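/- **Setting.** Fix $\eta\ge 1$, $0<\underline m<\overline m$, $0<\underline f<\overline f$, and let $\Theta=[\underline m,\overline m]\times[\underline f,\overline f]$ be the set of types $\theta=(m,f)$. A contract is a pair $(p,q)\in\mathcal C=[0,\infty)\times[0,1]$ (price, quality); supplying it gives type $\theta$ the profit $\pi(\theta,p,q)=p-mq^\eta-f$. A scoring rule is a smooth function $\Phi:\mathcal C\to\mathbb R$ that is strictly decreasing in $p$ and strictly increasing in $q$. Let $\mathcal G$ be the set of a.e. positive probability densities on $\Theta$ (with respect to Lebesgue measure). In the first-score auction with rule $\Phi$, two sellers with types drawn i.i.d. from $g\in\mathcal G$ each bid a contract; the bid with the highest score wins (ties are broken by a fair coin) and the winner supplies the contract he bid. **Regularity.** Let $u(s,\theta)=\max\{\pi(\theta,p,q):(p,q)\in\mathcal C,\ \Phi(p,q)=s\}$, let $Q(s)=\{q\in[0,1]:\Phi(0,q)\ge s\}$, and for $q\in Q(s)$ let $P(s,q)\ge 0$ be the price with $\Phi(P(s,q),q)=s$. Assume: (a) For every score $s$, on the set of types $\theta\in\Theta$ with $u(s,\theta)>0$: $u$ is differentiable in the score, with derivative $u_1$,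 and $\frac{\partial}{\partial m}\big(\frac{u(s,\theta)}{u_1(s,\theta)}\big)$ exists, is continuous in $\theta$ and is strictly positive. (b) For every $s$ in the image of $\Phi$: for each $q\in[0,1]$ there is a price $p\geq 0$ with $\Phi(p,q)\le s$; $P(s,\cdot)$ is smooth and strictly concave on $Q(s)$, with $P_{qq}<0$ in the interior; $P_q(s,0)>\overline m$ if $0\in Q(s)$; and $P_q(s,1)<\underline m$ if $s<\Phi(0,1)$. **Equilibrium.** Let $(p^*,q^*):\Theta\times\mathcal G\to\mathcal C$ be a strategy such that for every $g\in\mathcal G$ the bids $(p^*,q^*)(\cdot,g)$ form a symmetric pure-strategy Bayes–Nash equilibrium of the first-score auction in which $g$ is commonly known (every type $\theta\in\Theta$ plays a best response). Let $s^*=\Phi\circ(p^*,q^*)$ be the score that is bid, and assume that $s^*((m,f),g)$ is continuous in $f\in[\underline f,\overline f]$ for all $m$ and $g$. **Coarse beliefs.** The strategy is an *$n$-moment strategy* if for every $\theta\in\Theta$ there are bounded measurable functions $\zeta^1_\theta,\dots,\zeta^n_\theta:\Theta\to\mathbb R$ and a function $\varphi_\theta$ with $$(p^*,q^*)(\theta,g)=\varphi_\theta\big(M_\theta^1(g),\dots,M_\theta^n(g)\big)\quad\text{for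 all }g\in\mathcal G,\qquad M_\theta^i(g)=\int_\Theta\zeta_\theta^i(\tau)g(\tau)\,d\tau,$$ where $\varphi_\theta$ is differentiable on the set of vectors $(M^1_\theta(g),\dots,M^n_\theta(g))$, $g\in\mathcal G$. The auction *admits a coarse beliefs equilibrium* if its equilibrium strategy is an $n$-moment strategy for some finite $n$. **Proposition.** If the first-score auction admits a coarse beliefs equilibrium, then it satisfies *equilibrium invariance*: for all $g_1,g_2\in\mathcal G$ and all $\theta_1,\theta_2\in\Theta$, $$s^*(\theta_1,g_1)\ge s^*(\theta_2,g_1)\iff s^*(\theta_1,g_2)\ge s^*(\theta_2,g_2).$$ -/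

import Mathlib

open Set MeasureTheory
open scoped ContDiff

noncomputable section

namespace ScoreAuction

/-- The set of contracts `(p, q)`: a nonnegative price and a quality in `[0, 1]`. -/
def contracts : Set (ℝ × ℝ) := Ici 0 ×ˢ Icc 0 1

/-- A scoring rule: smooth on the set of contracts, strictly decreasing in the price and strictly
increasing in the quality. -/
structure IsScoringRule (Φ : ℝ × ℝ → ℝ) : Prop where
  smooth : ContDiffOn ℝ ∞ Φ contracts
  price_anti : ∀ q ∈ Icc (0 : ℝ) 1, StrictAntiOn (fun p => Φ (p, q)) (Ici 0)
  quality_mono : ∀ p ∈ Ici (0 : ℝ), StrictMonoOn (fun q => Φ (p, q)) (Icc 0 1)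

/-- The primitives of the sellers: the convexity parameter `η` of the cost function and the
endpoints of the ranges of marginal costs and of fixed costs. -/
structure Sellers where
  η : ℝ
  mLo : ℝ
  mHi : ℝ
  fLo : ℝ
  fHi : ℝ
  one_le_η : 1 ≤ η
  mLo_pos : 0 < mLo
  mLo_lt : mLo < mHi
  fLo_pos : 0 < fLo
  fLo_lt : fLo < fHi

namespace Sellers

variable (E : Sellers)

/-- The type space: pairs `θ = (m, f)` of a marginal cost and a fixed cost. -/
def types : Set (ℝ × ℝ) := Icc E.mLo E.mHi ×ˢ Icc E.fLo E.fHi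

/-- The profit of type `θ` when he supplies the contract `c`. -/
def profit (θ c : ℝ × ℝ) : ℝ := c.1 - (θ.1 * c.2 ^ E.η + θ.2)

/-- The type distributions: the almost everywhere positive probability densities, with respect to
Lebesgue measure, on the type space. -/
def densities : Set (ℝ × ℝ → ℝ) :=
  {g | IntegrableOn g E.types ∧ (∀ᵐ τ ∂(volume.restrict E.types), 0 < g τ) ∧
    ∫ τ in E.types, g τ = 1}

/-- The expectation of `ζ` under the density `g`. It is a moment of `g` if `ζ` is measurable and
bounded on the type space. -/
def moment (ζ g : ℝ × ℝ → ℝ) : ℝ := ∫ τ in E.types, ζ τ * g τ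

/-- The indirect utility `u(s, θ)`: the largest profit that type `θ` can make by supplying a
contract of score `s`. -/
def utility (Φ : ℝ × ℝ → ℝ) (s : ℝ) (θ : ℝ × ℝ) : ℝ :=
  sSup {x | ∃ c ∈ contracts, Φ c = s ∧ x = E.profit θ c}

/-- The quotient `u / u₁` of the indirect utility by its derivative in the score. -/
def utilityRatio (Φ : ℝ × ℝ → ℝ) (s : ℝ) (θ : ℝ × ℝ) : ℝ :=
  E.utility Φ s θ / deriv (fun t => E.utility Φ t θ) s

/-- The derivative of `u / u₁` in the marginal cost (one-sided at the ends of the range). -/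
def utilityRatioDeriv (Φ : ℝ × ℝ → ℝ) (s : ℝ) (θ : ℝ × ℝ) : ℝ :=
  derivWithin (fun m => E.utilityRatio Φ s (m, θ.2)) (Icc E.mLo E.mHi) θ.1

end Sellers

/-- The price `P(s, q)` that gives a bid of quality `q` the score `s`. It solves
`Φ (P(s, q), q) = s` for the qualities in `feasible Φ s`. -/
def price (Φ : ℝ × ℝ → ℝ) (s q : ℝ) : ℝ := sInf {p | 0 ≤ p ∧ Φ (p, q) ≤ s}

/-- The qualities with which a score of `s` can be reached at a nonnegative price. -/
def feasible (Φ : ℝ × ℝ → ℝ) (s : ℝ) : Set ℝ := {q | q ∈ Icc (0 : ℝ) 1 ∧ s ≤ Φ (0, q)}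

/-- The regularity conditions on the scoring rule: single crossing (the first three fields, at the
scores with which a type can make a profit) and a well-behaved choice of the quality (the other
fields). -/
structure IsRegular (E : Sellers) (Φ : ℝ × ℝ → ℝ) : Prop where
  utility_diff : ∀ s, ∀ θ ∈ E.types, 0 < E.utility Φ s θ →
    DifferentiableAt ℝ (fun t => E.utility Φ t θ) s ∧
    DifferentiableWithinAt ℝ (fun m => E.utilityRatio Φ s (m, θ.2)) (Icc E.mLo E.mHi) θ.1
  ratioDeriv_cont : ∀ s,
    ContinuousOn (E.utilityRatioDeriv Φ s) {θ | θ ∈ E.types ∧ 0 < E.utility Φ s θ}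
  ratioDeriv_pos : ∀ s, ∀ θ ∈ E.types, 0 < E.utility Φ s θ → 0 < E.utilityRatioDeriv Φ s θ
  price_finite : ∀ s ∈ Φ '' contracts, ∀ q ∈ Icc (0 : ℝ) 1, ∃ p, 0 ≤ p ∧ Φ (p, q) ≤ s
  price_concave : ∀ s ∈ Φ '' contracts, StrictConcaveOn ℝ (feasible Φ s) (price Φ s)
  price_smooth : ∀ s ∈ Φ '' contracts, ContDiffOn ℝ ∞ (price Φ s) (feasible Φ s)
  price_second : ∀ s ∈ Φ '' contracts, ∀ q ∈ interior (feasible Φ s),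
    deriv (deriv (price Φ s)) q < 0
  price_left : ∀ s ∈ Φ '' contracts, 0 ∈ feasible Φ s →
    E.mHi < derivWithin (price Φ s) (feasible Φ s) 0
  price_right : ∀ s ∈ Φ '' contracts, s < Φ (0, 1) →
    derivWithin (price Φ s) (feasible Φ s) 1 < E.mLo

open Classical in
/-- The probability that a bid of score `s` wins against an opponent whose type has density `g`
and who bids according to `b`. Ties are broken by a fair coin. -/
def winProb (E : Sellers) (Φ : ℝ × ℝ → ℝ) (g : ℝ × ℝ → ℝ) (b : ℝ × ℝ → ℝ × ℝ) (s : ℝ) : ℝ :=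
  ∫ τ in E.types, (if Φ (b τ) < s then 1 else if Φ (b τ) = s then 1 / 2 else 0) * g τ

/-- The expected payoff of type `θ` from bidding the contract `c`. -/
def payoff (E : Sellers) (Φ : ℝ × ℝ → ℝ) (g : ℝ × ℝ → ℝ) (b : ℝ × ℝ → ℝ × ℝ)
    (θ c : ℝ × ℝ) : ℝ :=
  winProb E Φ g b (Φ c) * E.profit θ c

/-- `b` is a symmetric pure-strategy Bayes-Nash equilibrium of the first-score auction in which
the density `g` of types is commonly known. -/
structure IsEquilibrium (E : Sellers) (Φ : ℝ × ℝ → ℝ) (g : ℝ × ℝ → ℝ)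
    (b : ℝ × ℝ → ℝ × ℝ) : Prop where
  measurable : AEMeasurable (fun τ => Φ (b τ)) (volume.restrict E.types)
  bid_mem : ∀ θ ∈ E.types, b θ ∈ contracts
  best : ∀ θ ∈ E.types, ∀ c ∈ contracts, payoff E Φ g b θ c ≤ payoff E Φ g b θ (b θ)

/-- `strat g θ` is the contract bid by type `θ` at the density `g`. The strategy is an equilibrium
strategy if it is an equilibrium of the common prior game at every density. -/
def IsEquilibriumStrategy (E : Sellers) (Φ : ℝ × ℝ → ℝ)
    (strat : (ℝ × ℝ → ℝ) → ℝ × ℝ → ℝ × ℝ) : Prop :=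
  ∀ g ∈ E.densities, IsEquilibrium E Φ g (strat g)

/-- At every density, the score that is bid depends continuously on the fixed cost. -/
def ScoreContinuousInFixedCost (E : Sellers) (Φ : ℝ × ℝ → ℝ)
    (strat : (ℝ × ℝ → ℝ) → ℝ × ℝ → ℝ × ℝ) : Prop :=
  ∀ g ∈ E.densities, ∀ m ∈ Icc E.mLo E.mHi,
    ContinuousOn (fun f => Φ (strat g (m, f))) (Icc E.fLo E.fHi)

/-- `strat` is an `n`-moment strategy: the bid of each type `θ` is a function `φ`, differentiable
on the set of moment vectors that can occur, of the values of `n` moments at the density. Both the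
moments and the function may depend on `θ`, but not on the density. -/
def IsMomentStrategy (E : Sellers) (n : ℕ)
    (strat : (ℝ × ℝ → ℝ) → ℝ × ℝ → ℝ × ℝ) : Prop :=
  ∀ θ ∈ E.types, ∃ (ζ : Fin n → ℝ × ℝ → ℝ) (φ : (Fin n → ℝ) → ℝ × ℝ),
    (∀ i, Measurable (ζ i) ∧ ∃ B : ℝ, ∀ τ ∈ E.types, |ζ i τ| ≤ B) ∧
    DifferentiableOn ℝ φ ((fun g i => E.moment (ζ i) g) '' E.densities) ∧
    ∀ g ∈ E.densities, strat g θ = φ (fun i => E.moment (ζ i) g)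

/-- The order on types implemented at the density `g`: `θ₁` bids at least the score of `θ₂`. -/
def RanksAbove (Φ : ℝ × ℝ → ℝ) (strat : (ℝ × ℝ → ℝ) → ℝ × ℝ → ℝ × ℝ) (g : ℝ × ℝ → ℝ)
    (θ₁ θ₂ : ℝ × ℝ) : Prop :=
  Φ (strat g θ₂) ≤ Φ (strat g θ₁)

/-- Equilibrium invariance: the implemented order is the same at all densities. -/
def EquilibriumInvariance (E : Sellers) (Φ : ℝ × ℝ → ℝ)
    (strat : (ℝ × ℝ → ℝ) → ℝ × ℝ → ℝ × ℝ) : Prop :=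
  ∀ g₁ ∈ E.densities, ∀ g₂ ∈ E.densities, ∀ θ₁ ∈ E.types, ∀ θ₂ ∈ E.types,
    RanksAbove Φ strat g₁ θ₁ θ₂ ↔ RanksAbove Φ strat g₂ θ₁ θ₂

end ScoreAuction

end

/-!
Fix a density `g` and write `S θ` for the score bid by the type `θ = (m, f)`, `W` for the winning
probability as a function of the score, and `v - f` for the indirect utility.

**One density.** Scores have no atom, every type with a fixed cost below the maximum makes a profit,
and single crossing makes `S` antitone in the type. Since `S` is continuous in the fixed cost, best
responses of types with an interior fixed cost are unique. It follows that `S` is jointly continuous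
at these types, that it is strictly decreasing in the fixed cost, and that the first-order condition
`(log W)' = -u₁ / u` holds at the score bid (`hasDerivAt_log_winProb`). Hence the set of the types
who bid less than a score `s = S θ` is determined by `θ` and `s` alone: it consists of the types
whose utility decays at `s` faster than that of `θ` (`score_lt_iff`).

**Perturbing the density.** Add mass on a set `X` of types who bid slightly less than
`θ = (m, f)`, in such a way that the scores of `θ` and of `(m, f + δ)` do not change. Then `W` does
not change at the lower one of these scores, and rises by the mass that is added at the upper one.
By the first-order condition, in the short interval between the two scores the equilibrium bids have
to be displaced by a large multiple of that mass. The displaced types lose their opponents in a band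
whose mass is proportional to the displacement, so that `W` could not rise
(`eventually_score_ne`).

**Counting dimensions.** If the order of two interior types `θ` and `(m', f')` is reversed between
two densities, then by continuity along a segment of densities the type `θ` ties with each of
`2 n + 2` types `(m', y j)`, with `f' ≤ y j` increasing in `j`, at some density `G j`. Choose sets
`X j` of types close to `(m', y j)` who bid slightly less than `θ` at `G j`. At the later densities
`G i`, `i > j`, they bid at least as much as `θ`. Some nontrivial combination of the indicators of
the `X j` is orthogonal to the constants and to the `2 n` moments on which the bids of `θ` and
`(m, f + δ)` depend. Let `i` be the largest index in the combination. Among the types who bid less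
than `θ` at `G i` the combination only affects `X i`, and it leaves the bids of `θ` and `(m, f + δ)`
unchanged, which the previous paragraph excludes (`not_forall_score_eq`). Types on the boundary of
the type space are reached by continuity (`score_lt_of_score_lt`).
-/

namespace ScoreAuction

open Filter Topology

/-! ### Scores and the indirect utility -/

/-- The indirect utility gross of the fixed cost: the largest value of `p - m q ^ η` over the
contracts of score `s`. -/
noncomputable def Sellers.surplus (E : Sellers) (Φ : ℝ × ℝ → ℝ) (s m : ℝ) : ℝ :=
  E.utility Φ s (m, 0)

/-- The derivative of the surplus in the score. -/
noncomputable def Sellers.surplusDeriv (E : Sellers) (Φ : ℝ × ℝ → ℝ) (s m : ℝ) : ℝ :=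
  deriv (fun t => E.surplus Φ t m) s

/-- The quotient `-u₁ / u`, the rate at which the logarithm of the indirect utility falls in the
score. In an equilibrium it is the growth rate of the winning probability at the score bid. -/
noncomputable def Sellers.decay (E : Sellers) (Φ : ℝ × ℝ → ℝ) (s : ℝ) (θ : ℝ × ℝ) : ℝ :=
  -E.surplusDeriv Φ s θ.1 / (E.surplus Φ s θ.1 - θ.2)

/-- The pairs `(s, m)` of a score and a marginal cost such that a type with marginal cost `m`, and
a fixed cost low enough, can make a profit at the score `s`. -/
def Sellers.profitable (E : Sellers) (Φ : ℝ × ℝ → ℝ) : Set (ℝ × ℝ) :=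
  {x | x.1 ∈ Φ '' contracts ∧ x.2 ∈ Icc E.mLo E.mHi ∧ E.fLo < E.surplus Φ x.1 x.2}

theorem isClosed_contracts : IsClosed contracts := isClosed_Ici.prod isClosed_Icc

theorem convex_contracts : Convex ℝ contracts := (convex_Ici 0).prod (convex_Icc 0 1)

theorem continuous_profit (E : Sellers) :
    Continuous fun x : (ℝ × ℝ) × (ℝ × ℝ) => E.profit x.1 x.2 := by
  unfold Sellers.profit
  have : Continuous fun x : (ℝ × ℝ) × (ℝ × ℝ) => x.2.2 ^ E.η :=
    (Real.continuous_rpow_const (by linarith [E.one_le_η])).comp (by fun_prop)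
  fun_prop

theorem rpow_mem_Icc (E : Sellers) {c : ℝ × ℝ} (hc : c ∈ contracts) :
    c.2 ^ E.η ∈ Icc (0 : ℝ) 1 :=
  ⟨Real.rpow_nonneg hc.2.1 _, Real.rpow_le_one hc.2.1 hc.2.2 (by linarith [E.one_le_η])⟩

section Primitives

variable {E : Sellers} {Φ : ℝ × ℝ → ℝ}

theorem ordConnected_scores (hΦ : IsScoringRule Φ) : (Φ '' contracts).OrdConnected :=
  (convex_contracts.isPreconnected.image Φ hΦ.smooth.continuousOn).ordConnected

theorem score_le_top (hΦ : IsScoringRule Φ) {c : ℝ × ℝ} (hc : c ∈ contracts) :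
    Φ c ≤ Φ (0, 1) :=
  calc Φ c ≤ Φ (0, c.2) :=
        (hΦ.price_anti c.2 hc.2).antitoneOn (mem_Ici.2 le_rfl) hc.1 hc.1
    _ ≤ Φ (0, 1) := (hΦ.quality_mono 0 (mem_Ici.2 le_rfl)).monotoneOn hc.2 ⟨zero_le_one, le_rfl⟩
        hc.2.2

/-- A contract can be turned into one of lower score and the same quality by raising the price. -/
theorem exists_price (hΦ : IsScoringRule Φ) (hreg : IsRegular E Φ) {s : ℝ}
    (hs : s ∈ Φ '' contracts) {c : ℝ × ℝ} (hc : c ∈ contracts) (h : s < Φ c) :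
    ∃ p, c.1 < p ∧ Φ (p, c.2) = s := by
  obtain ⟨p₁, hp₁, h₁⟩ := hreg.price_finite s hs c.2 hc.2
  have hlt : c.1 < p₁ := by
    by_contra! hle
    have := (hΦ.price_anti c.2 hc.2).antitoneOn (mem_Ici.2 hp₁) hc.1 hle
    simp only [Prod.mk.eta] at this
    linarith
  have hcont : ContinuousOn (fun p => Φ (p, c.2)) (Icc c.1 p₁) :=
    hΦ.smooth.continuousOn.comp (by fun_prop) fun p hp => ⟨le_trans hc.1 hp.1, hc.2⟩
  obtain ⟨p, hp, hps⟩ := intermediate_value_Icc' hlt.le hcont ⟨h₁, h.le⟩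
  refine ⟨p, lt_of_le_of_ne hp.1 ?_, hps⟩
  rintro rfl
  simp only [Prod.mk.eta] at hps
  linarith

theorem exists_lower_score (hΦ : IsScoringRule Φ) {s : ℝ} (hs : s ∈ Φ '' contracts) :
    ∃ t ∈ Φ '' contracts, t < s := by
  obtain ⟨c, hc, rfl⟩ := hs
  have hc' : (c.1 + 1, c.2) ∈ contracts := ⟨le_trans hc.1 (lt_add_one c.1).le, hc.2⟩
  exact ⟨_, ⟨_, hc', rfl⟩, hΦ.price_anti c.2 hc.2 hc.1 hc'.1 (by simp)⟩

theorem price_bounded (hΦ : IsScoringRule Φ) (hreg : IsRegular E Φ) {s : ℝ}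
    (hs : s ∈ Φ '' contracts) :
    ∃ B, ∀ c ∈ contracts, s ≤ Φ c → c ∈ Icc (0 : ℝ) B ×ˢ Icc (0 : ℝ) 1 := by
  obtain ⟨B, hB, h⟩ := hreg.price_finite s hs 1 ⟨zero_le_one, le_rfl⟩
  refine ⟨B, fun c hc hsc => ⟨⟨hc.1, ?_⟩, hc.2⟩⟩
  by_contra! hlt
  have h1 : Φ c ≤ Φ (c.1, 1) :=
    (hΦ.quality_mono c.1 hc.1).monotoneOn hc.2 ⟨zero_le_one, le_rfl⟩ hc.2.2
  have h2 := hΦ.price_anti 1 ⟨zero_le_one, le_rfl⟩ (mem_Ici.2 hB) hc.1 hlt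
  simp only at h2
  linarith

/-- `c` is a contract of score `s` that maximizes the profit of the types with marginal cost
`m`. -/
def IsOptimal (E : Sellers) (Φ : ℝ × ℝ → ℝ) (s m : ℝ) (c : ℝ × ℝ) : Prop :=
  c ∈ contracts ∧ Φ c = s ∧ ∀ d ∈ contracts, Φ d = s → E.profit (m, 0) d ≤ E.profit (m, 0) c

theorem exists_isOptimal (hΦ : IsScoringRule Φ) (hreg : IsRegular E Φ) {s : ℝ}
    (hs : s ∈ Φ '' contracts) (m : ℝ) : ∃ c, IsOptimal E Φ s m c := by
  obtain ⟨B, hB⟩ := price_bounded hΦ hreg hs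
  have hK : IsCompact {c | c ∈ contracts ∧ Φ c = s} := by
    have hcl : IsClosed (contracts ∩ Φ ⁻¹' {s}) :=
      hΦ.smooth.continuousOn.preimage_isClosed_of_isClosed isClosed_contracts isClosed_singleton
    exact IsCompact.of_isClosed_subset (isCompact_Icc.prod isCompact_Icc) hcl
      fun c hc => hB c hc.1 (le_of_eq hc.2.symm)
  obtain ⟨c₀, hc₀⟩ := hs
  have hcont : ContinuousOn (fun c => E.profit (m, 0) c) {c | c ∈ contracts ∧ Φ c = s} :=
    ((continuous_profit E).comp (by fun_prop : Continuous fun c : ℝ × ℝ =>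
      (((m, 0) : ℝ × ℝ), c))).continuousOn
  obtain ⟨c, hc, hmax⟩ := hK.exists_isMaxOn ⟨c₀, hc₀⟩ hcont
  exact ⟨c, hc.1, hc.2, fun d hd hds => hmax ⟨hd, hds⟩⟩

theorem profit_eq (E : Sellers) (m f : ℝ) (c : ℝ × ℝ) :
    E.profit (m, f) c = E.profit (m, 0) c - f := by
  simp only [Sellers.profit]; ring

theorem IsOptimal.utility_eq {s m : ℝ} {c : ℝ × ℝ} (h : IsOptimal E Φ s m c) (f : ℝ) :
    E.utility Φ s (m, f) = E.profit (m, f) c := by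
  refine IsGreatest.csSup_eq ⟨⟨c, h.1, h.2.1, rfl⟩, ?_⟩
  rintro x ⟨d, hd, hds, rfl⟩
  rw [profit_eq, profit_eq E m f c]
  linarith [h.2.2 d hd hds]

theorem IsOptimal.surplus_eq {s m : ℝ} {c : ℝ × ℝ} (h : IsOptimal E Φ s m c) :
    E.surplus Φ s m = E.profit (m, 0) c := h.utility_eq 0

theorem utility_eq (hΦ : IsScoringRule Φ) (hreg : IsRegular E Φ) {s : ℝ}
    (hs : s ∈ Φ '' contracts) (m f : ℝ) : E.utility Φ s (m, f) = E.surplus Φ s m - f := by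
  obtain ⟨c, hc⟩ := exists_isOptimal hΦ hreg hs m
  rw [hc.surplus_eq, hc.utility_eq, profit_eq]

theorem profit_le_surplus (hΦ : IsScoringRule Φ) (hreg : IsRegular E Φ) {c : ℝ × ℝ}
    (hc : c ∈ contracts) (m f : ℝ) : E.profit (m, f) c ≤ E.surplus Φ (Φ c) m - f := by
  obtain ⟨d, hd⟩ := exists_isOptimal hΦ hreg (mem_image_of_mem Φ hc) m
  rw [hd.surplus_eq, profit_eq]
  linarith [hd.2.2 c hc rfl]

theorem mem_scores_of_utility_pos {s : ℝ} {θ : ℝ × ℝ} (h : 0 < E.utility Φ s θ) :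
    s ∈ Φ '' contracts := by
  by_contra hs
  have : {x | ∃ c ∈ contracts, Φ c = s ∧ x = E.profit θ c} = ∅ := by
    ext x
    simp only [mem_ofPred_eq, mem_empty_iff_false, iff_false]
    rintro ⟨c, hc, hcs, -⟩
    exact hs ⟨c, hc, hcs⟩
  rw [Sellers.utility, this, Real.sSup_empty] at h
  exact lt_irrefl _ h

theorem surplus_strictAntiOn (hΦ : IsScoringRule Φ) (hreg : IsRegular E Φ) (m : ℝ) :
    StrictAntiOn (fun s => E.surplus Φ s m) (Φ '' contracts) := by
  intro s hs t ht hst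
  obtain ⟨c, hc⟩ := exists_isOptimal hΦ hreg ht m
  obtain ⟨p, hp, hps⟩ := exists_price hΦ hreg hs hc.1 (by rw [hc.2.1]; exact hst)
  have h := profit_le_surplus (E := E) hΦ hreg
    (show (p, c.2) ∈ contracts from ⟨le_trans hc.1.1 hp.le, hc.1.2⟩) m 0
  rw [hps] at h
  simp only [hc.surplus_eq, Sellers.profit] at h ⊢
  linarith

theorem surplus_le_add (hΦ : IsScoringRule Φ) (hreg : IsRegular E Φ) {s : ℝ}
    (hs : s ∈ Φ '' contracts) {m m' : ℝ} (h : m ≤ m') :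
    E.surplus Φ s m ≤ E.surplus Φ s m' + (m' - m) := by
  obtain ⟨c, hc⟩ := exists_isOptimal hΦ hreg hs m
  have h1 := profit_le_surplus (E := E) hΦ hreg hc.1 m' 0
  rw [hc.2.1] at h1
  have h2 := rpow_mem_Icc E hc.1
  simp only [hc.surplus_eq, Sellers.profit] at h1 ⊢
  nlinarith [mul_nonneg (sub_nonneg.2 h) (sub_nonneg.2 h2.2)]

theorem surplus_antitone (hΦ : IsScoringRule Φ) (hreg : IsRegular E Φ) {s : ℝ}
    (hs : s ∈ Φ '' contracts) : Antitone fun m => E.surplus Φ s m := by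
  intro m m' h
  obtain ⟨c, hc⟩ := exists_isOptimal hΦ hreg hs m'
  have h1 := profit_le_surplus (E := E) hΦ hreg hc.1 m 0
  rw [hc.2.1] at h1
  have h2 := rpow_mem_Icc E hc.1
  simp only [hc.surplus_eq, Sellers.profit] at h1 ⊢
  nlinarith [mul_nonneg (sub_nonneg.2 h) h2.1]

theorem abs_surplus_sub_le (hΦ : IsScoringRule Φ) (hreg : IsRegular E Φ) {s : ℝ}
    (hs : s ∈ Φ '' contracts) (m m' : ℝ) :
    |E.surplus Φ s m - E.surplus Φ s m'| ≤ |m - m'| := by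
  wlog h : m ≤ m' generalizing m m'
  · rw [abs_sub_comm, abs_sub_comm m]
    exact this m' m (le_of_not_ge h)
  have h1 := surplus_le_add hΦ hreg hs h
  have h2 := surplus_antitone hΦ hreg hs h
  simp only at h2
  rw [abs_of_nonneg (by linarith), abs_sub_comm, abs_of_nonneg (by linarith)]
  linarith

theorem mem_types_of_profitable {s m : ℝ} (h : (s, m) ∈ E.profitable Φ) : (m, E.fLo) ∈ E.types :=
  ⟨h.2.1, le_rfl, E.fLo_lt.le⟩

theorem utility_pos_of_profitable (hΦ : IsScoringRule Φ) (hreg : IsRegular E Φ) {s m : ℝ}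
    (h : (s, m) ∈ E.profitable Φ) : 0 < E.utility Φ s (m, E.fLo) := by
  rw [utility_eq hΦ hreg h.1]
  exact sub_pos.2 h.2.2

theorem eventually_mem_scores (hΦ : IsScoringRule Φ) (hreg : IsRegular E Φ) {s m : ℝ}
    (h : (s, m) ∈ E.profitable Φ) : ∀ᶠ t in 𝓝 s, t ∈ Φ '' contracts := by
  have hpos := utility_pos_of_profitable hΦ hreg h
  have hd := (hreg.utility_diff s _ (mem_types_of_profitable h) hpos).1
  filter_upwards [hd.continuousAt.eventually (lt_mem_nhds hpos)] with t ht
  exact mem_scores_of_utility_pos ht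

theorem hasDerivAt_surplus (hΦ : IsScoringRule Φ) (hreg : IsRegular E Φ) {s m : ℝ}
    (h : (s, m) ∈ E.profitable Φ) :
    HasDerivAt (fun t => E.surplus Φ t m) (E.surplusDeriv Φ s m) s := by
  have hpos := utility_pos_of_profitable hΦ hreg h
  have hd := (hreg.utility_diff s _ (mem_types_of_profitable h) hpos).1
  refine DifferentiableAt.hasDerivAt ?_
  refine (hd.add_const E.fLo).congr_of_eventuallyEq ?_
  filter_upwards [eventually_mem_scores hΦ hreg h] with t ht
  rw [utility_eq hΦ hreg ht]; ring

/-- The derivative of the score in the price. -/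
noncomputable def scoreDeriv (Φ : ℝ × ℝ → ℝ) (c : ℝ × ℝ) : ℝ :=
  fderivWithin ℝ Φ contracts c (1, 0)

theorem uniqueDiffOn_contracts : UniqueDiffOn ℝ contracts :=
  (uniqueDiffOn_Ici 0).prod (uniqueDiffOn_Icc zero_lt_one)

theorem continuousOn_scoreDeriv (hΦ : IsScoringRule Φ) : ContinuousOn (scoreDeriv Φ) contracts :=
  (hΦ.smooth.continuousOn_fderivWithin uniqueDiffOn_contracts (by simp)).clm_apply
    continuousOn_const

theorem hasDerivAt_score (hΦ : IsScoringRule Φ) {c : ℝ × ℝ} (hc : c ∈ contracts)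
    (h : 0 < c.1) : HasDerivAt (fun p => Φ (p, c.2)) (scoreDeriv Φ c) c.1 := by
  have h1 : HasFDerivWithinAt Φ (fderivWithin ℝ Φ contracts c) contracts (c.1, c.2) :=
    ((hΦ.smooth.differentiableOn (by simp)) c hc).hasFDerivWithinAt
  have h2 : HasDerivWithinAt (fun p : ℝ => (p, c.2)) ((1 : ℝ), (0 : ℝ)) (Ici 0) c.1 :=
    ((hasDerivAt_id c.1).prodMk (hasDerivAt_const c.1 c.2)).hasDerivWithinAt
  have h3 : MapsTo (fun p : ℝ => (p, c.2)) (Ici 0) contracts := fun p hp => ⟨hp, hc.2⟩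
  exact (h1.comp_hasDerivWithinAt c.1 h2 h3).hasDerivAt (Ici_mem_nhds h)

/-- The envelope theorem: the function `p ↦ v (Φ (p, q)) - p` is smallest at the price of an
optimal contract `(p, q)`, so that its derivative vanishes there. -/
theorem surplusDeriv_mul_scoreDeriv (hΦ : IsScoringRule Φ) (hreg : IsRegular E Φ) {s m : ℝ}
    (h : (s, m) ∈ E.profitable Φ) {c : ℝ × ℝ} (hc : IsOptimal E Φ s m c) :
    0 < c.1 ∧ E.surplusDeriv Φ s m * scoreDeriv Φ c = 1 := by
  have hpos : 0 < c.1 := by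
    have h1 := h.2.2
    have h2 := rpow_mem_Icc E hc.1
    simp only [hc.surplus_eq, Sellers.profit] at h1
    nlinarith [E.fLo_pos, mul_nonneg (E.mLo_pos.le.trans h.2.1.1) h2.1]
  refine ⟨hpos, ?_⟩
  have hv : HasDerivAt (fun t => E.surplus Φ t m) (E.surplusDeriv Φ s m) (Φ (c.1, c.2)) := by
    have := hasDerivAt_surplus hΦ hreg h
    rwa [← hc.2.1] at this ⊢
  have hd : HasDerivAt (fun p => E.surplus Φ (Φ (p, c.2)) m - p)
      (E.surplusDeriv Φ s m * scoreDeriv Φ c - 1) c.1 := by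
    have hcomp : HasDerivAt (fun p => E.surplus Φ (Φ (p, c.2)) m)
        (E.surplusDeriv Φ s m * scoreDeriv Φ c) c.1 :=
      HasDerivAt.comp (h₂ := fun t => E.surplus Φ t m) (h := fun p => Φ (p, c.2)) c.1 hv
        (hasDerivAt_score hΦ hc.1 hpos)
    exact hcomp.fun_sub (hasDerivAt_id' c.1)
  have hmin : IsLocalMin (fun p => E.surplus Φ (Φ (p, c.2)) m - p) c.1 := by
    filter_upwards [lt_mem_nhds hpos] with p hp
    have h1 := profit_le_surplus (E := E) hΦ hreg
      (show (p, c.2) ∈ contracts from ⟨hp.le, hc.1.2⟩) m 0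
    have h2 := hc.surplus_eq
    rw [← hc.2.1] at h2
    simp only [Sellers.profit] at h1 h2
    simp only [Prod.mk.eta]
    linarith
  linarith [hmin.hasDerivAt_eq_zero hd]

theorem surplusDeriv_neg (hΦ : IsScoringRule Φ) (hreg : IsRegular E Φ) {s m : ℝ}
    (h : (s, m) ∈ E.profitable Φ) : E.surplusDeriv Φ s m < 0 := by
  obtain ⟨c, hc⟩ := exists_isOptimal hΦ hreg h.1 m
  obtain ⟨hpos, hmul⟩ := surplusDeriv_mul_scoreDeriv hΦ hreg h hc
  have hanti : AntitoneOn (fun p => Φ (p, c.2)) (Ici 0) :=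
    (hΦ.price_anti c.2 hc.1.2).antitoneOn
  have hle : scoreDeriv Φ c ≤ 0 := by
    rw [← (hasDerivAt_score hΦ hc.1 hpos).deriv,
      ← derivWithin_of_mem_nhds (Ici_mem_nhds hpos)]
    exact hanti.derivWithin_nonpos
  by_contra! h0
  nlinarith [mul_nonneg h0 (neg_nonneg.2 hle)]

/-- Optimal contracts accumulate, and their limits are again of the limiting score. -/
theorem exists_limit_contract (hΦ : IsScoringRule Φ) (hreg : IsRegular E Φ)
    {ι : Type*} {𝒰 : Ultrafilter ι} {σ : ι → ℝ} {s : ℝ} (hs : s ∈ Φ '' contracts)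
    (hσ : Tendsto σ 𝒰 (𝓝 s)) {C : ι → ℝ × ℝ} (hC : ∀ᶠ i in (𝒰 : Filter ι), C i ∈ contracts)
    (hCσ : ∀ᶠ i in (𝒰 : Filter ι), Φ (C i) = σ i) :
    ∃ c ∈ contracts, Φ c = s ∧ Tendsto C 𝒰 (𝓝[contracts] c) := by
  obtain ⟨t, ht, hts⟩ := exists_lower_score hΦ hs
  obtain ⟨B, hB⟩ := price_bounded hΦ hreg ht
  have hmem : ∀ᶠ i in (𝒰 : Filter ι), C i ∈ Icc (0 : ℝ) B ×ˢ Icc (0 : ℝ) 1 := by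
    filter_upwards [hC, hCσ, hσ.eventually (lt_mem_nhds hts)] with i h1 h2 h3
    exact hB _ h1 (by rw [h2]; exact h3.le)
  obtain ⟨c, -, hc⟩ := (isCompact_Icc.prod isCompact_Icc).ultrafilter_le_nhds (𝒰.map C)
    (le_principal_iff.2 hmem)
  have hlim : Tendsto C 𝒰 (𝓝 c) := hc
  have hcc : c ∈ contracts := isClosed_contracts.mem_of_tendsto hlim hC
  have hlim' : Tendsto C 𝒰 (𝓝[contracts] c) := tendsto_nhdsWithin_iff.2 ⟨hlim, hC⟩
  refine ⟨c, hcc, ?_, hlim'⟩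
  refine tendsto_nhds_unique ((hΦ.smooth.continuousOn c hcc).tendsto.comp hlim') ?_
  exact hσ.congr' (hCσ.mono fun i hi => hi.symm)

theorem tendsto_profit {ι : Type*} {l : Filter ι} {μ : ι → ℝ} {m : ℝ} (hμ : Tendsto μ l (𝓝 m))
    {C : ι → ℝ × ℝ} {c : ℝ × ℝ} (hC : Tendsto C l (𝓝 c)) :
    Tendsto (fun i => E.profit (μ i, 0) (C i)) l (𝓝 (E.profit (m, 0) c)) :=
  (continuous_profit E).continuousAt.tendsto.comp
    ((hμ.prodMk_nhds tendsto_const_nhds).prodMk_nhds hC)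

/-- The surplus is upper semicontinuous. -/
theorem le_surplus_of_tendsto (hΦ : IsScoringRule Φ) (hreg : IsRegular E Φ)
    {ι : Type*} {𝒰 : Ultrafilter ι} {σ μ : ι → ℝ} {s m b : ℝ} (hs : s ∈ Φ '' contracts)
    (hσ : Tendsto σ 𝒰 (𝓝 s)) (hμ : Tendsto μ 𝒰 (𝓝 m))
    (hmem : ∀ᶠ i in (𝒰 : Filter ι), σ i ∈ Φ '' contracts)
    (hb : ∀ᶠ i in (𝒰 : Filter ι), b ≤ E.surplus Φ (σ i) (μ i)) : b ≤ E.surplus Φ s m := by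
  have hC : ∀ i, ∃ c, σ i ∈ Φ '' contracts → IsOptimal E Φ (σ i) (μ i) c := by
    intro i
    by_cases h : σ i ∈ Φ '' contracts
    · obtain ⟨c, hc⟩ := exists_isOptimal (E := E) hΦ hreg h (μ i)
      exact ⟨c, fun _ => hc⟩
    · exact ⟨0, fun h' => absurd h' h⟩
  choose C hC using hC
  obtain ⟨c, hc, hcs, hlim⟩ := exists_limit_contract hΦ hreg hs hσ
    (hmem.mono fun i hi => (hC i hi).1) (hmem.mono fun i hi => (hC i hi).2.1)
  have h1 := profit_le_surplus (E := E) hΦ hreg hc m 0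
  rw [hcs, sub_zero] at h1
  refine le_trans (ge_of_tendsto (tendsto_profit hμ (tendsto_nhds_of_tendsto_nhdsWithin hlim)) ?_)
    h1
  filter_upwards [hmem, hb] with i hi hbi
  rwa [← (hC i hi).surplus_eq]

theorem continuousOn_surplus (hΦ : IsScoringRule Φ) (hreg : IsRegular E Φ) :
    ContinuousOn (fun x : ℝ × ℝ => E.surplus Φ x.1 x.2) (E.profitable Φ) := by
  rintro ⟨s, m⟩ h
  have h1 : Tendsto (fun x : ℝ × ℝ => E.surplus Φ x.1 m) (𝓝[E.profitable Φ] (s, m))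
      (𝓝 (E.surplus Φ s m)) :=
    (hasDerivAt_surplus hΦ hreg h).continuousAt.tendsto.comp
      (tendsto_nhdsWithin_of_tendsto_nhds continuous_fst.continuousAt)
  have h2 : Tendsto (fun x : ℝ × ℝ => E.surplus Φ x.1 x.2 - E.surplus Φ x.1 m)
      (𝓝[E.profitable Φ] (s, m)) (𝓝 0) := by
    have h3 : Tendsto (fun x : ℝ × ℝ => |x.2 - m|) (𝓝[E.profitable Φ] (s, m)) (𝓝 0) := by
      refine tendsto_nhdsWithin_of_tendsto_nhds ?_
      have : Continuous fun x : ℝ × ℝ => |x.2 - m| := by fun_prop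
      simpa using this.tendsto (s, m)
    refine squeeze_zero_norm' ?_ h3
    filter_upwards [self_mem_nhdsWithin] with x hx
    exact abs_surplus_sub_le hΦ hreg hx.1 _ _
  simpa [ContinuousWithinAt] using h2.add h1

theorem continuousOn_surplusDeriv (hΦ : IsScoringRule Φ) (hreg : IsRegular E Φ) :
    ContinuousOn (fun x : ℝ × ℝ => E.surplusDeriv Φ x.1 x.2) (E.profitable Φ) := by
  rintro ⟨s, m⟩ h
  rw [ContinuousWithinAt, tendsto_iff_ultrafilter]
  intro 𝒰 h𝒰
  have hmem : ∀ᶠ x in (𝒰 : Filter (ℝ × ℝ)), x ∈ E.profitable Φ :=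
    h𝒰 self_mem_nhdsWithin
  have hlim : Tendsto (fun x : ℝ × ℝ => x) 𝒰 (𝓝 (s, m)) := h𝒰.trans nhdsWithin_le_nhds
  have hσ : Tendsto (fun x : ℝ × ℝ => x.1) 𝒰 (𝓝 s) := (continuous_fst.tendsto (s, m)).comp hlim
  have hμ : Tendsto (fun x : ℝ × ℝ => x.2) 𝒰 (𝓝 m) := (continuous_snd.tendsto (s, m)).comp hlim
  have hC : ∀ x : ℝ × ℝ, ∃ c, x ∈ E.profitable Φ → IsOptimal E Φ x.1 x.2 c := by
    intro x
    by_cases hx : x ∈ E.profitable Φ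
    · obtain ⟨c, hc⟩ := exists_isOptimal (E := E) hΦ hreg hx.1 x.2
      exact ⟨c, fun _ => hc⟩
    · exact ⟨0, fun h' => absurd h' hx⟩
  choose C hC using hC
  obtain ⟨c, hc, hcs, hCc⟩ := exists_limit_contract hΦ hreg h.1 hσ
    (hmem.mono fun i hi => (hC i hi).1) (hmem.mono fun i hi => (hC i hi).2.1)
  -- The limit of the optimal contracts is optimal, as its profit is the limit of the surpluses.
  have hopt : IsOptimal E Φ s m c := by
    refine ⟨hc, hcs, fun d hd hds => ?_⟩
    have h1 := profit_le_surplus (E := E) hΦ hreg hd m 0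
    rw [hds, sub_zero] at h1
    refine h1.trans (le_of_eq ?_)
    have h2 : Tendsto (fun x : ℝ × ℝ => E.surplus Φ x.1 x.2) 𝒰 (𝓝 (E.surplus Φ s m)) :=
      (continuousOn_surplus hΦ hreg (s, m) h).tendsto.mono_left h𝒰
    refine tendsto_nhds_unique h2
      ((tendsto_profit hμ (tendsto_nhds_of_tendsto_nhdsWithin hCc)).congr' ?_)
    filter_upwards [hmem] with x hx
    exact ((hC x hx).surplus_eq).symm
  have heq : ∀ {x : ℝ × ℝ} {d : ℝ × ℝ}, x ∈ E.profitable Φ → IsOptimal E Φ x.1 x.2 d →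
      E.surplusDeriv Φ x.1 x.2 = (scoreDeriv Φ d)⁻¹ := fun hx hd =>
    eq_inv_of_mul_eq_one_left (surplusDeriv_mul_scoreDeriv hΦ hreg hx hd).2
  have hne : scoreDeriv Φ c ≠ 0 :=
    right_ne_zero_of_mul_eq_one (surplusDeriv_mul_scoreDeriv hΦ hreg h hopt).2
  have h3 : E.surplusDeriv Φ s m = (scoreDeriv Φ c)⁻¹ := heq h hopt
  simp only [h3]
  refine ((((continuousOn_scoreDeriv hΦ) c hc).tendsto.comp hCc).inv₀ hne).congr' ?_
  filter_upwards [hmem] with x hx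
  exact (heq hx (hC x hx)).symm

theorem eventually_profitable (hΦ : IsScoringRule Φ) (hreg : IsRegular E Φ) {s m : ℝ}
    (h : (s, m) ∈ E.profitable Φ) :
    ∀ᶠ x in 𝓝[univ ×ˢ Icc E.mLo E.mHi] (s, m), x ∈ E.profitable Φ := by
  have h0 : 0 < (E.surplus Φ s m - E.fLo) / 2 := by linarith [h.2.2]
  have h1 : ∀ᶠ x in 𝓝 (s, m), x.1 ∈ Φ '' contracts :=
    (continuous_fst.tendsto (s, m)).eventually (eventually_mem_scores hΦ hreg h)
  have h2 : ∀ᶠ x in 𝓝 (s, m), E.surplus Φ s m - (E.surplus Φ s m - E.fLo) / 2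
      < E.surplus Φ x.1 m :=
    ((hasDerivAt_surplus hΦ hreg h).continuousAt.tendsto.comp
      (continuous_fst.tendsto (s, m))).eventually (lt_mem_nhds (by linarith))
  have h3 : ∀ᶠ x : ℝ × ℝ in 𝓝 (s, m), |x.2 - m| < (E.surplus Φ s m - E.fLo) / 2 := by
    have : Continuous fun x : ℝ × ℝ => |x.2 - m| := by fun_prop
    exact this.continuousAt.eventually (gt_mem_nhds (by simpa using h0))
  filter_upwards [nhdsWithin_le_nhds h1, nhdsWithin_le_nhds h2, nhdsWithin_le_nhds h3,
    self_mem_nhdsWithin] with x hx1 hx2 hx3 hx4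
  refine ⟨hx1, hx4.2, ?_⟩
  have := (abs_le.1 (abs_surplus_sub_le (E := E) hΦ hreg hx1 x.2 m)).1
  linarith

theorem profitable_of_lt {s m f : ℝ} (hs : s ∈ Φ '' contracts) (hθ : (m, f) ∈ E.types)
    (h : f < E.surplus Φ s m) : (s, m) ∈ E.profitable Φ :=
  ⟨hs, hθ.1, lt_of_le_of_lt hθ.2.1 h⟩

end Primitives

/-! ### Single crossing -/

section SingleCrossing

variable {E : Sellers} {Φ : ℝ × ℝ → ℝ}

theorem decay_pos (hΦ : IsScoringRule Φ) (hreg : IsRegular E Φ) {s m f : ℝ}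
    (hs : s ∈ Φ '' contracts) (hθ : (m, f) ∈ E.types) (h : f < E.surplus Φ s m) :
    0 < E.decay Φ s (m, f) :=
  div_pos (neg_pos.2 (surplusDeriv_neg hΦ hreg (profitable_of_lt hs hθ h))) (sub_pos.2 h)

theorem decay_lt_of_fixed_lt (hΦ : IsScoringRule Φ) (hreg : IsRegular E Φ) {s m f f' : ℝ}
    (hs : s ∈ Φ '' contracts) (hθ : (m, f) ∈ E.types) (hf : f < f') (h : f' < E.surplus Φ s m) :
    E.decay Φ s (m, f) < E.decay Φ s (m, f') := by
  have h1 := surplusDeriv_neg hΦ hreg (profitable_of_lt hs hθ (hf.trans h))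
  exact div_lt_div_of_pos_left (neg_pos.2 h1) (sub_pos.2 h) (by simp only; linarith)

theorem utilityRatio_eq (hΦ : IsScoringRule Φ) (hreg : IsRegular E Φ) {s m f : ℝ}
    (hs : s ∈ Φ '' contracts) (hθ : (m, f) ∈ E.types) (h : f < E.surplus Φ s m) :
    E.utilityRatio Φ s (m, f) = -(E.decay Φ s (m, f))⁻¹ := by
  have hp := profitable_of_lt hs hθ h
  have hd : deriv (fun t => E.utility Φ t (m, f)) s = E.surplusDeriv Φ s m := by
    refine (((hasDerivAt_surplus hΦ hreg hp).sub_const f).congr_of_eventuallyEq ?_).deriv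
    filter_upwards [eventually_mem_scores hΦ hreg hp] with t ht
    exact utility_eq hΦ hreg ht m f
  rw [Sellers.utilityRatio, hd, utility_eq hΦ hreg hs, Sellers.decay, inv_div, div_neg, neg_neg]

theorem decay_lt_of_marginal_lt (hΦ : IsScoringRule Φ) (hreg : IsRegular E Φ) {s m m' f : ℝ}
    (hs : s ∈ Φ '' contracts) (hθ : (m, f) ∈ E.types) (hθ' : (m', f) ∈ E.types) (hm : m < m')
    (h : f < E.surplus Φ s m') : E.decay Φ s (m, f) < E.decay Φ s (m', f) := by
  have hmem : ∀ μ ∈ Icc m m', (μ, f) ∈ E.types := fun μ hμ =>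
    ⟨⟨hθ.1.1.trans hμ.1, hμ.2.trans hθ'.1.2⟩, hθ.2⟩
  have hlt : ∀ μ ∈ Icc m m', f < E.surplus Φ s μ := fun μ hμ =>
    h.trans_le (surplus_antitone hΦ hreg hs hμ.2)
  have hpos : ∀ μ ∈ Icc m m', 0 < E.utility Φ s (μ, f) := fun μ hμ => by
    rw [utility_eq hΦ hreg hs]
    exact sub_pos.2 (hlt μ hμ)
  have hmono : StrictMonoOn (fun μ => E.utilityRatio Φ s (μ, f)) (Icc m m') := by
    refine strictMonoOn_of_deriv_pos (convex_Icc m m') (fun μ hμ => ?_) fun μ hμ => ?_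
    · exact (hreg.utility_diff s _ (hmem μ hμ) (hpos μ hμ)).2.continuousWithinAt.mono
        (Icc_subset_Icc hθ.1.1 hθ'.1.2)
    · rw [interior_Icc] at hμ
      have h1 := hreg.ratioDeriv_pos s _ (hmem μ (Ioo_subset_Icc_self hμ))
        (hpos μ (Ioo_subset_Icc_self hμ))
      rwa [Sellers.utilityRatioDeriv, derivWithin_of_mem_nhds (Icc_mem_nhds
        (hθ.1.1.trans_lt hμ.1) (hμ.2.trans_le hθ'.1.2))] at h1
  have h2 := hmono (left_mem_Icc.2 hm.le) (right_mem_Icc.2 hm.le) hm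
  simp only at h2
  rw [utilityRatio_eq hΦ hreg hs hθ (hlt m (left_mem_Icc.2 hm.le)),
    utilityRatio_eq hΦ hreg hs hθ' h, neg_lt_neg_iff] at h2
  exact (inv_lt_inv₀ (decay_pos hΦ hreg hs hθ' h)
    (decay_pos hΦ hreg hs hθ (hlt m (left_mem_Icc.2 hm.le)))).1 h2

theorem decay_lt_of_le (hΦ : IsScoringRule Φ) (hreg : IsRegular E Φ) {s : ℝ} {θ θ' : ℝ × ℝ}
    (hs : s ∈ Φ '' contracts) (hθ : θ ∈ E.types) (hθ' : θ' ∈ E.types) (hle : θ ≤ θ')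
    (hne : θ ≠ θ') (h : θ'.2 < E.surplus Φ s θ'.1) : E.decay Φ s θ < E.decay Φ s θ' := by
  obtain ⟨m, f⟩ := θ
  obtain ⟨m', f'⟩ := θ'
  obtain ⟨hm, hf⟩ : m ≤ m' ∧ f ≤ f' := hle
  have h1 : f' < E.surplus Φ s m := h.trans_le (surplus_antitone hΦ hreg hs hm)
  have hmid : (m, f') ∈ E.types := ⟨hθ.1, hθ'.2⟩
  rcases hm.eq_or_lt with rfl | hm
  · have hf : f < f' := lt_of_le_of_ne hf fun h => hne (by rw [h])
    exact decay_lt_of_fixed_lt hΦ hreg hs hθ hf h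
  · have h2 := decay_lt_of_marginal_lt hΦ hreg hs hmid hθ' hm h
    rcases hf.eq_or_lt with rfl | hf
    · exact h2
    · exact (decay_lt_of_fixed_lt hΦ hreg hs hθ hf h1).trans h2

theorem hasDerivAt_log_surplus (hΦ : IsScoringRule Φ) (hreg : IsRegular E Φ) {s : ℝ} {θ : ℝ × ℝ}
    (hs : s ∈ Φ '' contracts) (hθ : θ ∈ E.types) (h : θ.2 < E.surplus Φ s θ.1) :
    HasDerivAt (fun t => Real.log (E.surplus Φ t θ.1 - θ.2)) (-E.decay Φ s θ) s := by
  have h1 := ((hasDerivAt_surplus hΦ hreg (profitable_of_lt hs hθ h)).sub_const θ.2).log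
    (sub_pos.2 h).ne'
  rwa [Sellers.decay, neg_div, neg_neg]

/-- Single crossing: a type whose indirect utility decays faster along a range of scores has, in
relative terms, more to lose from the higher score. -/
theorem surplus_mul_lt (hΦ : IsScoringRule Φ) (hreg : IsRegular E Φ) {s t : ℝ} (hst : s < t)
    (hs : s ∈ Φ '' contracts) (ht : t ∈ Φ '' contracts) {θ θ' : ℝ × ℝ}
    (hθ : θ ∈ E.types) (hθ' : θ' ∈ E.types)
    (h : θ.2 < E.surplus Φ t θ.1) (h' : θ'.2 < E.surplus Φ t θ'.1)
    (hlt : ∀ r ∈ Icc s t, E.decay Φ r θ < E.decay Φ r θ') :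
    (E.surplus Φ t θ'.1 - θ'.2) * (E.surplus Φ s θ.1 - θ.2) <
      (E.surplus Φ s θ'.1 - θ'.2) * (E.surplus Φ t θ.1 - θ.2) := by
  have hmem : ∀ r ∈ Icc s t, r ∈ Φ '' contracts := fun r hr =>
    (ordConnected_scores hΦ).out hs ht hr
  have hu : ∀ {τ : ℝ × ℝ}, τ.2 < E.surplus Φ t τ.1 → ∀ r ∈ Icc s t, τ.2 < E.surplus Φ r τ.1 :=
    fun hτ r hr => hτ.trans_le ((surplus_strictAntiOn hΦ hreg _).antitoneOn (hmem r hr) ht hr.2)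
  have hd : ∀ r ∈ Icc s t, HasDerivAt (fun r => Real.log (E.surplus Φ r θ'.1 - θ'.2) -
      Real.log (E.surplus Φ r θ.1 - θ.2)) (-E.decay Φ r θ' - -E.decay Φ r θ) r := fun r hr =>
    (hasDerivAt_log_surplus hΦ hreg (hmem r hr) hθ' (hu h' r hr)).fun_sub
      (hasDerivAt_log_surplus hΦ hreg (hmem r hr) hθ (hu h r hr))
  have hanti := strictAntiOn_of_deriv_neg (convex_Icc s t)
    (fun r hr => (hd r hr).continuousAt.continuousWithinAt) fun r hr => by
      have hr' := interior_subset hr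
      rw [(hd r hr').deriv]
      linarith [hlt r hr']
  have h1 := hanti (left_mem_Icc.2 hst.le) (right_mem_Icc.2 hst.le) hst
  simp only at h1
  have p1 := sub_pos.2 (hu h s (left_mem_Icc.2 hst.le))
  have p2 := sub_pos.2 (hu h' s (left_mem_Icc.2 hst.le))
  have p3 := sub_pos.2 h
  have p4 := sub_pos.2 h'
  refine (Real.log_lt_log_iff (mul_pos p4 p1) (mul_pos p2 p3)).1 ?_
  rw [Real.log_mul p4.ne' p1.ne', Real.log_mul p2.ne' p3.ne']
  linarith

theorem continuousOn_decay (hΦ : IsScoringRule Φ) (hreg : IsRegular E Φ) {s m f : ℝ}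
    (hs : s ∈ Φ '' contracts) (hθ : (m, f) ∈ E.types) (h : f < E.surplus Φ s m) :
    ContinuousWithinAt (fun x : ℝ × (ℝ × ℝ) => E.decay Φ x.1 x.2) (univ ×ˢ E.types)
      (s, (m, f)) := by
  have hp := profitable_of_lt hs hθ h
  have hmaps : Tendsto (fun x : ℝ × (ℝ × ℝ) => (x.1, x.2.1)) (𝓝[univ ×ˢ E.types] (s, (m, f)))
      (𝓝[E.profitable Φ] (s, m)) := by
    refine tendsto_nhdsWithin_iff.2 ⟨?_, ?_⟩
    · refine tendsto_nhdsWithin_of_tendsto_nhds ?_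
      have : Continuous fun x : ℝ × (ℝ × ℝ) => (x.1, x.2.1) := by fun_prop
      exact this.tendsto (s, (m, f))
    · have h1 : Tendsto (fun x : ℝ × (ℝ × ℝ) => (x.1, x.2.1)) (𝓝[univ ×ˢ E.types] (s, (m, f)))
          (𝓝[univ ×ˢ Icc E.mLo E.mHi] (s, m)) := by
        refine ContinuousWithinAt.tendsto_nhdsWithin
          (f := fun x : ℝ × (ℝ × ℝ) => (x.1, x.2.1)) (x := (s, (m, f)))
          (by fun_prop) fun x hx => ⟨mem_univ _, hx.2.1⟩
      exact h1.eventually (eventually_profitable hΦ hreg hp)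
  have h1 := ((continuousOn_surplusDeriv hΦ hreg) _ hp).tendsto.comp hmaps
  have h2 := ((continuousOn_surplus hΦ hreg) _ hp).tendsto.comp hmaps
  have h3 : Tendsto (fun x : ℝ × (ℝ × ℝ) => x.2.2) (𝓝[univ ×ˢ E.types] (s, (m, f))) (𝓝 f) := by
    refine tendsto_nhdsWithin_of_tendsto_nhds ?_
    have : Continuous fun x : ℝ × (ℝ × ℝ) => x.2.2 := by fun_prop
    exact this.tendsto (s, (m, f))
  exact h1.neg.div (h2.sub h3) (sub_pos.2 h).ne'

end SingleCrossing

/-! ### The winning probability in an equilibrium -/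

/-- An equilibrium at a density `g`, with scores that are continuous in the fixed cost. -/
structure IsContinuousEquilibrium (E : Sellers) (Φ : ℝ × ℝ → ℝ) (g : ℝ × ℝ → ℝ)
    (b : ℝ × ℝ → ℝ × ℝ) : Prop extends IsEquilibrium E Φ g b where
  density : g ∈ E.densities
  continuousOn : ∀ m ∈ Icc E.mLo E.mHi,
    ContinuousOn (fun f => Φ (b (m, f))) (Icc E.fLo E.fHi)

/-- The distribution of types with density `g`. -/
noncomputable def Sellers.typeLaw (E : Sellers) (g : ℝ × ℝ → ℝ) : Measure (ℝ × ℝ) :=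
  (volume.restrict E.types).withDensity fun τ => ENNReal.ofReal (g τ)

/-- The distribution of the score that is bid by a random type. -/
noncomputable def scoreLaw (E : Sellers) (Φ : ℝ × ℝ → ℝ) (g : ℝ × ℝ → ℝ)
    (b : ℝ × ℝ → ℝ × ℝ) : Measure ℝ :=
  (E.typeLaw g).map fun τ => Φ (b τ)

theorem measurableSet_types (E : Sellers) : MeasurableSet E.types :=
  measurableSet_Icc.prod measurableSet_Icc

/-- A set of types that contains at most one type for each marginal cost is null. -/
theorem volume_eq_zero_of_subsingleton {T : Set (ℝ × ℝ)} (hT : NullMeasurableSet T)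
    (h : ∀ m, {f | (m, f) ∈ T}.Subsingleton) : volume T = 0 := by
  obtain ⟨T', hT', hm, hae⟩ := hT.exists_measurable_subset_ae_eq
  rw [← measure_congr hae, Measure.volume_eq_prod, Measure.measure_prod_null hm]
  refine Eventually.of_forall fun m => ?_
  exact Set.Subsingleton.measure_zero (fun x hx y hy => h m (hT' hx) (hT' hy)) _

section Density

variable {E : Sellers} {g : ℝ × ℝ → ℝ}

theorem isProbabilityMeasure_typeLaw (hg : g ∈ E.densities) :
    IsProbabilityMeasure (E.typeLaw g) := by
  constructor
  rw [Sellers.typeLaw, withDensity_apply _ MeasurableSet.univ, Measure.restrict_univ,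
    ← ofReal_integral_eq_lintegral_ofReal hg.1 (hg.2.1.mono fun τ h => h.le), hg.2.2,
    ENNReal.ofReal_one]

theorem typeLaw_absolutelyContinuous (E : Sellers) (g : ℝ × ℝ → ℝ) :
    E.typeLaw g ≪ volume.restrict E.types := withDensity_absolutelyContinuous _ _

theorem absolutelyContinuous_typeLaw (hg : g ∈ E.densities) :
    volume.restrict E.types ≪ E.typeLaw g :=
  withDensity_absolutelyContinuous' hg.1.aestronglyMeasurable.aemeasurable.ennreal_ofReal
    (hg.2.1.mono fun τ h => by simpa using h)

end Density

namespace IsContinuousEquilibrium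

variable {E : Sellers} {Φ : ℝ × ℝ → ℝ} {g : ℝ × ℝ → ℝ} {b : ℝ × ℝ → ℝ × ℝ}

theorem aemeasurable_typeLaw (H : IsContinuousEquilibrium E Φ g b) :
    AEMeasurable (fun τ => Φ (b τ)) (E.typeLaw g) :=
  H.measurable.mono_ac (typeLaw_absolutelyContinuous E g)

theorem isProbabilityMeasure_scoreLaw (H : IsContinuousEquilibrium E Φ g b) :
    IsProbabilityMeasure (scoreLaw E Φ g b) :=
  have := isProbabilityMeasure_typeLaw H.density
  Measure.isProbabilityMeasure_map H.aemeasurable_typeLaw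

theorem winProb_eq_law (H : IsContinuousEquilibrium E Φ g b) (s : ℝ) :
    winProb E Φ g b s =
      (scoreLaw E Φ g b).real (Iio s) + 1 / 2 * (scoreLaw E Φ g b).real {s} := by
  have := H.isProbabilityMeasure_scoreLaw
  classical
  set w : ℝ → ℝ := fun y => (Iio s).indicator 1 y + 1 / 2 * ({s} : Set ℝ).indicator 1 y with hw
  have hwm : Measurable w :=
    ((measurable_one.indicator measurableSet_Iio)).add
      ((measurable_one.indicator (measurableSet_singleton s)).const_mul _)
  have h1 : winProb E Φ g b s = ∫ τ, w (Φ (b τ)) ∂(E.typeLaw g) := by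
    rw [Sellers.typeLaw, integral_withDensity_eq_integral_toReal_smul₀
      H.density.1.aestronglyMeasurable.aemeasurable.ennreal_ofReal
      (Eventually.of_forall fun _ => ENNReal.ofReal_lt_top), winProb]
    refine integral_congr_ae ?_
    filter_upwards [H.density.2.1] with τ hτ
    rw [ENNReal.toReal_ofReal hτ.le, smul_eq_mul, mul_comm]
    congr 1
    rcases lt_trichotomy (Φ (b τ)) s with h | h | h
    · simp [hw, h, h.ne]
    · simp [hw, h]
    · simp [hw, h.not_gt, h.ne']
  rw [h1, ← integral_map (f := w) H.aemeasurable_typeLaw hwm.aestronglyMeasurable]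
  change ∫ y, w y ∂(scoreLaw E Φ g b) = _
  rw [hw, integral_add, integral_const_mul, integral_indicator_one measurableSet_Iio,
    integral_indicator_one (measurableSet_singleton s)]
  · exact (integrable_indicator_iff measurableSet_Iio).2 (integrable_const _).integrableOn
  · exact ((integrable_indicator_iff (measurableSet_singleton s)).2
      (integrable_const _).integrableOn).const_mul _

theorem winProb_nonneg (H : IsContinuousEquilibrium E Φ g b) (s : ℝ) :
    0 ≤ winProb E Φ g b s := by
  rw [H.winProb_eq_law]; positivity

theorem score_mem (H : IsContinuousEquilibrium E Φ g b) {τ : ℝ × ℝ} (hτ : τ ∈ E.types) :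
    Φ (b τ) ∈ Φ '' contracts := mem_image_of_mem Φ (H.bid_mem τ hτ)

theorem winProb_add_le (H : IsContinuousEquilibrium E Φ g b) {s t : ℝ} (hst : s < t) :
    winProb E Φ g b s + 1 / 2 * (scoreLaw E Φ g b).real {s} ≤ winProb E Φ g b t := by
  have := H.isProbabilityMeasure_scoreLaw
  have h1 : (scoreLaw E Φ g b).real (Iio s) + (scoreLaw E Φ g b).real {s} ≤
      (scoreLaw E Φ g b).real (Iio t) := by
    rw [← measureReal_union (by simp) (measurableSet_singleton s), Iio_union_right]
    exact measureReal_mono (Iic_subset_Iio.2 hst)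
  rw [H.winProb_eq_law, H.winProb_eq_law]
  have : 0 ≤ (scoreLaw E Φ g b).real {t} := measureReal_nonneg
  linarith

theorem winProb_mono (H : IsContinuousEquilibrium E Φ g b) : Monotone (winProb E Φ g b) := by
  intro s t hst
  rcases hst.eq_or_lt with rfl | hst
  · exact le_rfl
  · have : 0 ≤ (scoreLaw E Φ g b).real {s} := measureReal_nonneg
    linarith [H.winProb_add_le hst]

theorem payoff_nonneg (H : IsContinuousEquilibrium E Φ g b) {τ : ℝ × ℝ} (hτ : τ ∈ E.types) :
    0 ≤ payoff E Φ g b τ (b τ) := by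
  have hf : 0 < τ.2 := E.fLo_pos.trans_le hτ.2.1
  refine le_trans ?_ (H.best τ hτ (τ.2 + 1, 0) ⟨by simp only [mem_Ici]; linarith, by simp⟩)
  refine mul_nonneg (H.winProb_nonneg _) ?_
  simp only [Sellers.profit]
  rw [Real.zero_rpow (by linarith [E.one_le_η])]
  linarith

/-- The scores that are bid have no atom: a type who makes a profit at an atom would rather bid a
slightly higher score, and for each marginal cost at most one type breaks even. -/
theorem scoreLaw_singleton (hΦ : IsScoringRule Φ) (H : IsContinuousEquilibrium E Φ g b) (s : ℝ) :
    scoreLaw E Φ g b {s} = 0 := by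
  have := H.isProbabilityMeasure_scoreLaw
  by_contra h0
  have hpos : 0 < (scoreLaw E Φ g b).real {s} :=
    measureReal_nonneg.lt_of_ne fun h =>
      h0 ((measureReal_eq_zero_iff (measure_ne_top _ _)).1 h.symm)
  have hW : 0 < winProb E Φ g b s := by
    rw [H.winProb_eq_law]
    have : 0 ≤ (scoreLaw E Φ g b).real (Iio s) := measureReal_nonneg
    linarith
  have hzero : ∀ τ ∈ E.types, Φ (b τ) = s → E.profit τ (b τ) ≤ 0 := by
    intro τ hτ hs
    by_contra! hp
    have hb := H.bid_mem τ hτ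
    have hprice : E.profit τ (b τ) < (b τ).1 := by
      have h1 := rpow_mem_Icc E hb
      simp only [Sellers.profit]
      nlinarith [mul_nonneg (E.mLo_pos.le.trans hτ.1.1) h1.1, E.fLo_pos, hτ.2.1]
    set π := E.profit τ (b τ) with hπ
    set a := (scoreLaw E Φ g b).real {s} with ha
    -- Lower the price by `ε`.
    set ε := π * (a / 4) with hε
    have ha1 : a ≤ 1 := measureReal_le_one
    have hε0 : 0 < ε := by positivity
    have hεπ : ε < π := by nlinarith
    have hc : ((b τ).1 - ε, (b τ).2) ∈ contracts :=
      ⟨by simp only [mem_Ici]; linarith, hb.2⟩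
    have hlt : s < Φ ((b τ).1 - ε, (b τ).2) := by
      rw [← hs]
      exact hΦ.price_anti (b τ).2 hb.2 hc.1 hb.1 (by simp only; linarith)
    have h1 := H.best τ hτ _ hc
    have h2 := H.winProb_add_le hlt
    have h3 : E.profit τ ((b τ).1 - ε, (b τ).2) = π - ε := by
      simp only [hπ, Sellers.profit]; ring
    have hW1 : winProb E Φ g b s ≤ 1 := by
      have h4 : (scoreLaw E Φ g b).real (Iio s) + (scoreLaw E Φ g b).real {s} ≤ 1 := by
        rw [← measureReal_union (by simp) (measurableSet_singleton s)]
        exact measureReal_le_one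
      rw [H.winProb_eq_law]
      linarith
    simp only [payoff, h3, hs, ← hπ] at h1
    have h5 : (winProb E Φ g b s + 1 / 2 * a) * (π - ε) ≤ winProb E Φ g b s * π :=
      (mul_le_mul_of_nonneg_right h2 (by linarith)).trans h1
    nlinarith [mul_pos hpos hp, mul_pos hε0 hpos]
  have hnull : volume ((fun τ => Φ (b τ)) ⁻¹' {s} ∩ E.types) = 0 := by
    refine volume_eq_zero_of_subsingleton ?_ ?_
    · exact (nullMeasurableSet_restrict (measurableSet_types E).nullMeasurableSet).1
        (H.measurable.nullMeasurableSet_preimage (measurableSet_singleton s))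
    · have key : ∀ m f f', (m, f) ∈ E.types → (m, f') ∈ E.types → Φ (b (m, f)) = s →
          Φ (b (m, f')) = s → ¬ f < f' := by
        intro m f f' hm hm' hs hs' hlt
        have h1 := H.best _ hm _ (H.bid_mem _ hm')
        have h2 := H.payoff_nonneg hm'
        have h3 := hzero _ hm hs
        simp only [payoff, hs, hs'] at h1 h2
        have h4 := nonneg_of_mul_nonneg_right h2 hW
        have h5 := le_of_mul_le_mul_left h1 hW
        rw [profit_eq] at h3 h4 h5
        rw [profit_eq E m f] at h5
        linarith
      rintro m f ⟨hf, hft⟩ f' ⟨hf', hft'⟩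
      rcases lt_trichotomy f f' with h | h | h
      · exact absurd h (key m f f' hft hft' hf hf')
      · exact h
      · exact absurd h (key m f' f hft' hft hf' hf)
  refine h0 ?_
  rw [scoreLaw, Measure.map_apply_of_aemeasurable H.aemeasurable_typeLaw
    (measurableSet_singleton s)]
  refine typeLaw_absolutelyContinuous E g ?_
  rwa [Measure.restrict_apply' (measurableSet_types E)]

theorem winProb_eq_cdf (hΦ : IsScoringRule Φ) (H : IsContinuousEquilibrium E Φ g b) (s : ℝ) :
    winProb E Φ g b s = ProbabilityTheory.cdf (scoreLaw E Φ g b) s := by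
  have := H.isProbabilityMeasure_scoreLaw
  have h0 : (scoreLaw E Φ g b).real {s} = 0 := by
    simp [measureReal_def, H.scoreLaw_singleton hΦ s]
  have h1 : (scoreLaw E Φ g b).real (Iio s) + (scoreLaw E Φ g b).real {s} =
      (scoreLaw E Φ g b).real (Iic s) := by
    rw [← measureReal_union (by simp) (measurableSet_singleton s), Iio_union_right]
  rw [H.winProb_eq_law, ProbabilityTheory.cdf_eq_real]
  linarith

theorem continuous_winProb (hΦ : IsScoringRule Φ) (H : IsContinuousEquilibrium E Φ g b) :
    Continuous (winProb E Φ g b) := by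
  have := H.isProbabilityMeasure_scoreLaw
  have h : winProb E Φ g b = ProbabilityTheory.cdf (scoreLaw E Φ g b) :=
    funext (H.winProb_eq_cdf hΦ)
  rw [h, continuous_iff_continuousAt]
  intro s
  set F := ProbabilityTheory.cdf (scoreLaw E Φ g b)
  rw [F.mono.continuousAt_iff_leftLim_eq_rightLim, F.rightLim_eq]
  have h1 := F.measure_singleton s
  rw [ProbabilityTheory.measure_cdf, H.scoreLaw_singleton hΦ, eq_comm,
    ENNReal.ofReal_eq_zero] at h1
  exact le_antisymm (F.mono.leftLim_le le_rfl) (by linarith)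

theorem winProb_le_one (hΦ : IsScoringRule Φ) (H : IsContinuousEquilibrium E Φ g b) (s : ℝ) :
    winProb E Φ g b s ≤ 1 := by
  rw [H.winProb_eq_cdf hΦ]
  exact ProbabilityTheory.cdf_le_one _ _

theorem ae_ne (hΦ : IsScoringRule Φ) (H : IsContinuousEquilibrium E Φ g b) (s : ℝ) :
    ∀ᵐ τ ∂volume.restrict E.types, Φ (b τ) ≠ s := by
  refine absolutelyContinuous_typeLaw H.density ?_
  have h := H.scoreLaw_singleton hΦ s
  rw [scoreLaw, Measure.map_apply_of_aemeasurable H.aemeasurable_typeLaw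
    (measurableSet_singleton s)] at h
  refine measure_mono_null (fun τ hτ => ?_) h
  simpa using hτ

theorem nullMeasurableSet_lt (H : IsContinuousEquilibrium E Φ g b) (s : ℝ) :
    NullMeasurableSet {τ | Φ (b τ) < s} (volume.restrict E.types) :=
  H.measurable.nullMeasurableSet_preimage measurableSet_Iio

theorem winProb_eq_setIntegral (hΦ : IsScoringRule Φ) (H : IsContinuousEquilibrium E Φ g b)
    (s : ℝ) :
    winProb E Φ g b s = ∫ τ in E.types, {τ | Φ (b τ) < s}.indicator g τ := by
  refine integral_congr_ae ?_
  filter_upwards [H.ae_ne hΦ s] with τ hτ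
  by_cases h : Φ (b τ) < s <;> simp [h, hτ]

end IsContinuousEquilibrium

/-! ### Best responses and the monotonicity of equilibrium scores -/

/-- `s` is a best response of the type `θ`. The type supplies an optimal contract of score `s`
when he wins, so that the score alone determines his payoff. -/
def IsBestScore (E : Sellers) (Φ : ℝ × ℝ → ℝ) (g : ℝ × ℝ → ℝ) (b : ℝ × ℝ → ℝ × ℝ) (θ : ℝ × ℝ)
    (s : ℝ) : Prop :=
  s ∈ Φ '' contracts ∧ ∀ t ∈ Φ '' contracts,
    winProb E Φ g b t * (E.surplus Φ t θ.1 - θ.2) ≤ winProb E Φ g b s * (E.surplus Φ s θ.1 - θ.2)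

namespace IsContinuousEquilibrium

variable {E : Sellers} {Φ : ℝ × ℝ → ℝ} {g : ℝ × ℝ → ℝ} {b : ℝ × ℝ → ℝ × ℝ}

theorem le_payoff (hΦ : IsScoringRule Φ) (hreg : IsRegular E Φ)
    (H : IsContinuousEquilibrium E Φ g b) {τ : ℝ × ℝ} (hτ : τ ∈ E.types) {t : ℝ}
    (ht : t ∈ Φ '' contracts) :
    winProb E Φ g b t * (E.surplus Φ t τ.1 - τ.2) ≤ payoff E Φ g b τ (b τ) := by
  obtain ⟨c, hc⟩ := exists_isOptimal (E := E) hΦ hreg ht τ.1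
  have h := H.best τ hτ c hc.1
  rwa [payoff, hc.2.1, ← Prod.mk.eta (p := τ), profit_eq, ← hc.surplus_eq] at h

theorem payoff_le (hΦ : IsScoringRule Φ) (hreg : IsRegular E Φ)
    (H : IsContinuousEquilibrium E Φ g b) {τ : ℝ × ℝ} (hτ : τ ∈ E.types) :
    payoff E Φ g b τ (b τ) ≤
      winProb E Φ g b (Φ (b τ)) * (E.surplus Φ (Φ (b τ)) τ.1 - τ.2) :=
  mul_le_mul_of_nonneg_left (profit_le_surplus hΦ hreg (H.bid_mem τ hτ) τ.1 τ.2)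
    (H.winProb_nonneg _)

theorem isBestScore (hΦ : IsScoringRule Φ) (hreg : IsRegular E Φ)
    (H : IsContinuousEquilibrium E Φ g b) {τ : ℝ × ℝ} (hτ : τ ∈ E.types) :
    IsBestScore E Φ g b τ (Φ (b τ)) :=
  ⟨H.score_mem hτ, fun _ ht => (H.le_payoff hΦ hreg hτ ht).trans (H.payoff_le hΦ hreg hτ)⟩

/-- If a type makes no profit, then the worse types never win, so that all of them bid scores below
almost all scores that are bid. This is impossible when they have positive mass. -/
theorem payoff_pos_of_lt (hΦ : IsScoringRule Φ) (H : IsContinuousEquilibrium E Φ g b)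
    {m f : ℝ} (hτ : (m, f) ∈ E.types) (hm : m < E.mHi) (hf : f < E.fHi) :
    0 < payoff E Φ g b (m, f) (b (m, f)) := by
  have := H.isProbabilityMeasure_scoreLaw
  by_contra! h0
  set B : Set (ℝ × ℝ) := Ioc m E.mHi ×ˢ Ioc f E.fHi with hB
  have hBt : B ⊆ E.types := fun τ hτ' =>
    ⟨⟨hτ.1.1.trans hτ'.1.1.le, hτ'.1.2⟩, ⟨hτ.2.1.trans hτ'.2.1.le, hτ'.2.2⟩⟩
  have hW : ∀ τ ∈ B, winProb E Φ g b (Φ (b τ)) = 0 := by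
    intro τ hτB
    by_contra hne
    have hWpos := (H.winProb_nonneg (Φ (b τ))).lt_of_ne' hne
    have h1 := nonneg_of_mul_nonneg_right (H.payoff_nonneg (hBt hτB)) hWpos
    have h2 : 0 < E.profit (m, f) (b τ) := by
      have h3 := (rpow_mem_Icc E (H.bid_mem τ (hBt hτB))).1
      have h4 : m < τ.1 := hτB.1.1
      have h5 : f < τ.2 := hτB.2.1
      simp only [Sellers.profit] at h1 ⊢
      nlinarith [mul_nonneg (sub_nonneg.2 h4.le) h3]
    have h6 := H.best _ hτ _ (H.bid_mem τ (hBt hτB))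
    have h7 : 0 < payoff E Φ g b (m, f) (b τ) := mul_pos hWpos h2
    linarith
  set σ := sSup ((fun τ => Φ (b τ)) '' B) with hσ
  have hne : ((fun τ => Φ (b τ)) '' B).Nonempty :=
    ⟨_, mem_image_of_mem _ (show (E.mHi, E.fHi) ∈ B from ⟨⟨hm, le_rfl⟩, ⟨hf, le_rfl⟩⟩)⟩
  have hbdd : BddAbove ((fun τ => Φ (b τ)) '' B) := by
    refine ⟨Φ (0, 1), ?_⟩
    rintro _ ⟨τ, hτB, rfl⟩
    exact score_le_top hΦ (H.bid_mem τ (hBt hτB))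
  obtain ⟨u, -, hu, hmem⟩ := exists_seq_tendsto_sSup hne hbdd
  have hnull : scoreLaw E Φ g b (Iio σ) = 0 := by
    have hsub : Iio σ ⊆ ⋃ n, Iio (u n) := fun y hy => by
      obtain ⟨n, hn⟩ := (hu.eventually (lt_mem_nhds hy)).exists
      exact mem_iUnion.2 ⟨n, hn⟩
    refine measure_mono_null hsub (measure_iUnion_null fun n => ?_)
    obtain ⟨τ, hτB, hτu⟩ := hmem n
    have h1 := hW τ hτB
    simp only at hτu
    rw [hτu, H.winProb_eq_law] at h1
    have h2 : 0 ≤ (scoreLaw E Φ g b).real (Iio (u n)) := measureReal_nonneg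
    have h3 : 0 ≤ (scoreLaw E Φ g b).real {u n} := measureReal_nonneg
    exact (measureReal_eq_zero_iff (measure_ne_top _ _)).1 (by linarith)
  have hnull' : scoreLaw E Φ g b (Iic σ) = 0 := by
    rw [← Iio_union_right]
    exact measure_union_null hnull (H.scoreLaw_singleton hΦ σ)
  have hB0 : volume.restrict E.types B = 0 := by
    refine absolutelyContinuous_typeLaw H.density ?_
    rw [scoreLaw, Measure.map_apply_of_aemeasurable H.aemeasurable_typeLaw measurableSet_Iic]
      at hnull'
    refine measure_mono_null (fun τ hτB => ?_) hnull'
    exact le_csSup hbdd (mem_image_of_mem _ hτB)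
  rw [Measure.restrict_apply' (measurableSet_types E), inter_eq_left.2 hBt, hB,
    Measure.volume_eq_prod, Measure.prod_prod, Real.volume_Ioc, Real.volume_Ioc] at hB0
  simp only [mul_eq_zero, ENNReal.ofReal_eq_zero] at hB0
  rcases hB0 with h | h <;> linarith

/-- All types make a profit, except possibly those with the highest fixed cost. -/
theorem payoff_pos (hΦ : IsScoringRule Φ) (hreg : IsRegular E Φ)
    (H : IsContinuousEquilibrium E Φ g b) {τ : ℝ × ℝ} (hτ : τ ∈ E.types) (hf : τ.2 < E.fHi) :
    0 < payoff E Φ g b τ (b τ) := by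
  obtain ⟨m, f⟩ := τ
  rcases hτ.1.2.lt_or_eq with hm | hm
  · exact H.payoff_pos_of_lt hΦ hτ hm hf
  simp only at hm hf
  subst hm
  -- A type with a slightly lower marginal cost and a higher fixed cost makes a profit at some
  -- score, and the difference in the fixed costs is larger than that in the costs of quality.
  obtain ⟨f', hf1, hf2⟩ := exists_between hf
  set m' := max E.mLo (E.mHi - (f' - f)) with hm'
  have h1 : m' < E.mHi := max_lt E.mLo_lt (by linarith)
  have h2 : E.mHi - m' ≤ f' - f := by linarith [le_max_right E.mLo (E.mHi - (f' - f))]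
  have hτ' : (m', f') ∈ E.types :=
    ⟨⟨le_max_left _ _, h1.le⟩, ⟨hτ.2.1.trans hf1.le, hf2.le⟩⟩
  have hp := H.payoff_pos_of_lt hΦ hτ' h1 hf2
  set s := Φ (b (m', f'))
  have hs : s ∈ Φ '' contracts := H.score_mem hτ'
  have hp' := hp.trans_le (H.payoff_le hΦ hreg hτ')
  have hW : 0 < winProb E Φ g b s := (H.winProb_nonneg s).lt_of_ne fun h => by
    change 0 < winProb E Φ g b s * _ at hp'
    rw [← h, zero_mul] at hp'
    exact lt_irrefl _ hp'
  have hu := pos_of_mul_pos_right hp' hW.le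
  simp only at hu
  refine lt_of_lt_of_le (mul_pos hW ?_) (H.le_payoff hΦ hreg hτ hs)
  have h3 := surplus_le_add (E := E) hΦ hreg hs h1.le
  simp only
  linarith

theorem pos_of_isBestScore (hΦ : IsScoringRule Φ) (hreg : IsRegular E Φ)
    (H : IsContinuousEquilibrium E Φ g b) {τ : ℝ × ℝ} (hτ : τ ∈ E.types) (hf : τ.2 < E.fHi)
    {s : ℝ} (hs : IsBestScore E Φ g b τ s) :
    0 < winProb E Φ g b s ∧ τ.2 < E.surplus Φ s τ.1 := by
  have h1 : 0 < winProb E Φ g b s * (E.surplus Φ s τ.1 - τ.2) :=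
    ((H.payoff_pos hΦ hreg hτ hf).trans_le (H.payoff_le hΦ hreg hτ)).trans_le
      (hs.2 _ (H.score_mem hτ))
  have hW : 0 < winProb E Φ g b s := (H.winProb_nonneg s).lt_of_ne fun h => by
    rw [← h, zero_mul] at h1
    exact lt_irrefl _ h1
  exact ⟨hW, sub_pos.1 (pos_of_mul_pos_right h1 hW.le)⟩

theorem winProb_pos (hΦ : IsScoringRule Φ) (hreg : IsRegular E Φ)
    (H : IsContinuousEquilibrium E Φ g b) {τ : ℝ × ℝ} (hτ : τ ∈ E.types) (hf : τ.2 < E.fHi) :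
    0 < winProb E Φ g b (Φ (b τ)) :=
  (H.pos_of_isBestScore hΦ hreg hτ hf (H.isBestScore hΦ hreg hτ)).1

theorem lt_surplus (hΦ : IsScoringRule Φ) (hreg : IsRegular E Φ)
    (H : IsContinuousEquilibrium E Φ g b) {τ : ℝ × ℝ} (hτ : τ ∈ E.types) (hf : τ.2 < E.fHi) :
    τ.2 < E.surplus Φ (Φ (b τ)) τ.1 :=
  (H.pos_of_isBestScore hΦ hreg hτ hf (H.isBestScore hΦ hreg hτ)).2

/-- A type whose indirect utility decays faster between two scores does not prefer the higher one
when the other type prefers the lower one. -/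
theorem not_isBestScore_of_decay_lt (hΦ : IsScoringRule Φ) (hreg : IsRegular E Φ)
    {θ θ' : ℝ × ℝ} (hθ : θ ∈ E.types) (hθ' : θ' ∈ E.types) {s t : ℝ} (hst : s < t)
    (hs : IsBestScore E Φ g b θ s) (hWs : 0 < winProb E Φ g b s) (hWt : 0 < winProb E Φ g b t)
    (h : θ.2 < E.surplus Φ t θ.1) (h' : θ'.2 < E.surplus Φ t θ'.1)
    (hlt : ∀ r ∈ Icc s t, E.decay Φ r θ < E.decay Φ r θ') : ¬ IsBestScore E Φ g b θ' t := by
  intro ht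
  have h1 := surplus_mul_lt hΦ hreg hst hs.1 ht.1 hθ hθ' h h' hlt
  have hu : ∀ {τ : ℝ × ℝ}, τ.2 < E.surplus Φ t τ.1 → 0 < E.surplus Φ s τ.1 - τ.2 := fun hτ =>
    sub_pos.2 (hτ.trans_le ((surplus_strictAntiOn hΦ hreg _).antitoneOn hs.1 ht.1 hst.le))
  have h2 := mul_le_mul (hs.2 t ht.1) (ht.2 s hs.1) (mul_nonneg hWs.le (hu h').le)
    (mul_nonneg hWs.le (hu h).le)
  nlinarith [mul_pos hWs hWt]

theorem isBestScore_le_of_le (hΦ : IsScoringRule Φ) (hreg : IsRegular E Φ)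
    (H : IsContinuousEquilibrium E Φ g b) {θ θ' : ℝ × ℝ} (hθ : θ ∈ E.types) (hθ' : θ' ∈ E.types)
    (hle : θ ≤ θ') (hne : θ ≠ θ') (hf : θ'.2 < E.fHi) {s t : ℝ}
    (hs : IsBestScore E Φ g b θ s) (ht : IsBestScore E Φ g b θ' t) : t ≤ s := by
  by_contra! hst
  obtain ⟨hWt, hut⟩ := H.pos_of_isBestScore hΦ hreg hθ' hf ht
  obtain ⟨hWs, hus⟩ := H.pos_of_isBestScore hΦ hreg hθ (hle.2.trans_lt hf) hs
  refine not_isBestScore_of_decay_lt hΦ hreg hθ hθ' hst hs hWs hWt ?_ hut (fun r hr => ?_) ht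
  · exact hle.2.trans_lt (hut.trans_le (surplus_antitone hΦ hreg ht.1 hle.1))
  · have hr' := (ordConnected_scores hΦ).out hs.1 ht.1 hr
    exact decay_lt_of_le hΦ hreg hr' hθ hθ' hle hne
      (hut.trans_le ((surplus_strictAntiOn hΦ hreg _).antitoneOn hr' ht.1 hr.2))

theorem tendsto_score_top (H : IsContinuousEquilibrium E Φ g b) {m : ℝ}
    (hm : m ∈ Icc E.mLo E.mHi) :
    Tendsto (fun f => Φ (b (m, f))) (𝓝[Ioo E.fLo E.fHi] E.fHi) (𝓝 (Φ (b (m, E.fHi)))) :=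
  (H.continuousOn m hm E.fHi (right_mem_Icc.2 E.fLo_lt.le)).tendsto.mono_left
    (nhdsWithin_mono _ Ioo_subset_Icc_self)

theorem score_antitoneOn (hΦ : IsScoringRule Φ) (hreg : IsRegular E Φ)
    (H : IsContinuousEquilibrium E Φ g b) : AntitoneOn (fun τ => Φ (b τ)) E.types := by
  have hlt : ∀ θ ∈ E.types, ∀ θ' ∈ E.types, θ ≤ θ' → θ'.2 < E.fHi → Φ (b θ') ≤ Φ (b θ) := by
    intro θ hθ θ' hθ' hle hf
    by_cases hne : θ = θ'
    · rw [hne]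
    · exact H.isBestScore_le_of_le hΦ hreg hθ hθ' hle hne hf (H.isBestScore hΦ hreg hθ)
        (H.isBestScore hΦ hreg hθ')
  intro θ hθ θ' hθ' hle
  rcases hθ'.2.2.lt_or_eq with hf | hf
  · exact hlt θ hθ θ' hθ' hle hf
  obtain ⟨m, f⟩ := θ
  obtain ⟨m', f'⟩ := θ'
  simp only at hf
  subst hf
  have : (𝓝[Ioo E.fLo E.fHi] E.fHi).NeBot := by
    rw [nhdsWithin_Ioo_eq_nhdsLT E.fLo_lt]; infer_instance
  rcases hθ.2.2.lt_or_eq with hf | hf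
  · refine le_of_tendsto (H.tendsto_score_top hθ'.1) ?_
    filter_upwards [self_mem_nhdsWithin, nhdsWithin_le_nhds (lt_mem_nhds hf)] with x hx hfx
    exact hlt _ hθ _ ⟨hθ'.1, Ioo_subset_Icc_self hx⟩ ⟨hle.1, hfx.le⟩ hx.2
  · simp only at hf
    subst hf
    refine le_of_tendsto_of_tendsto (H.tendsto_score_top hθ'.1) (H.tendsto_score_top hθ.1) ?_
    filter_upwards [self_mem_nhdsWithin] with x hx
    have hx' : x ∈ Icc E.fLo E.fHi := Ioo_subset_Icc_self hx
    exact hlt (m, x) ⟨hθ.1, hx'⟩ (m', x) ⟨hθ'.1, hx'⟩ ⟨hle.1, le_rfl⟩ hx.2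

/-- Best responses are unique for types with an interior fixed cost: a second one would be a jump
of the score bid at the fixed cost of the type. -/
theorem eq_of_isBestScore (hΦ : IsScoringRule Φ) (hreg : IsRegular E Φ)
    (H : IsContinuousEquilibrium E Φ g b) {m f : ℝ} (hm : m ∈ Icc E.mLo E.mHi)
    (hf : f ∈ Ioo E.fLo E.fHi) {s : ℝ} (hs : IsBestScore E Φ g b (m, f) s) :
    s = Φ (b (m, f)) := by
  have hcont := H.continuousOn m hm f (Ioo_subset_Icc_self hf)
  have hτ : (m, f) ∈ E.types := ⟨hm, Ioo_subset_Icc_self hf⟩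
  refine le_antisymm ?_ ?_
  · have : (𝓝[Ioo E.fLo f] f).NeBot := by
      rw [nhdsWithin_Ioo_eq_nhdsLT hf.1]; infer_instance
    refine ge_of_tendsto (hcont.tendsto.mono_left (nhdsWithin_mono (s := Ioo E.fLo f) _
      fun x hx => ⟨hx.1.le, (hx.2.trans hf.2).le⟩)) ?_
    filter_upwards [self_mem_nhdsWithin] with x hx
    have hx' : (m, x) ∈ E.types := ⟨hm, hx.1.le, (hx.2.trans hf.2).le⟩
    exact H.isBestScore_le_of_le hΦ hreg hx' hτ ⟨le_rfl, hx.2.le⟩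
      (fun h => hx.2.ne (Prod.ext_iff.1 h).2) hf.2 (H.isBestScore hΦ hreg hx') hs
  · have : (𝓝[Ioo f E.fHi] f).NeBot := by
      rw [nhdsWithin_Ioo_eq_nhdsGT hf.2]; infer_instance
    refine le_of_tendsto (hcont.tendsto.mono_left (nhdsWithin_mono (s := Ioo f E.fHi) _
      fun x hx => ⟨(hf.1.trans hx.1).le, hx.2.le⟩)) ?_
    filter_upwards [self_mem_nhdsWithin] with x hx
    have hx' : (m, x) ∈ E.types := ⟨hm, (hf.1.trans hx.1).le, hx.2.le⟩
    exact H.isBestScore_le_of_le hΦ hreg hτ hx' ⟨le_rfl, hx.1.le⟩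
      (fun h => hx.1.ne (Prod.ext_iff.1 h).2) hx.2 hs (H.isBestScore hΦ hreg hx')

/-- Scores are continuous at types with an interior fixed cost, as limits of best responses are
best responses. -/
theorem continuousWithinAt_score (hΦ : IsScoringRule Φ) (hreg : IsRegular E Φ)
    (H : IsContinuousEquilibrium E Φ g b) {m f : ℝ} (hm : m ∈ Icc E.mLo E.mHi)
    (hf : f ∈ Ioo E.fLo E.fHi) : ContinuousWithinAt (fun τ => Φ (b τ)) E.types (m, f) := by
  have hτ : (m, f) ∈ E.types := ⟨hm, Ioo_subset_Icc_self hf⟩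
  rw [ContinuousWithinAt, tendsto_iff_ultrafilter]
  intro 𝒰 h𝒰
  have htypes : ∀ᶠ τ in (𝒰 : Filter (ℝ × ℝ)), τ ∈ E.types := h𝒰 self_mem_nhdsWithin
  have hlim : Tendsto (fun τ : ℝ × ℝ => τ) 𝒰 (𝓝 (m, f)) := h𝒰.trans nhdsWithin_le_nhds
  have hlim1 : Tendsto (fun τ : ℝ × ℝ => τ.1) 𝒰 (𝓝 m) := (continuous_fst.tendsto (m, f)).comp hlim
  have hlim2 : Tendsto (fun τ : ℝ × ℝ => τ.2) 𝒰 (𝓝 f) := (continuous_snd.tendsto (m, f)).comp hlim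
  have hlo : (E.mLo, E.fLo) ∈ E.types :=
    ⟨left_mem_Icc.2 E.mLo_lt.le, left_mem_Icc.2 E.fLo_lt.le⟩
  have hhi : (E.mHi, E.fHi) ∈ E.types :=
    ⟨right_mem_Icc.2 E.mLo_lt.le, right_mem_Icc.2 E.fLo_lt.le⟩
  obtain ⟨s, hsmem, hs⟩ := (isCompact_Icc (a := Φ (b (E.mHi, E.fHi)))
    (b := Φ (b (E.mLo, E.fLo)))).ultrafilter_le_nhds (𝒰.map fun τ => Φ (b τ))
      (le_principal_iff.2 (by
        change ∀ᶠ τ in (𝒰 : Filter (ℝ × ℝ)), Φ (b τ) ∈ _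
        filter_upwards [htypes] with τ hτ
        exact ⟨H.score_antitoneOn hΦ hreg hτ hhi ⟨hτ.1.2, hτ.2.2⟩,
          H.score_antitoneOn hΦ hreg hlo hτ ⟨hτ.1.1, hτ.2.1⟩⟩))
  have hlims : Tendsto (fun τ => Φ (b τ)) 𝒰 (𝓝 s) := hs
  have hsIm : s ∈ Φ '' contracts :=
    (ordConnected_scores hΦ).out (H.score_mem hhi) (H.score_mem hlo) hsmem
  have hpos : ∀ᶠ τ in (𝒰 : Filter (ℝ × ℝ)), τ.2 < E.surplus Φ (Φ (b τ)) τ.1 := by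
    filter_upwards [htypes, hlim2.eventually (gt_mem_nhds hf.2)] with τ h1 h2
    exact H.lt_surplus hΦ hreg h1 h2
  have hprof : (s, m) ∈ E.profitable Φ := by
    obtain ⟨f', hf1, hf2⟩ := exists_between hf.1
    refine ⟨hsIm, hm, hf1.trans_le (le_surplus_of_tendsto (E := E) hΦ hreg hsIm hlims hlim1
      (htypes.mono fun τ h => H.score_mem h) ?_)⟩
    filter_upwards [hpos, hlim2.eventually (lt_mem_nhds hf2)] with τ h1 h2
    exact (h2.trans h1).le
  have hv : Tendsto (fun τ => E.surplus Φ (Φ (b τ)) τ.1) 𝒰 (𝓝 (E.surplus Φ s m)) := by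
    refine ((continuousOn_surplus hΦ hreg) (s, m) hprof).tendsto.comp
      (tendsto_nhdsWithin_iff.2 ⟨hlims.prodMk_nhds hlim1, ?_⟩)
    filter_upwards [htypes, hpos] with τ h1 h2
    exact profitable_of_lt (H.score_mem h1) h1 h2
  have hbest : IsBestScore E Φ g b (m, f) s := by
    refine ⟨hsIm, fun t ht => ?_⟩
    have hvt : Tendsto (fun τ : ℝ × ℝ => E.surplus Φ t τ.1) 𝒰 (𝓝 (E.surplus Φ t m)) := by
      have h0 : Tendsto (fun τ : ℝ × ℝ => |τ.1 - m|) 𝒰 (𝓝 0) := by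
        simpa using (hlim1.sub_const m).abs
      rw [tendsto_iff_dist_tendsto_zero]
      exact squeeze_zero (fun _ => dist_nonneg)
        (fun τ => abs_surplus_sub_le (E := E) hΦ hreg ht τ.1 m) h0
    refine le_of_tendsto_of_tendsto ((hvt.sub hlim2).const_mul _)
      ((((H.continuous_winProb hΦ).tendsto s).comp hlims).mul (hv.sub hlim2)) ?_
    filter_upwards [htypes] with τ h1
    exact (H.isBestScore hΦ hreg h1).2 t ht
  rw [← H.eq_of_isBestScore hΦ hreg hm hf hbest]
  exact hlims

end IsContinuousEquilibrium

/-! ### Strict monotonicity and the first-order condition -/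

theorem types_subset_closure_interior (E : Sellers) : E.types ⊆ closure (interior E.types) := by
  rw [Sellers.types, interior_prod_eq, interior_Icc, interior_Icc, closure_prod_eq,
    closure_Ioo E.mLo_lt.ne, closure_Ioo E.fLo_lt.ne]

namespace IsContinuousEquilibrium

variable {E : Sellers} {Φ : ℝ × ℝ → ℝ} {g : ℝ × ℝ → ℝ} {b : ℝ × ℝ → ℝ × ℝ}

theorem not_eventually_eq (hΦ : IsScoringRule Φ) (H : IsContinuousEquilibrium E Φ g b)
    {τ : ℝ × ℝ} (hτ : τ ∈ E.types) (s : ℝ) : ¬ ∀ᶠ τ' in 𝓝[E.types] τ, Φ (b τ') = s := by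
  intro h
  obtain ⟨U, hU, hτU, hs⟩ := mem_nhdsWithin.1 h
  have hV : (U ∩ interior E.types).Nonempty :=
    mem_closure_iff.1 (types_subset_closure_interior E hτ) U hU hτU
  have hpos := (hU.inter isOpen_interior).measure_pos volume hV
  have h0 := H.ae_ne hΦ s
  rw [ae_iff, Measure.restrict_apply' (measurableSet_types E)] at h0
  refine hpos.ne' (measure_mono_null ?_ h0)
  intro τ' hτ'
  refine ⟨?_, interior_subset hτ'.2⟩
  simpa using hs ⟨hτ'.1, interior_subset hτ'.2⟩

/-- Types that differ in the fixed cost bid different scores: if `f < f'` bid the same score, then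
by single crossing so do all types close to those with intermediate fixed costs, an atom. -/
theorem score_strictAntiOn (hΦ : IsScoringRule Φ) (hreg : IsRegular E Φ)
    (H : IsContinuousEquilibrium E Φ g b) {m : ℝ} (hm : m ∈ Icc E.mLo E.mHi) :
    StrictAntiOn (fun f => Φ (b (m, f))) (Icc E.fLo E.fHi) := by
  intro f hf f' hf' hff'
  by_contra! hle
  obtain ⟨x, hfx, hxf'⟩ := exists_between hff'
  obtain ⟨x₁, hfx₁, hx₁⟩ := exists_between hfx
  obtain ⟨x₂, hx₂, hx₂f'⟩ := exists_between hxf'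
  have hmem : ∀ {y}, f ≤ y → y ≤ f' → (m, y) ∈ E.types := fun h1 h2 =>
    ⟨hm, hf.1.trans h1, h2.trans hf'.2⟩
  set s := Φ (b (m, x)) with hs
  have heq : ∀ y, f ≤ y → y ≤ f' → Φ (b (m, y)) = Φ (b (m, f)) := fun y h1 h2 =>
    le_antisymm (H.score_antitoneOn hΦ hreg (hmem le_rfl hff'.le) (hmem h1 h2) ⟨le_rfl, h1⟩)
      (hle.trans (H.score_antitoneOn hΦ hreg (hmem h1 h2) (hmem hff'.le le_rfl) ⟨le_rfl, h2⟩))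
  have hsx : ∀ y, f ≤ y → y ≤ f' → Φ (b (m, y)) = s := fun y h1 h2 =>
    (heq y h1 h2).trans (heq x hfx.le hxf'.le).symm
  have ht : (m, x) ∈ E.types := hmem hfx.le hxf'.le
  have ht₁ : (m, x₁) ∈ E.types := hmem hfx₁.le (hx₁.trans hxf').le
  have ht₂ : (m, x₂) ∈ E.types := hmem (hfx.trans hx₂).le hx₂f'.le
  have hx₂hi : x₂ < E.fHi := hx₂f'.trans_le hf'.2
  have hs₁ : Φ (b (m, x₁)) = s := hsx _ hfx₁.le (hx₁.trans hxf').le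
  have hs₂ : Φ (b (m, x₂)) = s := hsx _ (hfx.trans hx₂).le hx₂f'.le
  have hb₁ : IsBestScore E Φ g b (m, x₁) s := hs₁ ▸ H.isBestScore hΦ hreg ht₁
  have hb₂ : IsBestScore E Φ g b (m, x₂) s := hs₂ ▸ H.isBestScore hΦ hreg ht₂
  have hsIm : s ∈ Φ '' contracts := H.score_mem ht
  obtain ⟨hWs, hu₂⟩ := H.pos_of_isBestScore hΦ hreg ht₂ hx₂hi hb₂
  simp only at hu₂
  have hu : x < E.surplus Φ s m := hx₂.trans hu₂
  have hprof : (s, m) ∈ E.profitable Φ := profitable_of_lt hsIm ht hu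
  refine H.not_eventually_eq hΦ ht s ?_
  have hconst : ∀ {y}, (m, y) ∈ E.types → y < E.surplus Φ s m →
      Tendsto (fun z : ℝ × (ℝ × ℝ) => E.decay Φ z.1 (m, y)) (𝓝[univ ×ˢ E.types] (s, (m, x)))
        (𝓝 (E.decay Φ s (m, y))) := fun {y} hy hyu => by
    refine (continuousOn_decay hΦ hreg hsIm hy hyu).tendsto.comp
      (f := fun z : ℝ × (ℝ × ℝ) => (z.1, (m, y))) (tendsto_nhdsWithin_iff.2 ⟨?_, ?_⟩)
    · refine tendsto_nhdsWithin_of_tendsto_nhds ?_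
      have : Continuous fun z : ℝ × (ℝ × ℝ) => (z.1, (m, y)) := by fun_prop
      exact this.tendsto (s, (m, x))
    · exact Eventually.of_forall fun z => ⟨mem_univ _, hy⟩
  have hself := (continuousOn_decay hΦ hreg hsIm ht hu).tendsto
  have hdec : ∀ᶠ z in 𝓝[univ ×ˢ E.types] (s, (m, x)),
      E.decay Φ z.1 (m, x₁) < E.decay Φ z.1 z.2 ∧ E.decay Φ z.1 z.2 < E.decay Φ z.1 (m, x₂) :=
    ((hconst ht₁ (hx₁.trans hu)).eventually_lt hself
      (decay_lt_of_fixed_lt hΦ hreg hsIm ht₁ hx₁ hu)).and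
      (hself.eventually_lt (hconst ht₂ hu₂) (decay_lt_of_fixed_lt hΦ hreg hsIm ht hx₂ hu₂))
  rw [nhdsWithin_prod_eq, nhdsWithin_univ] at hdec
  obtain ⟨p, hp, q, hq, hpq⟩ := eventually_prod_iff.1 hdec
  obtain ⟨ε, hε, hball⟩ := Metric.eventually_nhds_iff_ball.1
    (hp.and ((hasDerivAt_surplus hΦ hreg hprof).continuousAt.eventually (lt_mem_nhds hu₂)))
  have hxI : x ∈ Ioo E.fLo E.fHi := ⟨hf.1.trans_lt hfx, hxf'.trans_le hf'.2⟩
  have hcontS := H.continuousWithinAt_score hΦ hreg hm hxI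
  have huτ : ∀ᶠ τ : ℝ × ℝ in 𝓝[E.types] (m, x), τ.2 < E.surplus Φ s τ.1 := by
    have hc : Continuous fun τ : ℝ × ℝ => τ.2 + |τ.1 - m| := by fun_prop
    have := hc.continuousAt.eventually (gt_mem_nhds (show (m, x).2 + |(m, x).1 - m| <
      E.surplus Φ s m by simpa using hu))
    filter_upwards [nhdsWithin_le_nhds this] with τ hτ
    have := (abs_le.1 (abs_surplus_sub_le (E := E) hΦ hreg hsIm τ.1 m)).1
    linarith
  have hτhi : ∀ᶠ τ : ℝ × ℝ in 𝓝[E.types] (m, x), τ.2 < E.fHi :=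
    nhdsWithin_le_nhds (continuous_snd.continuousAt.eventually (gt_mem_nhds hxI.2))
  filter_upwards [hq, self_mem_nhdsWithin, hτhi, huτ,
    hcontS.tendsto.eventually (Metric.ball_mem_nhds _ hε)] with τ hqτ hτ hτhi huτ hball'
  set t := Φ (b τ) with htdef
  have hbτ : IsBestScore E Φ g b τ t := H.isBestScore hΦ hreg hτ
  obtain ⟨hWt, hut⟩ := H.pos_of_isBestScore hΦ hreg hτ hτhi hbτ
  have hIcc : ∀ r, r ∈ uIcc s t → r ∈ Metric.ball s ε := fun r hr =>
    (convex_ball s ε).ordConnected.uIcc_subset (Metric.mem_ball_self hε) hball' hr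
  rcases lt_trichotomy t s with h | h | h
  · exfalso
    refine not_isBestScore_of_decay_lt hΦ hreg hτ ht₂ h hbτ hWt hWs huτ hu₂ (fun r hr => ?_) hb₂
    exact (hpq (hball r (hIcc r (by rwa [uIcc_of_ge h.le]))).1 hqτ).2
  · exact h
  · exfalso
    have h1 := (hball t (hIcc t right_mem_uIcc)).2
    refine not_isBestScore_of_decay_lt hΦ hreg ht₁ hτ h hb₁ hWs hWt
      ((hx₁.trans hx₂).trans h1) hut (fun r hr => ?_) hbτ
    exact (hpq (hball r (hIcc r (by rwa [uIcc_of_le h.le]))).1 hqτ).1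

theorem exists_score_eq (H : IsContinuousEquilibrium E Φ g b) {m x y : ℝ} (hm : m ∈ Icc E.mLo E.mHi)
    (hx : x ∈ Icc E.fLo E.fHi) (hy : y ∈ Icc E.fLo E.fHi) (hxy : x ≤ y) {t : ℝ}
    (ht : t ∈ Ioo (Φ (b (m, y))) (Φ (b (m, x)))) : ∃ z ∈ Ioo x y, Φ (b (m, z)) = t := by
  obtain ⟨z, hz, hzt⟩ := intermediate_value_Icc' hxy
    ((H.continuousOn m hm).mono (Icc_subset_Icc hx.1 hy.2)) (Ioo_subset_Icc_self ht)
  refine ⟨z, ⟨lt_of_le_of_ne hz.1 ?_, lt_of_le_of_ne hz.2 ?_⟩, hzt⟩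
  · rintro rfl
    exact ht.2.ne hzt.symm
  · rintro rfl
    exact ht.1.ne hzt

/-- The first-order condition: the winning probability grows at the rate at which the indirect
utility of the bidder decays. The upper bound on the growth comes from the best response of the
type himself, the lower bound from those of the types who bid nearby scores. -/
theorem hasDerivAt_log_winProb (hΦ : IsScoringRule Φ) (hreg : IsRegular E Φ)
    (H : IsContinuousEquilibrium E Φ g b) {m f : ℝ} (hm : m ∈ Icc E.mLo E.mHi)
    (hf : f ∈ Ioo E.fLo E.fHi) :
    HasDerivAt (fun t => Real.log (winProb E Φ g b t)) (E.decay Φ (Φ (b (m, f))) (m, f))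
      (Φ (b (m, f))) := by
  have hτ : (m, f) ∈ E.types := ⟨hm, Ioo_subset_Icc_self hf⟩
  have hbest := H.isBestScore hΦ hreg hτ
  have hanti := H.score_strictAntiOn hΦ hreg hm
  set s := Φ (b (m, f)) with hs
  obtain ⟨hWs, hu⟩ := H.pos_of_isBestScore hΦ hreg hτ hf.2 hbest
  simp only at hu
  have hprof := profitable_of_lt hbest.1 hτ hu
  have hv := hasDerivAt_surplus hΦ hreg hprof
  have hex : ∀ t, ∃ x, t ∈ Ioo (Φ (b (m, E.fHi))) (Φ (b (m, E.fLo))) →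
      x ∈ Ioo E.fLo E.fHi ∧ Φ (b (m, x)) = t := by
    intro t
    by_cases ht : t ∈ Ioo (Φ (b (m, E.fHi))) (Φ (b (m, E.fLo)))
    · obtain ⟨x, hx⟩ := H.exists_score_eq hm (left_mem_Icc.2 E.fLo_lt.le)
        (right_mem_Icc.2 E.fLo_lt.le) E.fLo_lt.le ht
      exact ⟨x, fun _ => hx⟩
    · exact ⟨0, fun h => absurd h ht⟩
  choose φ hφ using hex
  have hnear : ∀ {x y}, x ∈ Icc E.fLo E.fHi → y ∈ Icc E.fLo E.fHi → x < f → f < y →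
      ∀ᶠ t in 𝓝 s, t ∈ Ioo (Φ (b (m, y))) (Φ (b (m, x))) := fun hx hy hxf hfy =>
    Ioo_mem_nhds (hanti (Ioo_subset_Icc_self hf) hy hfy) (hanti hx (Ioo_subset_Icc_self hf) hxf)
  have hdom := hnear (left_mem_Icc.2 E.fLo_lt.le) (right_mem_Icc.2 E.fLo_lt.le) hf.1 hf.2
  have hφlim : Tendsto φ (𝓝 s) (𝓝 f) := by
    rw [tendsto_order]
    constructor
    · intro x hx
      obtain ⟨x', hx', hx'f⟩ := exists_between (max_lt hx hf.1)
      have hx'I : x' ∈ Icc E.fLo E.fHi :=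
        ⟨(le_max_right _ _).trans hx'.le, (hx'f.trans hf.2).le⟩
      filter_upwards [hdom, hnear hx'I (right_mem_Icc.2 E.fLo_lt.le) hx'f hf.2] with t h1 h2
      obtain ⟨h3, h4⟩ := hφ t h1
      by_contra! hle
      have h5 := hanti.antitoneOn (Ioo_subset_Icc_self h3) hx'I
        (hle.trans ((le_max_left _ _).trans hx'.le))
      simp only [h4] at h5
      exact absurd h2.2 (not_lt.2 h5)
    · intro y hy
      obtain ⟨y', hfy', hy'⟩ := exists_between (lt_min hy hf.2)
      have hy'I : y' ∈ Icc E.fLo E.fHi :=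
        ⟨(hf.1.trans hfy').le, hy'.le.trans (min_le_right _ _)⟩
      filter_upwards [hdom, hnear (left_mem_Icc.2 E.fLo_lt.le) hy'I hf.1 hfy'] with t h1 h2
      obtain ⟨h3, h4⟩ := hφ t h1
      by_contra! hle
      have h5 := hanti.antitoneOn hy'I (Ioo_subset_Icc_self h3)
        ((hy'.le.trans (min_le_left _ _)).trans hle)
      simp only [h4] at h5
      exact absurd h2.1 (not_lt.2 h5)

  have hv0 : HasDerivAt (fun t => E.surplus Φ s m - E.surplus Φ t m) (-E.surplusDeriv Φ s m) s :=
    hv.const_sub _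
  -- Upper and lower bounds on the increment of `log W` at `s`.
  have hup : HasDerivAt (fun t => (E.surplus Φ s m - E.surplus Φ t m) / (E.surplus Φ t m - f))
      (E.decay Φ s (m, f)) s := by
    refine (hv0.fun_div (hv.sub_const f) (sub_pos.2 hu).ne').congr_deriv ?_
    have h0 := (sub_pos.2 hu).ne'
    simp only [Sellers.decay, sub_self, zero_mul, sub_zero]
    field_simp
  have hlow : HasDerivAt
      (fun t => (E.surplus Φ s m - E.surplus Φ t m) / (E.surplus Φ s m - φ t))
      (E.decay Φ s (m, f)) s := by
    have he : Tendsto (fun t => (E.surplus Φ s m - φ t)⁻¹) (𝓝 s) (𝓝 (E.surplus Φ s m - f)⁻¹) :=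
      (hφlim.const_sub _).inv₀ (sub_pos.2 hu).ne'
    rw [hasDerivAt_iff_tendsto_slope] at hv0 ⊢
    have h1 := hv0.mul (he.mono_left nhdsWithin_le_nhds)
    rw [← div_eq_mul_inv] at h1
    refine h1.congr fun t => ?_
    simp only [slope_def_field, sub_self, zero_div, sub_zero]
    ring
  have hbounds : ∀ᶠ t in 𝓝 s,
      (E.surplus Φ s m - E.surplus Φ t m) / (E.surplus Φ s m - φ t) ≤
        Real.log (winProb E Φ g b t) - Real.log (winProb E Φ g b s) ∧
      Real.log (winProb E Φ g b t) - Real.log (winProb E Φ g b s) ≤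
        (E.surplus Φ s m - E.surplus Φ t m) / (E.surplus Φ t m - f) := by
    filter_upwards [hdom, hφlim.eventually (gt_mem_nhds hu),
      hv.continuousAt.eventually (lt_mem_nhds hu), eventually_mem_scores hΦ hreg hprof]
      with t h1 h2 h3 h4
    obtain ⟨hx, hxt⟩ := hφ t h1
    have hxτ : (m, φ t) ∈ E.types := ⟨hm, Ioo_subset_Icc_self hx⟩
    have hbt : IsBestScore E Φ g b (m, φ t) t := by
      have := H.isBestScore hΦ hreg hxτ
      rwa [hxt] at this
    obtain ⟨hWt, hut⟩ := H.pos_of_isBestScore hΦ hreg hxτ hx.2 hbt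
    simp only at hut
    have p1 := sub_pos.2 hu
    have p2 := sub_pos.2 hut
    have p3 := sub_pos.2 h3
    have p4 : 0 < E.surplus Φ s m - φ t := sub_pos.2 h2
    have hA := hbt.2 s hbest.1
    have hB := hbest.2 t h4
    simp only at hA hB
    rw [← Real.log_div hWt.ne' hWs.ne']
    constructor
    · have h5 : (E.surplus Φ s m - φ t) / (E.surplus Φ t m - φ t) ≤
          winProb E Φ g b t / winProb E Φ g b s := by
        rw [div_le_div_iff₀ p2 hWs]
        linarith
      refine le_trans ?_ (Real.log_le_log (div_pos p4 p2) h5)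
      refine le_trans (le_of_eq ?_) (Real.one_sub_inv_le_log_of_pos (div_pos p4 p2))
      field_simp
      ring
    · have h5 : winProb E Φ g b t / winProb E Φ g b s ≤
          (E.surplus Φ s m - f) / (E.surplus Φ t m - f) := by
        rw [div_le_div_iff₀ hWs p3]
        linarith
      refine (Real.log_le_log (div_pos hWt hWs) h5).trans ?_
      refine (Real.log_le_sub_one_of_pos (div_pos p1 p3)).trans (le_of_eq ?_)
      field_simp
      ring
  rw [hasDerivAt_iff_isLittleO] at hup hlow ⊢
  simp only [sub_self, zero_div, sub_zero] at hup hlow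
  refine Asymptotics.IsBigO.trans_isLittleO ?_ (hup.norm_left.add hlow.norm_left)
  refine Asymptotics.IsBigO.of_bound 1 ?_
  filter_upwards [hbounds] with t ht
  rw [one_mul, Real.norm_eq_abs, Real.norm_eq_abs, Real.norm_eq_abs, Real.norm_eq_abs]
  refine le_trans ?_ (le_abs_self _)
  refine abs_le.2 ⟨?_, ?_⟩
  · have := neg_abs_le ((E.surplus Φ s m - E.surplus Φ t m) / (E.surplus Φ s m - φ t) -
      (t - s) • E.decay Φ s (m, f))
    have h0 := abs_nonneg ((E.surplus Φ s m - E.surplus Φ t m) / (E.surplus Φ t m - f) -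
      (t - s) • E.decay Φ s (m, f))
    linarith [ht.1]
  · have := le_abs_self ((E.surplus Φ s m - E.surplus Φ t m) / (E.surplus Φ t m - f) -
      (t - s) • E.decay Φ s (m, f))
    have h0 := abs_nonneg ((E.surplus Φ s m - E.surplus Φ t m) / (E.surplus Φ s m - φ t) -
      (t - s) • E.decay Φ s (m, f))
    linarith [ht.2]

theorem decay_eq (hΦ : IsScoringRule Φ) (hreg : IsRegular E Φ)
    (H : IsContinuousEquilibrium E Φ g b) {m f : ℝ} (hm : m ∈ Icc E.mLo E.mHi)
    (hf : f ∈ Ioo E.fLo E.fHi) {τ : ℝ × ℝ} (hτ : τ ∈ E.types) (hτf : τ.2 < E.fHi)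
    (heq : Φ (b τ) = Φ (b (m, f))) :
    E.decay Φ (Φ (b (m, f))) τ = E.decay Φ (Φ (b (m, f))) (m, f) := by
  have hd := H.hasDerivAt_log_winProb hΦ hreg hm hf
  set s := Φ (b (m, f)) with hs
  have hbest : IsBestScore E Φ g b τ s := heq ▸ H.isBestScore hΦ hreg hτ
  obtain ⟨hWs, hu⟩ := H.pos_of_isBestScore hΦ hreg hτ hτf hbest
  have hprof : (s, τ.1) ∈ E.profitable Φ := profitable_of_lt hbest.1 hτ hu
  have hmax : IsLocalMax (fun t => Real.log (winProb E Φ g b t) +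
      Real.log (E.surplus Φ t τ.1 - τ.2)) s := by
    filter_upwards [(H.continuous_winProb hΦ).continuousAt.eventually (lt_mem_nhds hWs),
      (hasDerivAt_surplus hΦ hreg hprof).continuousAt.eventually (lt_mem_nhds hu),
      eventually_mem_scores hΦ hreg hprof] with t h1 h2 h3
    rw [← Real.log_mul h1.ne' (sub_pos.2 h2).ne', ← Real.log_mul hWs.ne' (sub_pos.2 hu).ne']
    exact Real.log_le_log (mul_pos h1 (sub_pos.2 h2)) (hbest.2 t h3)
  have := hmax.hasDerivAt_eq_zero
    (hd.fun_add (hasDerivAt_log_surplus hΦ hreg hbest.1 hτ hu))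
  linarith

/-! ### The types who bid below a given score -/

theorem lt_score_of_decay_lt (hΦ : IsScoringRule Φ) (hreg : IsRegular E Φ)
    (H : IsContinuousEquilibrium E Φ g b) {m f m' f' : ℝ} (hm : m ∈ Icc E.mLo E.mHi)
    (hf : f ∈ Ioo E.fLo E.fHi) (hm' : m' ∈ Icc E.mLo E.mHi) (hf' : f' ∈ Ioo E.fLo E.fHi)
    (hu : f' < E.surplus Φ (Φ (b (m, f))) m')
    (h : E.decay Φ (Φ (b (m, f))) (m', f') < E.decay Φ (Φ (b (m, f))) (m, f)) :
    Φ (b (m, f)) < Φ (b (m', f')) := by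
  have hfoc : ∀ {x y}, x ∈ Icc E.mLo E.mHi → y ∈ Ioo E.fLo E.fHi →
      Φ (b (x, y)) = Φ (b (m, f)) → E.decay Φ (Φ (b (m, f))) (x, y) =
        E.decay Φ (Φ (b (m, f))) (m, f) := fun hx hy => H.decay_eq hΦ hreg hm hf
    ⟨hx, Ioo_subset_Icc_self hy⟩ hy.2
  have hsIm : Φ (b (m, f)) ∈ Φ '' contracts := H.score_mem ⟨hm, Ioo_subset_Icc_self hf⟩
  have hmono := H.score_antitoneOn hΦ hreg
  set s := Φ (b (m, f)) with hs
  by_contra! hle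
  have hne : Φ (b (m', f')) ≠ s := fun he => h.ne (hfoc hm' hf' he)
  -- Move from `(m', f')` to `(m', y)`, where `y ≤ f, f'`, and on to `(m, y)`. The score `s` is bid
  -- somewhere on the way, but not by types whose utility decays too slowly.
  set y := min f f' with hy
  have hyI : y ∈ Ioo E.fLo E.fHi := ⟨lt_min hf.1 hf'.1, (min_le_left _ _).trans_lt hf.2⟩
  have hyf' : y ≤ f' := min_le_right _ _
  have hdec : ∀ x, y ≤ x → x ≤ f' → E.decay Φ s (m', x) < E.decay Φ s (m, f) := by
    intro x h1 h2
    rcases h2.eq_or_lt with rfl | h2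
    · exact h
    · exact (decay_lt_of_fixed_lt hΦ hreg hsIm
        ⟨hm', hyI.1.le.trans h1, h2.le.trans hf'.2.le⟩ h2 hu).trans h
  have hleg1 : Φ (b (m', y)) < s := by
    by_contra! hge
    obtain ⟨x, hx, hxs⟩ := intermediate_value_Icc' hyf'
      ((H.continuousOn m' hm').mono (Icc_subset_Icc hyI.1.le hf'.2.le)) ⟨hle, hge⟩
    exact (hdec x hx.1 hx.2).ne (hfoc hm' ⟨hyI.1.trans_le hx.1, hx.2.trans_lt hf'.2⟩ hxs)
  have hend : s ≤ Φ (b (m, y)) := hmono ⟨hm, Ioo_subset_Icc_self hyI⟩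
    ⟨hm, Ioo_subset_Icc_self hf⟩ ⟨le_rfl, min_le_left _ _⟩
  have hcont : ContinuousOn (fun x => Φ (b (x, y))) (uIcc m' m) := by
    intro x hx
    have hxI : x ∈ Icc E.mLo E.mHi := ordConnected_Icc.uIcc_subset hm' hm hx
    exact ContinuousWithinAt.comp (f := fun x => (x, y))
      (H.continuousWithinAt_score hΦ hreg hxI hyI)
      (by fun_prop) fun z hz =>
        ⟨ordConnected_Icc.uIcc_subset hm' hm hz, Ioo_subset_Icc_self hyI⟩
  obtain ⟨x, hx, hxs⟩ := intermediate_value_uIcc hcont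
    (Icc_subset_uIcc ⟨hleg1.le, hend⟩)
  simp only at hxs
  have hxI : x ∈ Icc E.mLo E.mHi := ordConnected_Icc.uIcc_subset hm' hm hx
  have hxt : (x, y) ∈ E.types := ⟨hxI, Ioo_subset_Icc_self hyI⟩
  have hyt : (m', y) ∈ E.types := ⟨hm', Ioo_subset_Icc_self hyI⟩
  rcases le_or_gt m' x with hlt | hlt
  · have := hmono hyt hxt ⟨hlt, le_rfl⟩
    simp only [hxs] at this
    exact absurd hleg1 (not_lt.2 this)
  · have h1 := decay_lt_of_marginal_lt hΦ hreg hsIm hxt hyt hlt (hyf'.trans_lt hu)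
    rw [hfoc hxI hyI hxs] at h1
    exact lt_asymm h1 (hdec y le_rfl hyf')

theorem score_lt_of_decay_lt (hΦ : IsScoringRule Φ) (hreg : IsRegular E Φ)
    (H : IsContinuousEquilibrium E Φ g b) {m f m' f' : ℝ} (hm : m ∈ Icc E.mLo E.mHi)
    (hf : f ∈ Ioo E.fLo E.fHi) (hm' : m' ∈ Icc E.mLo E.mHi) (hf' : f' ∈ Ioo E.fLo E.fHi)
    (h : E.decay Φ (Φ (b (m, f))) (m, f) < E.decay Φ (Φ (b (m, f))) (m', f')) :
    Φ (b (m', f')) < Φ (b (m, f)) := by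
  have hfoc : ∀ {x y}, x ∈ Icc E.mLo E.mHi → y ∈ Ioo E.fLo E.fHi →
      Φ (b (x, y)) = Φ (b (m, f)) → E.decay Φ (Φ (b (m, f))) (x, y) =
        E.decay Φ (Φ (b (m, f))) (m, f) := fun hx hy => H.decay_eq hΦ hreg hm hf
    ⟨hx, Ioo_subset_Icc_self hy⟩ hy.2
  have hlt : ∀ {x y}, x ∈ Icc E.mLo E.mHi → y ∈ Ioo E.fLo E.fHi →
      Φ (b (m, f)) ≤ Φ (b (x, y)) → y < E.surplus Φ (Φ (b (m, f))) x := fun hx hy hle =>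
    (H.lt_surplus hΦ hreg ⟨hx, Ioo_subset_Icc_self hy⟩ hy.2).trans_le
      ((surplus_strictAntiOn hΦ hreg _).antitoneOn
        (H.score_mem ⟨hm, Ioo_subset_Icc_self hf⟩) (H.score_mem ⟨hx, Ioo_subset_Icc_self hy⟩) hle)
  have hsIm : Φ (b (m, f)) ∈ Φ '' contracts := H.score_mem ⟨hm, Ioo_subset_Icc_self hf⟩
  have hmono := H.score_antitoneOn hΦ hreg
  set s := Φ (b (m, f)) with hs
  by_contra! hle
  set y := max f f' with hy
  have hyI : y ∈ Ioo E.fLo E.fHi := ⟨lt_max_of_lt_left hf.1, max_lt hf.2 hf'.2⟩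
  have hyf' : f' ≤ y := le_max_right _ _
  have hdec : ∀ x, f' ≤ x → x ≤ y → x < E.surplus Φ s m' →
      E.decay Φ s (m, f) < E.decay Φ s (m', x) := by
    intro x h1 h2 h3
    rcases h1.eq_or_lt with rfl | h1
    · exact h
    · exact h.trans (decay_lt_of_fixed_lt hΦ hreg hsIm ⟨hm', Ioo_subset_Icc_self hf'⟩ h1 h3)
  have hleg1 : s < Φ (b (m', y)) := by
    by_contra! hge
    obtain ⟨x, hx, hxs⟩ := intermediate_value_Icc' hyf'
      ((H.continuousOn m' hm').mono (Icc_subset_Icc hf'.1.le hyI.2.le)) ⟨hge, hle⟩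
    have hxI : x ∈ Ioo E.fLo E.fHi := ⟨hf'.1.trans_le hx.1, hx.2.trans_lt hyI.2⟩
    exact (hdec x hx.1 hx.2 (hlt hm' hxI hxs.ge)).ne' (hfoc hm' hxI hxs)
  have hend : Φ (b (m, y)) ≤ s := hmono ⟨hm, Ioo_subset_Icc_self hf⟩
    ⟨hm, Ioo_subset_Icc_self hyI⟩ ⟨le_rfl, le_max_left _ _⟩
  have hcont : ContinuousOn (fun x => Φ (b (x, y))) (uIcc m m') := by
    intro x hx
    have hxI : x ∈ Icc E.mLo E.mHi := ordConnected_Icc.uIcc_subset hm hm' hx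
    exact ContinuousWithinAt.comp (f := fun x => (x, y))
      (H.continuousWithinAt_score hΦ hreg hxI hyI)
      (by fun_prop) fun z hz =>
        ⟨ordConnected_Icc.uIcc_subset hm hm' hz, Ioo_subset_Icc_self hyI⟩
  obtain ⟨x, hx, hxs⟩ := intermediate_value_uIcc hcont
    (Icc_subset_uIcc ⟨hend, hleg1.le⟩)
  simp only at hxs
  have hxI : x ∈ Icc E.mLo E.mHi := ordConnected_Icc.uIcc_subset hm hm' hx
  have hxt : (x, y) ∈ E.types := ⟨hxI, Ioo_subset_Icc_self hyI⟩
  have hyt : (m', y) ∈ E.types := ⟨hm', Ioo_subset_Icc_self hyI⟩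
  rcases le_or_gt x m' with hle' | hgt
  · have := hmono hxt hyt ⟨hle', le_rfl⟩
    simp only [hxs] at this
    exact absurd hleg1 (not_lt.2 this)
  · have h1 := decay_lt_of_marginal_lt hΦ hreg hsIm hyt hxt hgt (hlt hxI hyI hxs.ge)
    rw [hfoc hxI hyI hxs] at h1
    exact lt_asymm h1 (hdec y hyf' le_rfl (hlt hm' hyI hleg1.le))

/-- The types who bid below the score of `(m, f)` depend on the equilibrium only through that
score. This makes the sets of types that are outbid comparable across densities. -/
theorem score_lt_iff (hΦ : IsScoringRule Φ) (hreg : IsRegular E Φ)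
    (H : IsContinuousEquilibrium E Φ g b) {m f m' f' : ℝ} (hm : m ∈ Icc E.mLo E.mHi)
    (hf : f ∈ Ioo E.fLo E.fHi) (hm' : m' ∈ Icc E.mLo E.mHi) (hf' : f' ∈ Ioo E.fLo E.fHi) :
    Φ (b (m', f')) < Φ (b (m, f)) ↔ ¬ (f' < E.surplus Φ (Φ (b (m, f))) m' ∧
      E.decay Φ (Φ (b (m, f))) (m', f') ≤ E.decay Φ (Φ (b (m, f))) (m, f)) := by
  have hsIm : Φ (b (m, f)) ∈ Φ '' contracts := H.score_mem ⟨hm, Ioo_subset_Icc_self hf⟩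
  have ht' : (m', f') ∈ E.types := ⟨hm', Ioo_subset_Icc_self hf'⟩
  constructor
  · rintro hlt ⟨hu, hdec⟩
    -- Types with slightly lower fixed costs bid more than the score of `(m, f)`.
    have : (𝓝[Ioo E.fLo f'] f').NeBot := by
      rw [nhdsWithin_Ioo_eq_nhdsLT hf'.1]; infer_instance
    refine absurd hlt (not_lt.2 (ge_of_tendsto ((H.continuousOn m' hm' f'
      (Ioo_subset_Icc_self hf')).tendsto.mono_left (nhdsWithin_mono (s := Ioo E.fLo f') _
      fun x hx => ⟨hx.1.le, (hx.2.trans hf'.2).le⟩)) ?_))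
    filter_upwards [self_mem_nhdsWithin] with x hx
    refine (H.lt_score_of_decay_lt hΦ hreg hm hf hm' ⟨hx.1, hx.2.trans hf'.2⟩ (hx.2.trans hu)
      (lt_of_lt_of_le ?_ hdec)).le
    exact decay_lt_of_fixed_lt hΦ hreg hsIm ⟨hm', hx.1.le, (hx.2.trans hf'.2).le⟩ hx.2 hu
  · intro h
    by_contra! hle
    have hu : f' < E.surplus Φ (Φ (b (m, f))) m' :=
      (H.lt_surplus hΦ hreg ht' hf'.2).trans_le
        ((surplus_strictAntiOn hΦ hreg _).antitoneOn hsIm (H.score_mem ht') hle)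
    refine h ⟨hu, ?_⟩
    by_contra! hlt
    exact absurd (H.score_lt_of_decay_lt hΦ hreg hm hf hm' hf' hlt) (not_lt.2 hle)

end IsContinuousEquilibrium

/-! ### Adding types just below a given type -/

theorem ofReal_mul_le_volume {T : Set (ℝ × ℝ)} {a b l : ℝ}
    (h : ∀ x ∈ Icc a b, ENNReal.ofReal l ≤ volume {y | (x, y) ∈ T}) :
    ENNReal.ofReal l * ENNReal.ofReal (b - a) ≤ volume T := by
  calc ENNReal.ofReal l * ENNReal.ofReal (b - a)
      = ∫⁻ _ in Icc a b, ENNReal.ofReal l := by rw [setLIntegral_const, Real.volume_Icc]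
    _ ≤ ∫⁻ x in Icc a b, volume (Prod.mk x ⁻¹' toMeasurable volume T) :=
        setLIntegral_mono' measurableSet_Icc fun x hx => (h x hx).trans
          (measure_mono fun y hy => subset_toMeasurable volume T hy)
    _ ≤ ∫⁻ x, volume (Prod.mk x ⁻¹' toMeasurable volume T) := setLIntegral_le_lintegral _ _
    _ = volume T := by
        rw [← Measure.prod_apply (measurableSet_toMeasurable _ _), ← Measure.volume_eq_prod,
          measure_toMeasurable]

theorem ae_fixed_mem_Ioo (E : Sellers) :
    ∀ᵐ τ ∂volume.restrict E.types, τ.2 ∈ Ioo E.fLo E.fHi := by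
  have hline : ∀ a : ℝ, ∀ᵐ τ : ℝ × ℝ, τ.2 ≠ a := by
    intro a
    have : {τ : ℝ × ℝ | ¬ τ.2 ≠ a} = univ ×ˢ {a} := by
      ext τ; simp
    rw [ae_iff, this, Measure.volume_eq_prod, Measure.prod_prod]
    simp
  filter_upwards [ae_restrict_mem (measurableSet_types E), ae_restrict_of_ae (hline E.fLo),
    ae_restrict_of_ae (hline E.fHi)] with τ h1 h2 h3
  exact ⟨lt_of_le_of_ne h1.2.1 (Ne.symm h2), lt_of_le_of_ne h1.2.2 h3⟩

theorem isFiniteMeasure_types (E : Sellers) : IsFiniteMeasure (volume.restrict E.types) :=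
  ⟨by
    rw [Measure.restrict_apply_univ]
    exact (isCompact_Icc.prod isCompact_Icc).measure_lt_top⟩

section Band

variable {E : Sellers} {Φ : ℝ × ℝ → ℝ}

/-- The types whose utility decays at a rate between those of `(m, x)` and `(m, y)` form a band
around the column of `m` with a thickness proportional to `y - x`. -/
theorem exists_band (hΦ : IsScoringRule Φ) (hreg : IsRegular E Φ) {s₀ m f : ℝ}
    (hs₀ : s₀ ∈ Φ '' contracts) (hm : m ∈ Ico E.mLo E.mHi) (hf : f ∈ Ioo E.fLo E.fHi)
    (hu : f < E.surplus Φ s₀ m) :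
    ∃ r > 0, m + r ≤ E.mHi ∧ ∀ s, |s - s₀| < r → ∀ m' ∈ Icc m (m + r), ∀ x y, f ≤ x → x < y →
      y < f + r → ∃ lo hi, E.fLo ≤ lo ∧ hi ≤ E.fHi ∧ (y - x) / 2 ≤ hi - lo ∧
        ∀ z ∈ Ioo lo hi, z < E.surplus Φ s m' ∧ E.decay Φ s (m, x) < E.decay Φ s (m', z) ∧
          E.decay Φ s (m', z) ≤ E.decay Φ s (m, y) := by
  have hmI : m ∈ Icc E.mLo E.mHi := Ico_subset_Icc_self hm
  have hprof : (s₀, m) ∈ E.profitable Φ :=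
    profitable_of_lt hs₀ ⟨hmI, Ioo_subset_Icc_self hf⟩ hu
  set l := 𝓝[univ ×ˢ Icc E.mLo E.mHi] (s₀, m) with hl
  have hmem1 : ∀ᶠ p in l, p ∈ E.profitable Φ := eventually_profitable hΦ hreg hprof
  have hid : Tendsto (fun p : ℝ × ℝ => p) l (𝓝[E.profitable Φ] (s₀, m)) :=
    tendsto_nhdsWithin_iff.2 ⟨nhdsWithin_le_nhds, hmem1⟩
  have hcol : Tendsto (fun p : ℝ × ℝ => (p.1, m)) l (𝓝[univ ×ˢ Icc E.mLo E.mHi] (s₀, m)) := by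
    refine ContinuousWithinAt.tendsto_nhdsWithin (f := fun p : ℝ × ℝ => (p.1, m)) (x := (s₀, m))
      (by fun_prop) fun p _ => ⟨mem_univ _, hmI⟩
  have hmem2 : ∀ᶠ p in l, (p.1, m) ∈ E.profitable Φ := hcol.eventually hmem1
  have hcol' : Tendsto (fun p : ℝ × ℝ => (p.1, m)) l (𝓝[E.profitable Φ] (s₀, m)) :=
    tendsto_nhdsWithin_iff.2 ⟨hcol.mono_right nhdsWithin_le_nhds, hmem2⟩
  have hne := (surplusDeriv_neg hΦ hreg hprof).ne
  have hv1 := ((continuousOn_surplus hΦ hreg) _ hprof).tendsto.comp hid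
  have hv2 := ((continuousOn_surplus hΦ hreg) _ hprof).tendsto.comp hcol'
  have hd1 := ((continuousOn_surplusDeriv hΦ hreg) _ hprof).tendsto.comp hid
  have hd2 := ((continuousOn_surplusDeriv hΦ hreg) _ hprof).tendsto.comp hcol'
  have hk : Tendsto (fun p : ℝ × ℝ => E.surplusDeriv Φ p.1 p.2 / E.surplusDeriv Φ p.1 m) l
      (𝓝 1) := by
    have := hd1.div hd2 hne
    rwa [div_self hne] at this
  have hheight : Tendsto (fun q : (ℝ × ℝ) × ℝ => E.surplus Φ q.1.1 q.1.2 -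
      (E.surplus Φ q.1.1 m - q.2) *
        (E.surplusDeriv Φ q.1.1 q.1.2 / E.surplusDeriv Φ q.1.1 m)) (l ×ˢ 𝓝 f) (𝓝 f) := by
    have := (hv1.comp tendsto_fst).sub (((hv2.comp tendsto_fst).sub
      (tendsto_snd (f := l) (g := 𝓝 f))).mul (hk.comp (tendsto_fst (f := l) (g := 𝓝 f))))
    simp only [mul_one, sub_sub_cancel] at this
    exact this
  have hgap : Tendsto (fun q : (ℝ × ℝ) × ℝ => E.surplus Φ q.1.1 m - q.2) (l ×ˢ 𝓝 f)
      (𝓝 (E.surplus Φ s₀ m - f)) := (hv2.comp tendsto_fst).sub tendsto_snd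
  have hall := ((hheight.eventually (Ioo_mem_nhds hf.1 hf.2)).and
    (hgap.eventually (lt_mem_nhds (sub_pos.2 hu)))).and
    (tendsto_fst.eventually ((hmem1.and hmem2).and
      (hk.eventually (lt_mem_nhds (show (1 / 2 : ℝ) < 1 by norm_num)))))
  obtain ⟨p, hp, q, hq, hpq⟩ := eventually_prod_iff.1 hall
  obtain ⟨r₁, hr₁, hball₁⟩ := Metric.mem_nhdsWithin_iff.1 hp
  obtain ⟨r₂, hr₂, hball₂⟩ := Metric.eventually_nhds_iff_ball.1 hq
  refine ⟨min (min (r₁ / 2) r₂) (E.mHi - m), lt_min (lt_min (by linarith) hr₂)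
    (sub_pos.2 hm.2), by linarith [min_le_right (min (r₁ / 2) r₂) (E.mHi - m)], ?_⟩
  intro s hs m' hm' x y hfx hxy hy
  have hle1 : min (min (r₁ / 2) r₂) (E.mHi - m) ≤ r₁ / 2 :=
    (min_le_left _ _).trans (min_le_left _ _)
  have hle2 : min (min (r₁ / 2) r₂) (E.mHi - m) ≤ r₂ := (min_le_left _ _).trans (min_le_right _ _)
  have hle3 := min_le_right (min (r₁ / 2) r₂) (E.mHi - m)
  have hpm : p (s, m') := by
    refine hball₁ ⟨?_, mem_univ _, hm.1.trans hm'.1, by linarith [hm'.2]⟩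
    rw [Metric.mem_ball, Prod.dist_eq, max_lt_iff, Real.dist_eq, Real.dist_eq]
    refine ⟨by linarith, ?_⟩
    simp only
    rw [abs_of_nonneg (sub_nonneg.2 hm'.1)]
    linarith [hm'.2]
  have hqz : ∀ z, f ≤ z → z < f + min (min (r₁ / 2) r₂) (E.mHi - m) → q z := fun z h1 h2 => by
    refine hball₂ z ?_
    rw [Metric.mem_ball, Real.dist_eq, abs_of_nonneg (sub_nonneg.2 h1)]
    linarith
  obtain ⟨⟨hx1, hx2⟩, ⟨hp1, hp2⟩, hk1⟩ := hpq hpm (hqz x hfx (hxy.trans hy))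
  obtain ⟨⟨hy1, hy2⟩, -⟩ := hpq hpm (hqz y (hfx.trans hxy.le) hy)
  simp only at hx1 hx2 hp1 hp2 hk1 hy1 hy2
  have hn1 := surplusDeriv_neg hΦ hreg hp1
  have hn2 := surplusDeriv_neg hΦ hreg hp2
  set k := E.surplusDeriv Φ s m' / E.surplusDeriv Φ s m with hkdef
  have hk0 : 0 < k := by linarith
  have hkmul : E.surplusDeriv Φ s m' = k * E.surplusDeriv Φ s m := by
    rw [hkdef, div_mul_cancel₀ _ hn2.ne]
  have hdecay : ∀ w, 0 < E.surplus Φ s m - w →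
      E.decay Φ s (m, w) = -E.surplusDeriv Φ s m' / ((E.surplus Φ s m - w) * k) := by
    intro w hw
    rw [Sellers.decay, hkmul]
    field_simp
  refine ⟨_, _, hx1.1.le, hy1.2.le, ?_, ?_⟩
  · nlinarith
  · rintro z ⟨hz1, hz2⟩
    have h1 : 0 < (E.surplus Φ s m - y) * k := mul_pos hy2 hk0
    have hz : 0 < E.surplus Φ s m' - z := by linarith
    refine ⟨by linarith, ?_, ?_⟩
    · rw [hdecay x hx2, Sellers.decay]
      exact div_lt_div_of_pos_left (neg_pos.2 hn1) hz (by simp only; linarith)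
    · rw [hdecay y hy2, Sellers.decay]
      exact div_le_div_of_nonneg_left (neg_pos.2 hn1).le h1 (by simp only; linarith)

end Band

namespace IsContinuousEquilibrium

variable {E : Sellers} {Φ : ℝ × ℝ → ℝ} {g g' : ℝ × ℝ → ℝ} {b b' : ℝ × ℝ → ℝ × ℝ}

theorem score_lt_of_score_lt (hΦ : IsScoringRule Φ) (hreg : IsRegular E Φ)
    (H : IsContinuousEquilibrium E Φ g b) (H' : IsContinuousEquilibrium E Φ g' b') {m x y : ℝ}
    (hm : m ∈ Icc E.mLo E.mHi) (hx : x ∈ Ioo E.fLo E.fHi) (hy : y ∈ Ioo E.fLo E.fHi)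
    (hxy : x ≤ y) (heq : Φ (b' (m, y)) = Φ (b (m, x))) {τ : ℝ × ℝ} (hτ : τ ∈ E.types)
    (hτf : τ.2 ∈ Ioo E.fLo E.fHi) (h : Φ (b' τ) < Φ (b (m, x))) : Φ (b τ) < Φ (b (m, x)) := by
  obtain ⟨m', f'⟩ := τ
  have hyu : y < E.surplus Φ (Φ (b (m, x))) m := by
    have := H'.lt_surplus hΦ hreg (τ := (m, y)) ⟨hm, Ioo_subset_Icc_self hy⟩ hy.2
    rwa [heq] at this
  have hdec : E.decay Φ (Φ (b (m, x))) (m, x) ≤ E.decay Φ (Φ (b (m, x))) (m, y) := by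
    rcases hxy.eq_or_lt with rfl | hxy
    · exact le_rfl
    · exact (decay_lt_of_fixed_lt hΦ hreg (H.score_mem ⟨hm, Ioo_subset_Icc_self hx⟩)
        ⟨hm, Ioo_subset_Icc_self hx⟩ hxy hyu).le
  rw [← heq, H'.score_lt_iff hΦ hreg hm hy hτ.1 hτf, heq] at h
  rw [H.score_lt_iff hΦ hreg hm hx hτ.1 hτf]
  exact fun h' => h ⟨h'.1, h'.2.trans hdec⟩

theorem score_lt_iff_score_lt (hΦ : IsScoringRule Φ) (hreg : IsRegular E Φ)
    (H : IsContinuousEquilibrium E Φ g b) (H' : IsContinuousEquilibrium E Φ g' b') {m x : ℝ}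
    (hm : m ∈ Icc E.mLo E.mHi) (hx : x ∈ Ioo E.fLo E.fHi)
    (heq : Φ (b' (m, x)) = Φ (b (m, x))) {τ : ℝ × ℝ} (hτ : τ ∈ E.types)
    (hτf : τ.2 ∈ Ioo E.fLo E.fHi) : Φ (b' τ) < Φ (b (m, x)) ↔ Φ (b τ) < Φ (b (m, x)) := by
  refine ⟨H.score_lt_of_score_lt hΦ hreg H' hm hx hx le_rfl heq hτ hτf, fun h => ?_⟩
  rw [← heq] at h ⊢
  exact H'.score_lt_of_score_lt hΦ hreg H hm hx hx le_rfl heq.symm hτ hτf h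

theorem integrable_indicator (H : IsContinuousEquilibrium E Φ g b)
    (H' : IsContinuousEquilibrium E Φ g' b') (s : ℝ) :
    Integrable ({τ | Φ (b τ) < s}.indicator g') (volume.restrict E.types) :=
  Integrable.indicator₀ H'.density.1 (H.nullMeasurableSet_lt s)

/-- Let `g' = g + ε h`, where `h` is the indicator of `X` on the types who bid less than `s₀`. If
`s ≤ s₀` is bid by `(m, x)` at `g` and by a worse type `(m, y)` at `g'`, then fewer types bid less
than `s` at `g'`, and the winning probability grows by less than the mass that is added. -/
theorem winProb_sub_le (hΦ : IsScoringRule Φ) (hreg : IsRegular E Φ)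
    (H : IsContinuousEquilibrium E Φ g b) (H' : IsContinuousEquilibrium E Φ g' b')
    {c : ℝ} (hc : ∀ᵐ τ ∂volume.restrict E.types, c ≤ g τ) {X : Set (ℝ × ℝ)} {h : ℝ × ℝ → ℝ}
    {ε s s₀ m x y : ℝ} (hX : MeasurableSet X) (hXt : X ⊆ E.types) (hε : 0 < ε)
    (hh : ∀ τ ∈ E.types, Φ (b τ) < s₀ → h τ = X.indicator 1 τ)
    (hg' : ∀ τ ∈ E.types, g' τ = g τ + ε * h τ) (hs : s ≤ s₀) (hm : m ∈ Icc E.mLo E.mHi)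
    (hx : x ∈ Ioo E.fLo E.fHi) (hy : y ∈ Ioo E.fLo E.fHi) (hxy : x ≤ y)
    (hxs : Φ (b (m, x)) = s) (hys : Φ (b' (m, y)) = s) :
    winProb E Φ g' b' s - winProb E Φ g b s ≤ ε * volume.real X -
      c * volume.real {τ | τ ∈ E.types ∧ Φ (b τ) < s ∧ ¬ Φ (b' τ) < s} := by
  have := isFiniteMeasure_types E
  set T : Set (ℝ × ℝ) := {τ | Φ (b τ) < s ∧ ¬ Φ (b' τ) < s} with hT
  have hTm : NullMeasurableSet T (volume.restrict E.types) :=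
    (H.nullMeasurableSet_lt s).inter (H'.nullMeasurableSet_lt s).compl
  have hTX : {τ | τ ∈ E.types ∧ Φ (b τ) < s ∧ ¬ Φ (b' τ) < s} = T ∩ E.types := by
    ext τ; exact and_comm
  have hI1 : Integrable (X.indicator (1 : ℝ × ℝ → ℝ)) (volume.restrict E.types) :=
    (integrable_indicator_iff hX).2 (integrable_const _).integrableOn
  have hI2 : Integrable (T.indicator (1 : ℝ × ℝ → ℝ)) (volume.restrict E.types) :=
    Integrable.indicator₀ (integrable_const _) hTm
  rw [H.winProb_eq_setIntegral hΦ, H'.winProb_eq_setIntegral hΦ,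
    ← integral_sub (H'.integrable_indicator H' s) (H.integrable_indicator H s)]
  have e1 : ∫ τ in E.types, X.indicator (1 : ℝ × ℝ → ℝ) τ = volume.real X := by
    rw [integral_indicator_one hX, measureReal_restrict_apply hX, inter_eq_left.2 hXt]
  have e2 : ∫ τ in E.types, T.indicator (1 : ℝ × ℝ → ℝ) τ = volume.real (T ∩ E.types) := by
    rw [integral_indicator₀ hTm]
    simp [measureReal_def, Measure.restrict_apply₀ hTm]
  rw [hTX, ← e1, ← e2, ← integral_const_mul, ← integral_const_mul,
    ← integral_sub (hI1.const_mul _) (hI2.const_mul _)]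
  refine integral_mono_ae ((H'.integrable_indicator H' s).sub (H.integrable_indicator H s))
    ((hI1.const_mul _).sub (hI2.const_mul _)) ?_
  filter_upwards [hc, ae_restrict_mem (measurableSet_types E), ae_fixed_mem_Ioo E]
    with τ hcτ hτ hτf
  have hXnn : 0 ≤ ε * X.indicator (1 : ℝ × ℝ → ℝ) τ :=
    mul_nonneg hε.le (indicator_nonneg (fun _ _ => zero_le_one) τ)
  by_cases h1 : Φ (b' τ) < s
  · have h2 : Φ (b τ) < s := by
      have h3 := H.score_lt_of_score_lt hΦ hreg H' hm hx hy hxy (hys.trans hxs.symm) hτ hτf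
      rw [hxs] at h3
      exact h3 h1
    have h3 : τ ∉ T := fun h => h.2 h1
    simp [h1, h2, h3, hg' τ hτ, hh τ hτ (h2.trans_le hs)]
  · by_cases h2 : Φ (b τ) < s
    · have h3 : τ ∈ T := ⟨h2, h1⟩
      simp only [mem_ofPred_eq, h1, not_false_eq_true, indicator_of_notMem, h2, indicator_of_mem,
        h3, Pi.one_apply, mul_one]
      linarith
    · have h3 : τ ∉ T := fun h => h2 h.1
      simpa [h1, h2, h3] using hXnn

theorem winProb_sub_eq (hΦ : IsScoringRule Φ) (hreg : IsRegular E Φ)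
    (H : IsContinuousEquilibrium E Φ g b) (H' : IsContinuousEquilibrium E Φ g' b')
    {h : ℝ × ℝ → ℝ} {ε s m x : ℝ}
    (hg' : ∀ τ ∈ E.types, g' τ = g τ + ε * h τ) (hm : m ∈ Icc E.mLo E.mHi)
    (hx : x ∈ Ioo E.fLo E.fHi) (hxs : Φ (b (m, x)) = s) (hys : Φ (b' (m, x)) = s) :
    winProb E Φ g' b' s - winProb E Φ g b s =
      ε * ∫ τ in E.types, {τ | Φ (b τ) < s}.indicator h τ := by
  rw [H.winProb_eq_setIntegral hΦ, H'.winProb_eq_setIntegral hΦ,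
    ← integral_sub (H'.integrable_indicator H' s) (H.integrable_indicator H s),
    ← integral_const_mul]
  refine integral_congr_ae ?_
  filter_upwards [ae_restrict_mem (measurableSet_types E), ae_fixed_mem_Ioo E] with τ hτ hτf
  have h1 := H.score_lt_iff_score_lt hΦ hreg H' hm hx (hys.trans hxs.symm) hτ hτf
  rw [hxs] at h1
  by_cases h2 : Φ (b τ) < s <;> simp [h1, h2, hg' τ hτ]

end IsContinuousEquilibrium

namespace IsContinuousEquilibrium

variable {E : Sellers} {Φ : ℝ × ℝ → ℝ} {g : ℝ × ℝ → ℝ} {b : ℝ × ℝ → ℝ × ℝ}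

theorem exists_score_eq_of_mem_Icc (H : IsContinuousEquilibrium E Φ g b) {m x y : ℝ}
    (hm : m ∈ Icc E.mLo E.mHi) (hx : x ∈ Icc E.fLo E.fHi) (hy : y ∈ Icc E.fLo E.fHi)
    (hxy : x ≤ y) {t : ℝ} (ht : t ∈ Icc (Φ (b (m, y))) (Φ (b (m, x)))) :
    ∃ z ∈ Icc x y, Φ (b (m, z)) = t :=
  intermediate_value_Icc' hxy ((H.continuousOn m hm).mono (Icc_subset_Icc hx.1 hy.2)) ht

/-- A function `D` that grows from a nonpositive value at `s₁` to `D s₀ > 0`, at a rate which is the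
difference of the decay rates of the bidders `(m, y)` and `(m, x)`, is positive at some score where
`y - x` is at least of the order of `D s₀` over the difference of the surpluses. In the application
`D` is the logarithm of the quotient of the winning probabilities in two equilibria, and `x` and `y`
are the fixed costs of the types who bid the score in each of them. -/
theorem exists_displacement (hΦ : IsScoringRule Φ) (hreg : IsRegular E Φ) {m f δ s₀ s₁ : ℝ}
    {D : ℝ → ℝ} (h₁ : s₁ ∈ Φ '' contracts) (h₀ : s₀ ∈ Φ '' contracts) (h₁₀ : s₁ < s₀)
    (hm : m ∈ Icc E.mLo E.mHi) (hf : E.fLo ≤ f)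
    (hδ : δ ≤ (E.surplus Φ s₀ m - f) / 2) (hu : f < E.surplus Φ s₀ m)
    (hD : ∀ t ∈ Icc s₁ s₀, ∃ x ∈ Icc f (f + δ), ∃ y ∈ Icc f (f + δ),
      HasDerivAt D (E.decay Φ t (m, y) - E.decay Φ t (m, x)) t) (hD₁ : D s₁ ≤ 0)
    (hD₀ : 0 < D s₀) :
    ∃ ξ ∈ Icc s₁ s₀, 0 < D ξ ∧ ∀ x ∈ Icc f (f + δ), ∀ y ∈ Icc f (f + δ),
      HasDerivAt D (E.decay Φ ξ (m, y) - E.decay Φ ξ (m, x)) ξ →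
      x < y ∧ D s₀ * (E.surplus Φ s₀ m - f) ^ 2 ≤
        4 * (E.surplus Φ s₁ m - E.surplus Φ s₀ m) * (y - x) := by
  have hcont : ContinuousOn D (Icc s₁ s₀) := fun t ht => by
    obtain ⟨x, -, y, -, h⟩ := hD t ht
    exact h.continuousAt.continuousWithinAt
  -- `s₂` is the last score at which `D` is not positive.
  obtain ⟨s₂, ⟨hs₂, hD₂⟩, hmax⟩ :=
    (isCompact_Icc.of_isClosed_subset
      (hcont.preimage_isClosed_of_isClosed isClosed_Icc isClosed_Iic)
      inter_subset_left).exists_isGreatest ⟨s₁, ⟨left_mem_Icc.2 h₁₀.le, hD₁⟩⟩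
  have hD₂' : D s₂ ≤ 0 := hD₂
  have hlt : s₂ < s₀ := lt_of_le_of_ne hs₂.2 fun h => by
    rw [h] at hD₂'
    linarith
  have hsub : Icc s₂ s₀ ⊆ Icc s₁ s₀ := Icc_subset_Icc_left hs₂.1
  have hIm : ∀ t ∈ Icc s₁ s₀, t ∈ Φ '' contracts := fun t ht =>
    (ordConnected_scores hΦ).out h₁ h₀ ht
  have hanti := surplus_strictAntiOn (E := E) hΦ hreg m
  have hge : ∀ t ∈ Icc s₁ s₀, E.surplus Φ s₀ m ≤ E.surplus Φ t m := fun t ht =>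
    hanti.antitoneOn (hIm t ht) h₀ ht.2
  have hprof : ∀ t ∈ Icc s₁ s₀, (t, m) ∈ E.profitable Φ := fun t ht =>
    ⟨hIm t ht, hm, hf.trans_lt (hu.trans_le (hge t ht))⟩
  have hDd : ∀ t ∈ Icc s₁ s₀, HasDerivAt D (deriv D t) t := fun t ht => by
    obtain ⟨x, -, y, -, h⟩ := hD t ht
    exact h.differentiableAt.hasDerivAt
  obtain ⟨ξ, hξ, hmvt⟩ := exists_ratio_hasDerivAt_eq_ratio_slope D (deriv D) hlt
    (hcont.mono hsub) (fun t ht => hDd t (hsub (Ioo_subset_Icc_self ht)))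
    (fun t => E.surplus Φ t m) (fun t => E.surplusDeriv Φ t m)
    (fun t ht => (hasDerivAt_surplus hΦ hreg (hprof t (hsub ht))).continuousAt.continuousWithinAt)
    (fun t ht => hasDerivAt_surplus hΦ hreg (hprof t (hsub (Ioo_subset_Icc_self ht))))
  have hξ' : ξ ∈ Icc s₁ s₀ := hsub (Ioo_subset_Icc_self hξ)
  refine ⟨ξ, hξ', ?_, ?_⟩
  · by_contra! hle
    exact absurd (hmax ⟨hξ', hle⟩) (not_le.2 hξ.1)
  intro x hx y hy hd
  rw [hd.deriv] at hmvt
  simp only [Sellers.decay] at hmvt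
  have hneg := surplusDeriv_neg hΦ hreg (hprof ξ hξ')
  have hvξ := hge ξ hξ'
  set V := E.surplus Φ ξ m
  set d := E.surplusDeriv Φ ξ m
  set u := E.surplus Φ s₀ m - f with hu_def
  have hu0 : 0 < u := sub_pos.2 hu
  have hVx : u / 2 ≤ V - x := by linarith [hx.2]
  have hVy : u / 2 ≤ V - y := by linarith [hy.2]
  have px : 0 < V - x := by linarith
  have py : 0 < V - y := by linarith
  have hgap : 0 < E.surplus Φ s₂ m - E.surplus Φ s₀ m :=
    sub_pos.2 (hanti (hIm s₂ hs₂) h₀ hlt)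
  have hgap' : E.surplus Φ s₂ m ≤ E.surplus Φ s₁ m :=
    hanti.antitoneOn h₁ (hIm s₂ hs₂) hs₂.1
  -- The mean value theorem, with the derivative of the surplus cancelled.
  have key : (E.surplus Φ s₂ m - E.surplus Φ s₀ m) * (y - x) =
      (D s₀ - D s₂) * ((V - x) * (V - y)) := by
    have h1 : -d / (V - y) - -d / (V - x) = -d * (y - x) / ((V - x) * (V - y)) := by
      field_simp
      ring
    rw [h1] at hmvt
    have h2 : d * ((E.surplus Φ s₂ m - E.surplus Φ s₀ m) * (y - x)) =
        d * ((D s₀ - D s₂) * ((V - x) * (V - y))) := by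
      have h3 := mul_pos px py
      field_simp at hmvt
      linarith
    exact mul_left_cancel₀ hneg.ne h2
  have hDpos : 0 < D s₀ - D s₂ := by linarith
  have hprod : u ^ 2 / 4 ≤ (V - x) * (V - y) := by
    have := mul_le_mul hVx hVy (by linarith) px.le
    nlinarith
  have hxy : 0 < y - x := by
    refine pos_of_mul_pos_right (a := E.surplus Φ s₂ m - E.surplus Φ s₀ m) ?_ hgap.le
    rw [key]
    positivity
  refine ⟨sub_pos.1 hxy, ?_⟩
  have h1 : D s₀ * (u ^ 2 / 4) ≤ (D s₀ - D s₂) * ((V - x) * (V - y)) :=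
    mul_le_mul (by linarith) hprod (by positivity) hDpos.le
  have h2 : (E.surplus Φ s₂ m - E.surplus Φ s₀ m) * (y - x) ≤
      (E.surplus Φ s₁ m - E.surplus Φ s₀ m) * (y - x) :=
    mul_le_mul_of_nonneg_right (by linarith) hxy.le
  linarith

/-- If types who bid between the scores of `(m, f + δ)` and `(m, f)` are added to the density, then
one of these two scores has to change, provided that `δ` is small. Otherwise the added mass `μ`
would be the rise of the winning probability at the score of `(m, f)`. By the first-order condition
the bidders at the intermediate scores would be displaced, in terms of the fixed cost, by a large
multiple of `μ`. By `winProb_sub_le` the displaced bidders have mass at most `μ`. -/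
theorem eventually_score_ne (hΦ : IsScoringRule Φ) (hreg : IsRegular E Φ)
    (H : IsContinuousEquilibrium E Φ g b) {c : ℝ} (hc0 : 0 < c)
    (hc : ∀ᵐ τ ∂volume.restrict E.types, c ≤ g τ) {m f : ℝ} (hm : m ∈ Ico E.mLo E.mHi)
    (hf : f ∈ Ioo E.fLo E.fHi) :
    ∀ᶠ δ in 𝓝[>] (0 : ℝ), ∀ (g' : ℝ × ℝ → ℝ) (b' : ℝ × ℝ → ℝ × ℝ) (X : Set (ℝ × ℝ))
      (h : ℝ × ℝ → ℝ) (ε : ℝ), IsContinuousEquilibrium E Φ g' b' → MeasurableSet X →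
      X ⊆ E.types → 0 < volume X → 0 < ε →
      (∀ τ ∈ X, Φ (b (m, f + δ)) < Φ (b τ) ∧ Φ (b τ) < Φ (b (m, f))) →
      (∀ τ ∈ E.types, Φ (b τ) < Φ (b (m, f)) → h τ = X.indicator 1 τ) →
      (∀ τ ∈ E.types, g' τ = g τ + ε * h τ) →
      Φ (b' (m, f)) = Φ (b (m, f)) → Φ (b' (m, f + δ)) ≠ Φ (b (m, f + δ)) := by
  have hmI : m ∈ Icc E.mLo E.mHi := Ico_subset_Icc_self hm
  have hfI := Ioo_subset_Icc_self hf
  have h₀ : Φ (b (m, f)) ∈ Φ '' contracts := H.score_mem ⟨hmI, hfI⟩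
  have hu : f < E.surplus Φ (Φ (b (m, f))) m := H.lt_surplus hΦ hreg (τ := (m, f)) ⟨hmI, hfI⟩ hf.2
  have hanti := H.score_strictAntiOn hΦ hreg hmI
  set s₀ := Φ (b (m, f)) with hs₀
  obtain ⟨r, hr, hrm, hband⟩ := exists_band hΦ hreg h₀ hm hf hu
  have hprof : (s₀, m) ∈ E.profitable Φ := profitable_of_lt h₀ ⟨hmI, hfI⟩ hu
  set u := E.surplus Φ s₀ m - f with hu_def
  have hu0 : 0 < u := sub_pos.2 hu
  have hshift : Tendsto (fun δ : ℝ => f + δ) (𝓝[>] 0) (𝓝 f) := by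
    have : Continuous fun δ : ℝ => f + δ := by fun_prop
    simpa using (this.tendsto 0).mono_left nhdsWithin_le_nhds
  have hscore : Tendsto (fun δ : ℝ => Φ (b (m, f + δ))) (𝓝[>] 0) (𝓝 s₀) :=
    ((H.continuousOn m hmI).continuousAt (Icc_mem_nhds hf.1 hf.2)).tendsto.comp hshift
  have hsurplus : Tendsto (fun δ : ℝ => E.surplus Φ (Φ (b (m, f + δ))) m) (𝓝[>] 0)
      (𝓝 (E.surplus Φ s₀ m)) :=
    (hasDerivAt_surplus hΦ hreg hprof).continuousAt.tendsto.comp hscore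
  have hsmall : 0 < c * r * u ^ 2 / 8 := by positivity
  filter_upwards [self_mem_nhdsWithin, hshift.eventually (gt_mem_nhds hf.2),
    nhdsWithin_le_nhds (gt_mem_nhds hr), nhdsWithin_le_nhds (gt_mem_nhds (half_pos hu0)),
    hscore.eventually (lt_mem_nhds (show s₀ - r < s₀ by linarith)),
    hsurplus.eventually (gt_mem_nhds (show E.surplus Φ s₀ m <
      E.surplus Φ s₀ m + c * r * u ^ 2 / 8 by linarith))]
    with δ hδ0 hδ1 hδ2 hδ3 hδ4 hδ5
  intro g' b' X h ε H' hX hXt hXpos hε hXs hh hg' he₀ he₁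
  have hδ : 0 < δ := hδ0
  set s₁ := Φ (b (m, f + δ)) with hs₁
  have hfδ : f + δ ∈ Ioo E.fLo E.fHi := ⟨by linarith [hf.1], hδ1⟩
  have hfδI := Ioo_subset_Icc_self hfδ
  have h₁₀ : s₁ < s₀ := hanti hfI hfδI (by linarith)
  have h₁ : s₁ ∈ Φ '' contracts := H.score_mem ⟨hmI, hfδI⟩
  have := isFiniteMeasure_types E
  have hXfin : volume X ≠ ⊤ := ne_top_of_le_ne_top
    (isCompact_Icc.prod isCompact_Icc : IsCompact E.types).measure_lt_top.ne (measure_mono hXt)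
  have hXr : 0 < volume.real X := ENNReal.toReal_pos hXpos.ne' hXfin
  have hpos : ∀ {g'' b''}, IsContinuousEquilibrium E Φ g'' b'' → Φ (b'' (m, f + δ)) = s₁ →
      ∀ t, s₁ ≤ t → 0 < winProb E Φ g'' b'' t := fun {g'' b''} H'' he t ht => by
    have := H''.winProb_pos hΦ hreg (τ := (m, f + δ)) ⟨hmI, hfδI⟩ hδ1
    rw [he] at this
    exact this.trans_le (H''.winProb_mono ht)
  -- The winning probability is unchanged at the lower score, and rises by the added mass at the
  -- upper score.
  have hW₁ : winProb E Φ g' b' s₁ = winProb E Φ g b s₁ := by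
    have h1 := H.winProb_sub_eq hΦ hreg H' hg' hmI hfδ rfl he₁
    rw [integral_eq_zero_of_ae, mul_zero] at h1
    · linarith
    · filter_upwards [ae_restrict_mem (measurableSet_types E)] with τ hτ
      refine indicator_apply_eq_zero.2 fun hτs => ?_
      rw [hh τ hτ (lt_trans hτs h₁₀)]
      exact indicator_of_notMem (fun hτX => lt_asymm hτs (hXs τ hτX).1) _
  have hW₀ : winProb E Φ g' b' s₀ - winProb E Φ g b s₀ = ε * volume.real X := by
    rw [H.winProb_sub_eq hΦ hreg H' hg' hmI hf rfl he₀]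
    congr 1
    have : volume.real X = ∫ τ in E.types, X.indicator (1 : ℝ × ℝ → ℝ) τ := by
      rw [integral_indicator_one hX, measureReal_restrict_apply hX, inter_eq_left.2 hXt]
    rw [this]
    refine integral_congr_ae ?_
    filter_upwards [ae_restrict_mem (measurableSet_types E)] with τ hτ
    by_cases hτs : Φ (b τ) < s₀
    · rw [indicator_of_mem (show τ ∈ {τ | Φ (b τ) < s₀} from hτs), hh τ hτ hτs]
    · rw [indicator_of_notMem (show τ ∉ {τ | Φ (b τ) < s₀} from hτs),
        indicator_of_notMem fun hτX => hτs (hXs τ hτX).2]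
  set D : ℝ → ℝ := fun t => Real.log (winProb E Φ g' b' t) - Real.log (winProb E Φ g b t) with hDdef
  have hbid : ∀ {g'' b''}, IsContinuousEquilibrium E Φ g'' b'' → Φ (b'' (m, f + δ)) = s₁ →
      Φ (b'' (m, f)) = s₀ → ∀ t ∈ Icc s₁ s₀, ∃ x ∈ Icc f (f + δ), Φ (b'' (m, x)) = t :=
    fun {g'' b''} H'' e1 e0 t ht => H''.exists_score_eq_of_mem_Icc hmI hfI hfδI (by linarith)
      (by rwa [e1, e0])
  have hIoo : ∀ x ∈ Icc f (f + δ), x ∈ Ioo E.fLo E.fHi := fun x hx =>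
    ⟨hf.1.trans_le hx.1, hx.2.trans_lt hδ1⟩
  have hderiv : ∀ t x y, x ∈ Icc f (f + δ) → y ∈ Icc f (f + δ) → Φ (b (m, x)) = t →
      Φ (b' (m, y)) = t → HasDerivAt D (E.decay Φ t (m, y) - E.decay Φ t (m, x)) t := by
    intro t x y hx hy hxt hyt
    have d1 := H.hasDerivAt_log_winProb hΦ hreg hmI (hIoo x hx)
    have d2 := H'.hasDerivAt_log_winProb hΦ hreg hmI (hIoo y hy)
    rw [hxt] at d1
    rw [hyt] at d2
    exact d2.fun_sub d1
  have hD₀ : ε * volume.real X ≤ D s₀ := by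
    have p1 := hpos H rfl s₀ h₁₀.le
    have p2 := hpos H' he₁ s₀ h₁₀.le
    have q := H'.winProb_le_one hΦ s₀
    have hlog := Real.one_sub_inv_le_log_of_pos (div_pos p2 p1)
    rw [Real.log_div p2.ne' p1.ne', inv_div] at hlog
    refine le_trans ?_ hlog
    have : 1 - winProb E Φ g b s₀ / winProb E Φ g' b' s₀ =
        ε * volume.real X / winProb E Φ g' b' s₀ := by
      rw [← hW₀]
      field_simp
    rw [this, le_div_iff₀ p2]
    exact mul_le_of_le_one_right (by positivity) q
  have hD₀pos : 0 < D s₀ := lt_of_lt_of_le (by positivity) hD₀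
  obtain ⟨ξ, hξ, hDξ, hdisp⟩ := exists_displacement hΦ hreg h₁ h₀ h₁₀ hmI hfI.1 hδ3.le hu
    (fun t ht => by
      obtain ⟨x, hx, hxt⟩ := hbid H rfl rfl t ht
      obtain ⟨y, hy, hyt⟩ := hbid H' he₁ he₀ t ht
      exact ⟨x, hx, y, hy, hderiv t x y hx hy hxt hyt⟩)
    (by simp [hDdef, hW₁]) hD₀pos
  obtain ⟨x, hx, hxξ⟩ := hbid H rfl rfl ξ hξ
  obtain ⟨y, hy, hyξ⟩ := hbid H' he₁ he₀ ξ hξ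
  obtain ⟨hxy, hineq⟩ := hdisp x hx y hy (hderiv ξ x y hx hy hxξ hyξ)
  have hWξ : winProb E Φ g b ξ < winProb E Φ g' b' ξ := by
    refine (Real.log_lt_log_iff (hpos H rfl ξ hξ.1) (hpos H' he₁ ξ hξ.1)).1 ?_
    simpa [hDdef] using hDξ
  have hle := H.winProb_sub_le hΦ hreg H' hc hX hXt hε hh hg' hξ.2 hmI (hIoo x hx) (hIoo y hy)
    hxy.le hxξ hyξ
  set T := {τ | τ ∈ E.types ∧ Φ (b τ) < ξ ∧ ¬ Φ (b' τ) < ξ} with hT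
  have hTvol : (y - x) / 2 * r ≤ volume.real T := by
    have hξr : |ξ - s₀| < r := by
      rw [abs_sub_comm, abs_of_nonneg (sub_nonneg.2 hξ.2)]
      linarith [hξ.1]
    have hcol : ∀ m' ∈ Icc m (m + r), ENNReal.ofReal ((y - x) / 2) ≤ volume {z | (m', z) ∈ T} := by
      intro m' hm'
      obtain ⟨lo, hi, hlo, hhi, hlen, hz⟩ := hband ξ hξr m' hm' x y hx.1 hxy (by linarith [hy.2])
      refine le_trans (ENNReal.ofReal_le_ofReal hlen) ?_
      rw [← Real.volume_Ioo]
      refine measure_mono fun z hzI => ?_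
      obtain ⟨z1, z2, z3⟩ := hz z hzI
      have hm'I : m' ∈ Icc E.mLo E.mHi := ⟨hmI.1.trans hm'.1, hm'.2.trans hrm⟩
      have hzf : z ∈ Ioo E.fLo E.fHi := ⟨hlo.trans_lt hzI.1, hzI.2.trans_le hhi⟩
      have i1 := H.score_lt_iff hΦ hreg hmI (hIoo x hx) hm'I hzf
      have i2 := H'.score_lt_iff hΦ hreg hmI (hIoo y hy) hm'I hzf
      rw [hxξ] at i1
      rw [hyξ] at i2
      refine ⟨⟨hm'I, Ioo_subset_Icc_self hzf⟩, i1.2 fun hcon => ?_, fun hcon => ?_⟩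
      · exact absurd z2 (not_lt.2 hcon.2)
      · exact i2.1 hcon ⟨z1, z3⟩
    have h1 := ofReal_mul_le_volume hcol
    rw [add_sub_cancel_left, ← ENNReal.ofReal_mul (by linarith)] at h1
    have hTfin : volume T ≠ ⊤ := ne_top_of_le_ne_top
      (isCompact_Icc.prod isCompact_Icc : IsCompact E.types).measure_lt_top.ne
      (measure_mono fun τ hτ => hτ.1)
    exact (ENNReal.ofReal_le_iff_le_toReal hTfin).1 h1
  have hyx : 0 < y - x := sub_pos.2 hxy
  have h1 : c * ((y - x) / 2 * r) < ε * volume.real X := by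
    have := mul_le_mul_of_nonneg_left hTvol hc0.le
    linarith
  have h2 : c * ((y - x) / 2 * r) * u ^ 2 <
      4 * (E.surplus Φ s₁ m - E.surplus Φ s₀ m) * (y - x) := by
    refine lt_of_lt_of_le ?_ hineq
    exact mul_lt_mul_of_pos_right (h1.trans_le hD₀) (by positivity)
  have h3 : 4 * (E.surplus Φ s₁ m - E.surplus Φ s₀ m) * (y - x) <
      4 * (c * r * u ^ 2 / 8) * (y - x) :=
    mul_lt_mul_of_pos_right (by linarith) hyx
  nlinarith

end IsContinuousEquilibrium

/-! ### Moments and mixtures of densities -/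

section Moments

variable {E : Sellers}

/-- The mixture of two densities with weights `1 - t` and `t`. -/
def mix (t : ℝ) (g₀ g₁ : ℝ × ℝ → ℝ) : ℝ × ℝ → ℝ := fun τ => (1 - t) * g₀ τ + t * g₁ τ

theorem integrable_mul {ζ g : ℝ × ℝ → ℝ} (hζ : Measurable ζ) (hB : ∃ B, ∀ τ ∈ E.types, |ζ τ| ≤ B)
    (hg : IntegrableOn g E.types) : Integrable (fun τ => ζ τ * g τ) (volume.restrict E.types) := by
  obtain ⟨B, hB⟩ := hB
  refine Integrable.bdd_mul hg hζ.aestronglyMeasurable (c := B) ?_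
  filter_upwards [ae_restrict_mem (measurableSet_types E)] with τ hτ
  exact hB τ hτ

theorem moment_lin {ζ g h : ℝ × ℝ → ℝ} (hζ : Measurable ζ)
    (hB : ∃ B, ∀ τ ∈ E.types, |ζ τ| ≤ B) (hg : IntegrableOn g E.types)
    (hh : IntegrableOn h E.types) (x y : ℝ) :
    E.moment ζ (fun τ => x * g τ + y * h τ) = x * E.moment ζ g + y * E.moment ζ h := by
  simp only [Sellers.moment]
  rw [← integral_const_mul, ← integral_const_mul, ← integral_add
    ((integrable_mul hζ hB hg).const_mul _) ((integrable_mul hζ hB hh).const_mul _)]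
  refine integral_congr_ae (Eventually.of_forall fun τ => ?_)
  simp only
  ring

theorem mix_mem {g₀ g₁ : ℝ × ℝ → ℝ} (h₀ : g₀ ∈ E.densities) (h₁ : g₁ ∈ E.densities) {t : ℝ}
    (ht : t ∈ Icc (0 : ℝ) 1) : mix t g₀ g₁ ∈ E.densities := by
  refine ⟨(h₀.1.const_mul _).add (h₁.1.const_mul _), ?_, ?_⟩
  · filter_upwards [h₀.2.1, h₁.2.1] with τ p₀ p₁
    rcases ht.1.eq_or_lt with rfl | h
    · simpa [mix] using p₀
    · exact add_pos_of_nonneg_of_pos (mul_nonneg (by linarith [ht.2]) p₀.le) (mul_pos h p₁)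
  · simp only [mix]
    rw [integral_add (h₀.1.const_mul _) (h₁.1.const_mul _), integral_const_mul,
      integral_const_mul, h₀.2.2, h₁.2.2]
    ring

theorem volume_types_pos (E : Sellers) : 0 < volume.real E.types := by
  refine ENNReal.toReal_pos ?_ (isCompact_Icc.prod isCompact_Icc).measure_lt_top.ne
  rw [Sellers.types, Measure.volume_eq_prod, Measure.prod_prod, Real.volume_Icc, Real.volume_Icc]
  simp only [ne_eq, mul_eq_zero, ENNReal.ofReal_eq_zero, not_or, not_le, sub_pos]
  exact ⟨E.mLo_lt, E.fLo_lt⟩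

theorem uniform_mem (E : Sellers) : (fun _ => (volume.real E.types)⁻¹) ∈ E.densities := by
  have := isFiniteMeasure_types E
  have h0 := volume_types_pos E
  refine ⟨integrable_const _, Eventually.of_forall fun _ => inv_pos.2 h0, ?_⟩
  rw [integral_const, smul_eq_mul, measureReal_restrict_apply_univ]
  exact mul_inv_cancel₀ h0.ne'

/-- The bid of a type is a continuous function of the density along segments. -/
theorem continuousOn_score_mix {Φ : ℝ × ℝ → ℝ} {strat : (ℝ × ℝ → ℝ) → ℝ × ℝ → ℝ × ℝ} {n : ℕ}
    (hΦ : IsScoringRule Φ) (heq : IsEquilibriumStrategy E Φ strat)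
    (hmom : IsMomentStrategy E n strat) {θ : ℝ × ℝ} (hθ : θ ∈ E.types) {g₀ g₁ : ℝ × ℝ → ℝ}
    (h₀ : g₀ ∈ E.densities) (h₁ : g₁ ∈ E.densities) :
    ContinuousOn (fun t => Φ (strat (mix t g₀ g₁) θ)) (Icc 0 1) := by
  obtain ⟨ζ, φ, hζ, hφ, hstrat⟩ := hmom θ hθ
  have hM : ∀ t ∈ Icc (0 : ℝ) 1, (fun i => E.moment (ζ i) (mix t g₀ g₁)) =
      fun i => (1 - t) * E.moment (ζ i) g₀ + t * E.moment (ζ i) g₁ := fun t _ =>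
    funext fun i => moment_lin (hζ i).1 (hζ i).2 h₀.1 h₁.1 _ _
  have hline : ContinuousOn (fun t : ℝ => fun i => (1 - t) * E.moment (ζ i) g₀ +
      t * E.moment (ζ i) g₁) (Icc 0 1) := by fun_prop
  have hcomp : ContinuousOn (fun t : ℝ => φ (fun i => (1 - t) * E.moment (ζ i) g₀ +
      t * E.moment (ζ i) g₁)) (Icc 0 1) := by
    refine hφ.continuousOn.comp hline fun t ht => ⟨mix t g₀ g₁, mix_mem h₀ h₁ ht, ?_⟩
    exact hM t ht
  have hbid : ContinuousOn (fun t => strat (mix t g₀ g₁) θ) (Icc 0 1) := by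
    refine hcomp.congr fun t ht => ?_
    simp only
    rw [hstrat _ (mix_mem h₀ h₁ ht), hM t ht]
  exact hΦ.smooth.continuousOn.comp hbid fun t ht => (heq _ (mix_mem h₀ h₁ ht)).bid_mem θ hθ

end Moments

namespace IsContinuousEquilibrium

variable {E : Sellers} {Φ : ℝ × ℝ → ℝ} {g : ℝ × ℝ → ℝ} {b : ℝ × ℝ → ℝ × ℝ}

/-- A set of positive measure of types who bid slightly less than `(m, y)`, although their marginal
costs are lower. -/
theorem exists_patch (hΦ : IsScoringRule Φ) (hreg : IsRegular E Φ)
    (H : IsContinuousEquilibrium E Φ g b) {m y z s : ℝ} (hm : m ∈ Ioo E.mLo E.mHi)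
    (hy : y ∈ Ioo E.fLo E.fHi) (hyz : y < z) (hs : s < Φ (b (m, y))) :
    ∃ X, MeasurableSet X ∧ X ⊆ E.types ∧ 0 < volume X ∧ (∀ τ ∈ X, τ.1 ≤ m ∧ τ.2 ≤ z) ∧
      ∀ τ ∈ X, s < Φ (b τ) ∧ Φ (b τ) < Φ (b (m, y)) := by
  have hmI := Ioo_subset_Icc_self hm
  have hyI := Ioo_subset_Icc_self hy
  have hlim : Tendsto (fun x => Φ (b (m, x))) (𝓝[>] y) (𝓝 (Φ (b (m, y)))) :=
    ((H.continuousOn m hmI).continuousAt (Icc_mem_nhds hy.1 hy.2)).tendsto.mono_left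
      nhdsWithin_le_nhds
  have hnear : ∀ᶠ x in 𝓝[>] y, x < min z E.fHi :=
    nhdsWithin_le_nhds (gt_mem_nhds (lt_min hyz hy.2))
  obtain ⟨x, hxs, hyx : y < x, hxz'⟩ := ((hlim.eventually (lt_mem_nhds hs)).and
    ((eventually_mem_nhdsWithin : ∀ᶠ x in 𝓝[>] y, x ∈ Ioi y).and hnear)).exists
  obtain ⟨hxz, hxhi⟩ := lt_min_iff.1 hxz'
  have hxI : x ∈ Ioo E.fLo E.fHi := ⟨hy.1.trans hyx, hxhi⟩
  have hxy := H.score_strictAntiOn hΦ hreg hmI hyI (Ioo_subset_Icc_self hxI) hyx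
  have hint : E.types ∈ 𝓝 (m, x) :=
    prod_mem_nhds (Icc_mem_nhds hm.1 hm.2) (Icc_mem_nhds hxI.1 hxI.2)
  have hcont := (H.continuousWithinAt_score hΦ hreg hmI hxI).continuousAt hint
  have hev : ∀ᶠ τ in 𝓝 (m, x), τ ∈ E.types ∧ τ.2 ≤ z ∧ s < Φ (b τ) ∧ Φ (b τ) < Φ (b (m, y)) := by
    filter_upwards [hint, hcont.eventually (lt_mem_nhds hxs), hcont.eventually (gt_mem_nhds hxy),
      continuous_snd.continuousAt.eventually (gt_mem_nhds (show (m, x).2 < z from hxz))]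
      with τ h1 h2 h3 h4
    exact ⟨h1, le_of_lt h4, h2, h3⟩
  obtain ⟨ρ, hρ, hball⟩ := Metric.eventually_nhds_iff_ball.1 hev
  have hX : ∀ τ ∈ Ioo (m - ρ) m ×ˢ Ioo (x - ρ) (x + ρ), τ ∈ Metric.ball (m, x) ρ := by
    rintro ⟨p, q⟩ ⟨⟨h1, h2⟩, h3, h4⟩
    simp only at h1 h2 h3 h4
    rw [Metric.mem_ball, Prod.dist_eq, max_lt_iff, Real.dist_eq, Real.dist_eq, abs_lt, abs_lt]
    exact ⟨⟨by linarith, by linarith⟩, by linarith, by linarith⟩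
  refine ⟨Ioo (m - ρ) m ×ˢ Ioo (x - ρ) (x + ρ), measurableSet_Ioo.prod measurableSet_Ioo,
    fun τ hτ => (hball τ (hX τ hτ)).1, ?_, fun τ hτ => ⟨hτ.1.2.le, (hball τ (hX τ hτ)).2.1⟩,
    fun τ hτ => (hball τ (hX τ hτ)).2.2⟩
  rw [Measure.volume_eq_prod, Measure.prod_prod, Real.volume_Ioo, Real.volume_Ioo]
  exact ENNReal.mul_pos (by simpa using hρ) (by simpa using hρ)

end IsContinuousEquilibrium

/-- A finite family of sets, larger than a finite family of moments, carries a nontrivial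
combination of indicators for which all the moments vanish. -/
theorem exists_moments_eq_zero (E : Sellers) {ι : Type*} [Fintype ι] {N : ℕ}
    (hN : Fintype.card ι < N) (η : ι → ℝ × ℝ → ℝ)
    (hη : ∀ r, Measurable (η r) ∧ ∃ B, ∀ τ ∈ E.types, |η r τ| ≤ B) (X : Fin N → Set (ℝ × ℝ))
    (hX : ∀ j, MeasurableSet (X j)) :
    ∃ a : Fin N → ℝ, a ≠ 0 ∧
      ∀ r, E.moment (η r) (fun τ => ∑ j, a j * (X j).indicator 1 τ) = 0 := by
  have := isFiniteMeasure_types E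
  let A : Matrix ι (Fin N) ℝ := fun r j => E.moment (η r) ((X j).indicator 1)
  obtain ⟨a, ha, ha0⟩ := Submodule.exists_mem_ne_zero_of_ne_bot
    (LinearMap.ker_ne_bot_of_finrank_lt (f := A.mulVecLin) (by simpa using hN))
  refine ⟨a, ha0, fun r => ?_⟩
  have h1 : ∑ j, E.moment (η r) ((X j).indicator 1) * a j = 0 :=
    congrFun (LinearMap.mem_ker.1 ha) r
  have hint : ∀ j, Integrable (fun τ => η r τ * (X j).indicator (1 : ℝ × ℝ → ℝ) τ)
      (volume.restrict E.types) := fun j =>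
    integrable_mul (hη r).1 (hη r).2
      ((integrable_indicator_iff (hX j)).2 (integrable_const _).integrableOn)
  have h2 : ∀ τ, η r τ * ∑ j, a j * (X j).indicator 1 τ =
      ∑ j, a j * (η r τ * (X j).indicator 1 τ) := fun τ => by
    rw [Finset.mul_sum]
    exact Finset.sum_congr rfl fun j _ => mul_left_comm _ _ _
  rw [← h1, Sellers.moment]
  simp only [h2]
  rw [integral_finsetSum _ fun j _ => (hint j).const_mul _]
  refine Finset.sum_congr rfl fun j _ => ?_
  rw [integral_const_mul, mul_comm]
  rfl

/-! ### Equilibrium invariance -/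

section Invariance

variable {E : Sellers} {Φ : ℝ × ℝ → ℝ} {strat : (ℝ × ℝ → ℝ) → ℝ × ℝ → ℝ × ℝ} {n : ℕ}

theorem isContinuousEquilibrium (heq : IsEquilibriumStrategy E Φ strat)
    (hcont : ScoreContinuousInFixedCost E Φ strat) {g : ℝ × ℝ → ℝ} (hg : g ∈ E.densities) :
    IsContinuousEquilibrium E Φ g (strat g) :=
  ⟨heq g hg, hg, hcont g hg⟩

/-- There are no arbitrarily large finite families of densities, bounded away from zero, at which a
type `(m, f)` bids the same score as types with a given marginal cost `m'` and different fixed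
costs. The densities are perturbed on sets `X j` of types who bid slightly less than `(m, f)` at
the `j`-th density, while they bid more at the later ones. -/
theorem not_forall_score_eq (hΦ : IsScoringRule Φ) (hreg : IsRegular E Φ)
    (heq : IsEquilibriumStrategy E Φ strat) (hcont : ScoreContinuousInFixedCost E Φ strat)
    (hmom : IsMomentStrategy E n strat) {m f m' c d : ℝ} (hm : m ∈ Ioo E.mLo E.mHi)
    (hf : f ∈ Ioo E.fLo E.fHi) (hm' : m' ∈ Ioo E.mLo E.mHi) (hc : 0 < c) (hd : 0 < d)
    (y : Fin (2 * n + 2) → ℝ) (hy : ∀ j, y j ∈ Ioo E.fLo E.fHi)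
    (hyd : ∀ i j, i < j → y i + d ≤ y j) (G : Fin (2 * n + 2) → ℝ × ℝ → ℝ)
    (hG : ∀ j, G j ∈ E.densities) (hGc : ∀ j, ∀ᵐ τ ∂volume.restrict E.types, c ≤ G j τ) :
    ¬ ∀ j, Φ (strat (G j) (m', y j)) = Φ (strat (G j) (m, f)) := by
  intro hS
  have := isFiniteMeasure_types E
  have hmI := Ioo_subset_Icc_self hm
  have hfI := Ioo_subset_Icc_self hf
  have hm'I := Ioo_subset_Icc_self hm'
  have H := fun j => isContinuousEquilibrium heq hcont (hG j)
  obtain ⟨δ, hδ, hδ0, hδf⟩ := ((eventually_all.2 fun j => (H j).eventually_score_ne hΦ hreg hc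
    (hGc j) ⟨hm.1.le, hm.2⟩ hf).and ((eventually_mem_nhdsWithin :
      ∀ᶠ δ in 𝓝[>] (0 : ℝ), δ ∈ Ioi (0 : ℝ)).and
        (nhdsWithin_le_nhds (gt_mem_nhds (sub_pos.2 hf.2))))).exists
  have hδ0 : 0 < δ := hδ0
  have hδf : δ < E.fHi - f := hδf
  have hfδ : f + δ ∈ Icc E.fLo E.fHi := ⟨by linarith [hf.1], by linarith⟩
  have hpatch := fun j => (H j).exists_patch hΦ hreg hm' (hy j) (lt_add_of_pos_right (y j) hd)
    (s := Φ (strat (G j) (m, f + δ)))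
    (by rw [hS j]; exact (H j).score_strictAntiOn hΦ hreg hmI hfI hfδ (by linarith))
  choose X hXm hXt hXpos hXle hXs using hpatch
  obtain ⟨ζ, φ, hζ, -, hφ⟩ := hmom (m, f) ⟨hmI, hfI⟩
  obtain ⟨ζ', φ', hζ', -, hφ'⟩ := hmom (m, f + δ) ⟨hmI, hfδ⟩
  -- The moments of both types, and the total mass.
  obtain ⟨a, ha0, ha⟩ := exists_moments_eq_zero E (ι := Fin n ⊕ Fin n ⊕ Unit) (N := 2 * n + 2)
    (by simp only [Fintype.card_sum, Fintype.card_fin, Fintype.card_unit]; omega)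
    (Sum.elim ζ (Sum.elim ζ' fun _ _ => 1))
    (by
      rintro (i | i | i)
      · exact hζ i
      · exact hζ' i
      · exact ⟨measurable_const, 1, fun τ _ => by simp⟩) X hXm
  have hne : (Finset.univ.filter fun j => a j ≠ 0).Nonempty := by
    obtain ⟨j, hj⟩ := Function.ne_iff.1 ha0
    exact ⟨j, by simpa using hj⟩
  set i := (Finset.univ.filter fun j => a j ≠ 0).max' hne with hi
  have hai : a i ≠ 0 := (Finset.mem_filter.1 (Finset.max'_mem _ hne)).2
  have hmax : ∀ j, i < j → a j = 0 := fun j hj => by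
    by_contra h
    exact absurd (Finset.le_max' _ j (Finset.mem_filter.2 ⟨Finset.mem_univ _, h⟩)) (not_le.2 hj)
  set k : ℝ × ℝ → ℝ := fun τ => ∑ j, a j * (X j).indicator 1 τ with hk
  set h : ℝ × ℝ → ℝ := fun τ => (a i)⁻¹ * k τ with hh
  have hkint : IntegrableOn k E.types := integrable_finsetSum _ fun j _ =>
    ((integrable_indicator_iff (hXm j)).2 (integrable_const _).integrableOn).const_mul _
  have hhint : IntegrableOn h E.types := hkint.const_mul _
  set B := |(a i)⁻¹| * ∑ j, |a j| with hB
  have hB0 : 0 ≤ B := by positivity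
  have hhB : ∀ τ, -B ≤ h τ := by
    intro τ
    have h1 : |h τ| ≤ B := by
      rw [hh, abs_mul]
      refine mul_le_mul_of_nonneg_left ((Finset.abs_sum_le_sum_abs _ _).trans
        (Finset.sum_le_sum fun j _ => ?_)) (abs_nonneg _)
      rw [abs_mul]
      refine mul_le_of_le_one_right (abs_nonneg _) ?_
      by_cases hτ : τ ∈ X j <;> simp [hτ]
    exact (abs_le.1 h1).1
  set ε := c / (B + 1) with hε
  have hε0 : 0 < ε := by positivity
  have hεB : ε * B < c := by
    rw [hε, div_mul_eq_mul_div, div_lt_iff₀ (by linarith)]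
    nlinarith
  set g' : ℝ × ℝ → ℝ := fun τ => 1 * G i τ + (ε * (a i)⁻¹) * k τ with hg'
  have hg'h : ∀ τ, g' τ = G i τ + ε * h τ := fun τ => by
    simp only [hg', hh]; ring
  have hmoment : ∀ ξ : ℝ × ℝ → ℝ, Measurable ξ → (∃ B, ∀ τ ∈ E.types, |ξ τ| ≤ B) →
      E.moment ξ k = 0 → E.moment ξ g' = E.moment ξ (G i) := fun ξ h1 h2 h3 => by
    rw [hg', moment_lin h1 h2 (hG i).1 hkint, h3]
    ring
  have hg'mem : g' ∈ E.densities := by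
    refine ⟨((hG i).1.const_mul _).add (hkint.const_mul _), ?_, ?_⟩
    · filter_upwards [hGc i] with τ hτ
      rw [hg'h]
      have := mul_le_mul_of_nonneg_left (hhB τ) hε0.le
      linarith
    · have h1 := hmoment (fun _ => 1) measurable_const ⟨1, fun τ _ => by simp⟩
        (ha (Sum.inr (Sum.inr ())))
      simp only [Sellers.moment, one_mul] at h1
      rw [h1, (hG i).2.2]
  refine hδ i g' (strat g') (X i) h ε (isContinuousEquilibrium heq hcont hg'mem) (hXm i) (hXt i)
    (hXpos i) hε0 (fun τ hτ => ?_) (fun τ hτ hτs => ?_) (fun τ _ => hg'h τ) ?_ ?_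
  · have := hXs i τ hτ
    rwa [hS i] at this
  · have h1 : k τ = a i * (X i).indicator 1 τ := by
      refine Finset.sum_eq_single i (fun j _ hj => ?_) (by simp)
      rcases lt_or_gt_of_ne hj with hj | hj
      · -- The types in `X j` are better than `(m', y i)`, hence bid at least the score of `(m, f)`.
        rw [indicator_of_notMem, mul_zero]
        intro hτj
        have h2 := (H i).score_antitoneOn hΦ hreg hτ
          (show (m', y i) ∈ E.types from ⟨hm'I, Ioo_subset_Icc_self (hy i)⟩)
          ⟨(hXle j τ hτj).1, (hXle j τ hτj).2.trans (hyd j i hj)⟩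
        simp only [hS i] at h2
        exact absurd hτs (not_lt.2 h2)
      · rw [hmax j hj, zero_mul]
    rw [hh]
    simp only
    rw [h1, inv_mul_cancel_left₀ hai]
  · rw [hφ _ hg'mem, hφ _ (hG i)]
    congr 2
    exact funext fun r => hmoment _ (hζ r).1 (hζ r).2 (ha (Sum.inl r))
  · rw [hφ' _ hg'mem, hφ' _ (hG i)]
    congr 2
    exact funext fun r => hmoment _ (hζ' r).1 (hζ' r).2 (ha (Sum.inr (Sum.inl r)))

/-- The order of two interior types is not reversed between two densities. Otherwise, on the
segment between the densities, it would also be reversed for types slightly worse than the second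
one, and each of these would tie with the first one at some density. -/
theorem not_score_lt_of_interior (hΦ : IsScoringRule Φ) (hreg : IsRegular E Φ)
    (heq : IsEquilibriumStrategy E Φ strat) (hcont : ScoreContinuousInFixedCost E Φ strat)
    (hmom : IsMomentStrategy E n strat) {m f m' f' : ℝ} (hm : m ∈ Ioo E.mLo E.mHi)
    (hf : f ∈ Ioo E.fLo E.fHi) (hm' : m' ∈ Ioo E.mLo E.mHi) (hf' : f' ∈ Ioo E.fLo E.fHi)
    {g₀ g₁ : ℝ × ℝ → ℝ} (hg₀ : g₀ ∈ E.densities) (hg₁ : g₁ ∈ E.densities)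
    (h₀ : Φ (strat g₀ (m', f')) < Φ (strat g₀ (m, f))) :
    ¬ Φ (strat g₁ (m, f)) < Φ (strat g₁ (m', f')) := by
  intro h₁
  have hθ : (m, f) ∈ E.types := ⟨Ioo_subset_Icc_self hm, Ioo_subset_Icc_self hf⟩
  have hm'I := Ioo_subset_Icc_self hm'
  have hθ' : (m', f') ∈ E.types := ⟨hm'I, Ioo_subset_Icc_self hf'⟩
  -- Mixing with the uniform density makes the densities bounded away from zero.
  set U : ℝ × ℝ → ℝ := fun _ => (volume.real E.types)⁻¹ with hU
  have hUmem : U ∈ E.densities := uniform_mem E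
  have hV := volume_types_pos E
  have hmix0 : ∀ g : ℝ × ℝ → ℝ, mix 0 g U = g := fun g => by
    funext τ; simp [mix]
  have hlim : ∀ {g θ}, g ∈ E.densities → θ ∈ E.types →
      Tendsto (fun κ => Φ (strat (mix κ g U) θ)) (𝓝[Ioo 0 1] 0) (𝓝 (Φ (strat g θ))) :=
    fun {g θ} hg hθ => by
      have h := (continuousOn_score_mix hΦ heq hmom hθ hg hUmem 0 (by simp)).tendsto
      rw [hmix0] at h
      exact h.mono_left (nhdsWithin_mono _ Ioo_subset_Icc_self)
  have : (𝓝[Ioo (0 : ℝ) 1] 0).NeBot := by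
    rw [nhdsWithin_Ioo_eq_nhdsGT zero_lt_one]; infer_instance
  obtain ⟨κ, hκ₀, hκ₁, hκ⟩ := (((hlim hg₀ hθ').eventually_lt (hlim hg₀ hθ) h₀).and
    (((hlim hg₁ hθ).eventually_lt (hlim hg₁ hθ') h₁).and
      (eventually_mem_nhdsWithin : ∀ᶠ κ in 𝓝[Ioo (0 : ℝ) 1] 0, κ ∈ Ioo (0 : ℝ) 1))).exists
  set c := κ * (volume.real E.types)⁻¹ with hc
  have hc0 : 0 < c := mul_pos hκ.1 (inv_pos.2 hV)
  have hmixc : ∀ g ∈ E.densities, ∀ᵐ τ ∂volume.restrict E.types, c ≤ mix κ g U τ := by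
    intro g hg
    filter_upwards [hg.2.1] with τ hτ
    have : 0 ≤ (1 - κ) * g τ := mul_nonneg (by linarith [hκ.2]) hτ.le
    simp only [mix, hU, hc]
    linarith
  set k₀ := mix κ g₀ U with hk₀
  set k₁ := mix κ g₁ U with hk₁
  have hk₀mem : k₀ ∈ E.densities := mix_mem hg₀ hUmem (Ioo_subset_Icc_self hκ)
  have hk₁mem : k₁ ∈ E.densities := mix_mem hg₁ hUmem (Ioo_subset_Icc_self hκ)
  -- The reversal persists for slightly higher fixed costs of the second type.
  have hcol : Tendsto (fun x => Φ (strat k₁ (m', x))) (𝓝[>] f') (𝓝 (Φ (strat k₁ (m', f')))) :=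
    ((hcont k₁ hk₁mem m' hm'I).continuousAt (Icc_mem_nhds hf'.1 hf'.2)).tendsto.mono_left
      nhdsWithin_le_nhds
  obtain ⟨z, hz₁, hz, hzhi⟩ := ((hcol.eventually (lt_mem_nhds hκ₁)).and
    ((eventually_mem_nhdsWithin : ∀ᶠ x in 𝓝[>] f', x ∈ Ioi f').and
      (nhdsWithin_le_nhds (gt_mem_nhds hf'.2)))).exists
  have hz : f' < z := hz
  have hzhi : z < E.fHi := hzhi
  set d := (z - f') / (2 * n + 2 : ℝ) with hd
  have hn : (0 : ℝ) < 2 * n + 2 := by positivity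
  have hd0 : 0 < d := div_pos (sub_pos.2 hz) hn
  set y : Fin (2 * n + 2) → ℝ := fun j => f' + (j : ℕ) * d with hy
  have hymem : ∀ j, f' ≤ y j ∧ y j ≤ z := fun j => by
    have h1 : ((j : ℕ) : ℝ) ≤ 2 * n + 2 := by
      have := j.2.le
      exact_mod_cast this
    have h2 : ((j : ℕ) : ℝ) * d ≤ (2 * n + 2) * d := mul_le_mul_of_nonneg_right h1 hd0.le
    have h3 : (2 * n + 2 : ℝ) * d = z - f' := mul_div_cancel₀ _ hn.ne'
    have h4 : 0 ≤ ((j : ℕ) : ℝ) * d := by positivity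
    exact ⟨by simp only [hy]; linarith, by simp only [hy]; linarith⟩
  have hyI : ∀ j, y j ∈ Ioo E.fLo E.fHi := fun j =>
    ⟨hf'.1.trans_le (hymem j).1, (hymem j).2.trans_lt hzhi⟩
  have hyd : ∀ i j, i < j → y i + d ≤ y j := fun i j hij => by
    have h1 : ((i : ℕ) : ℝ) + 1 ≤ (j : ℕ) := by exact_mod_cast hij
    have h2 := mul_le_mul_of_nonneg_right h1 hd0.le
    simp only [hy]
    linarith
  have hty : ∀ j, (m', y j) ∈ E.types := fun j => ⟨hm'I, Ioo_subset_Icc_self (hyI j)⟩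
  have htie : ∀ j, ∃ t ∈ Icc (0 : ℝ) 1,
      Φ (strat (mix t k₀ k₁) (m', y j)) = Φ (strat (mix t k₀ k₁) (m, f)) := by
    intro j
    have e0 : mix 0 k₀ k₁ = k₀ := by funext τ; simp [mix]
    have e1 : mix 1 k₀ k₁ = k₁ := by funext τ; simp [mix]
    have hK₀ := isContinuousEquilibrium heq hcont hk₀mem
    have hK₁ := isContinuousEquilibrium heq hcont hk₁mem
    have hz' : (m', z) ∈ E.types := ⟨hm'I, (hf'.1.trans hz).le, hzhi.le⟩
    have l0 : Φ (strat k₀ (m', y j)) < Φ (strat k₀ (m, f)) :=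
      lt_of_le_of_lt (hK₀.score_antitoneOn hΦ hreg hθ' (hty j) ⟨le_rfl, (hymem j).1⟩) hκ₀
    have l1 : Φ (strat k₁ (m, f)) < Φ (strat k₁ (m', y j)) :=
      lt_of_lt_of_le hz₁ (hK₁.score_antitoneOn hΦ hreg (hty j) hz' ⟨le_rfl, (hymem j).2⟩)
    obtain ⟨t, ht, hts⟩ := intermediate_value_Icc zero_le_one
      ((continuousOn_score_mix hΦ heq hmom (hty j) hk₀mem hk₁mem).sub
        (continuousOn_score_mix hΦ heq hmom hθ hk₀mem hk₁mem))
      (show (0 : ℝ) ∈ Icc _ _ by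
        simp only [Pi.sub_apply, e0, e1]
        exact ⟨by linarith, by linarith⟩)
    exact ⟨t, ht, sub_eq_zero.1 hts⟩
  choose t ht hts using htie
  refine not_forall_score_eq hΦ hreg heq hcont hmom hm hf hm' hc0 hd0 y hyI hyd
    (fun j => mix (t j) k₀ k₁) (fun j => mix_mem hk₀mem hk₁mem (ht j)) (fun j => ?_) hts
  filter_upwards [hmixc g₀ hg₀, hmixc g₁ hg₁] with τ h1 h2
  have h3 := mul_le_mul_of_nonneg_left h1 (sub_nonneg.2 (ht j).2)
  have h4 := mul_le_mul_of_nonneg_left h2 (ht j).1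
  change c ≤ (1 - t j) * mix κ g₀ U τ + t j * mix κ g₁ U τ
  linarith

theorem not_score_lt (hΦ : IsScoringRule Φ) (hreg : IsRegular E Φ)
    (heq : IsEquilibriumStrategy E Φ strat) (hcont : ScoreContinuousInFixedCost E Φ strat)
    (hmom : IsMomentStrategy E n strat) {m f m' f' : ℝ} (hm : m ∈ Icc E.mLo E.mHi)
    (hf : f ∈ Ioo E.fLo E.fHi) (hm' : m' ∈ Icc E.mLo E.mHi) (hf' : f' ∈ Ioo E.fLo E.fHi)
    {g₀ g₁ : ℝ × ℝ → ℝ} (hg₀ : g₀ ∈ E.densities) (hg₁ : g₁ ∈ E.densities)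
    (h₀ : Φ (strat g₀ (m', f')) < Φ (strat g₀ (m, f))) :
    ¬ Φ (strat g₁ (m, f)) < Φ (strat g₁ (m', f')) := by
  intro h₁
  have hlim : ∀ {g x y}, g ∈ E.densities → x ∈ Icc E.mLo E.mHi → y ∈ Ioo E.fLo E.fHi →
      Tendsto (fun z => Φ (strat g (z, y))) (𝓝[Ioo E.mLo E.mHi] x) (𝓝 (Φ (strat g (x, y)))) := by
    intro g x y hg hx hy
    refine ((isContinuousEquilibrium heq hcont hg).continuousWithinAt_score hΦ hreg hx
      hy).tendsto.comp (f := fun z => (z, y)) (tendsto_nhdsWithin_iff.2 ⟨?_, ?_⟩)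
    · refine tendsto_nhdsWithin_of_tendsto_nhds ?_
      have : Continuous fun z : ℝ => (z, y) := by fun_prop
      exact this.tendsto x
    · filter_upwards [self_mem_nhdsWithin] with z hz
      exact ⟨Ioo_subset_Icc_self hz, Ioo_subset_Icc_self hy⟩
  have hne : ∀ {x}, x ∈ Icc E.mLo E.mHi → (𝓝[Ioo E.mLo E.mHi] x).NeBot := fun hx =>
    mem_closure_iff_nhdsWithin_neBot.1 (by rwa [closure_Ioo E.mLo_lt.ne])
  have := hne hm
  have := hne hm'
  obtain ⟨x, hx₀, hx₁, hx⟩ := (((hlim hg₀ hm hf).eventually (lt_mem_nhds h₀)).and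
    (((hlim hg₁ hm hf).eventually (gt_mem_nhds h₁)).and
      (eventually_mem_nhdsWithin : ∀ᶠ z in 𝓝[Ioo E.mLo E.mHi] m, z ∈ _))).exists
  obtain ⟨x', hx'₀, hx'₁, hx'⟩ := (((hlim hg₀ hm' hf').eventually (gt_mem_nhds hx₀)).and
    (((hlim hg₁ hm' hf').eventually (lt_mem_nhds hx₁)).and
      (eventually_mem_nhdsWithin : ∀ᶠ z in 𝓝[Ioo E.mLo E.mHi] m', z ∈ _))).exists
  exact not_score_lt_of_interior hΦ hreg heq hcont hmom hx hf hx' hf' hg₀ hg₁ hx'₀ hx'₁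

/-- A strict ranking at one density is preserved at all others, including for types on the boundary
of the type space: two types with the same marginal cost fit strictly between the given ones, and
their order does not depend on the density. -/
theorem score_lt_of_score_lt (hΦ : IsScoringRule Φ) (hreg : IsRegular E Φ)
    (heq : IsEquilibriumStrategy E Φ strat) (hcont : ScoreContinuousInFixedCost E Φ strat)
    (hmom : IsMomentStrategy E n strat) {θ θ' : ℝ × ℝ} (hθ : θ ∈ E.types) (hθ' : θ' ∈ E.types)
    {g₀ g₁ : ℝ × ℝ → ℝ} (hg₀ : g₀ ∈ E.densities) (hg₁ : g₁ ∈ E.densities)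
    (h : Φ (strat g₀ θ) < Φ (strat g₀ θ')) : Φ (strat g₁ θ) < Φ (strat g₁ θ') := by
  obtain ⟨m, f⟩ := θ
  obtain ⟨m', f'⟩ := θ'
  have H₀ := isContinuousEquilibrium heq hcont hg₀
  have H₁ := isContinuousEquilibrium heq hcont hg₁
  have hlim : ∀ {g x y}, g ∈ E.densities → x ∈ Icc E.mLo E.mHi → y ∈ Icc E.fLo E.fHi →
      Tendsto (fun z => Φ (strat g (x, z))) (𝓝[Ioo E.fLo E.fHi] y) (𝓝 (Φ (strat g (x, y)))) :=
    fun hg hx hy => ((hcont _ hg _ hx) _ hy).tendsto.mono_left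
      (nhdsWithin_mono _ Ioo_subset_Icc_self)
  have hne : ∀ {y}, y ∈ Icc E.fLo E.fHi → (𝓝[Ioo E.fLo E.fHi] y).NeBot := fun hy =>
    mem_closure_iff_nhdsWithin_neBot.1 (by rwa [closure_Ioo E.fLo_lt.ne])
  have := hne hθ.2
  have := hne hθ'.2
  obtain ⟨s, hs₁, hs₂⟩ := exists_between h
  -- The scores bid by the types with interior fixed costs form an interval.
  obtain ⟨⟨μ, x⟩, ⟨hμ, hx⟩, hμx⟩ : s ∈ (fun τ => Φ (strat g₀ τ)) ''
      (Icc E.mLo E.mHi ×ˢ Ioo E.fLo E.fHi) := by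
    have hpre : IsPreconnected ((fun τ => Φ (strat g₀ τ)) ''
        (Icc E.mLo E.mHi ×ˢ Ioo E.fLo E.fHi)) := by
      refine ((convex_Icc _ _).prod (convex_Ioo _ _)).isPreconnected.image _ ?_
      rintro ⟨p, q⟩ ⟨hp, hq⟩
      exact (H₀.continuousWithinAt_score hΦ hreg hp hq).mono
        (prod_mono_right Ioo_subset_Icc_self)
    obtain ⟨z, hz, hzI⟩ := (((hlim hg₀ hθ.1 hθ.2).eventually (gt_mem_nhds hs₁)).and
      eventually_mem_nhdsWithin).exists
    obtain ⟨z', hz', hz'I⟩ := (((hlim hg₀ hθ'.1 hθ'.2).eventually (lt_mem_nhds hs₂)).and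
      eventually_mem_nhdsWithin).exists
    exact hpre.ordConnected.out (mem_image_of_mem _ (mk_mem_prod hθ.1 hzI))
      (mem_image_of_mem _ (mk_mem_prod hθ'.1 hz'I)) ⟨hz.le, hz'.le⟩
  simp only at hμx
  have hxI := Ioo_subset_Icc_self hx
  have hat : Tendsto (fun z => Φ (strat g₀ (μ, z))) (𝓝 x) (𝓝 s) := by
    have := ((hcont g₀ hg₀ μ hμ).continuousAt (Icc_mem_nhds hx.1 hx.2)).tendsto
    rwa [hμx] at this
  obtain ⟨ε, hε, hball⟩ := Metric.eventually_nhds_iff_ball.1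
    ((hat.eventually (Ioo_mem_nhds hs₁ hs₂)).and (Ioo_mem_nhds hx.1 hx.2))
  obtain ⟨⟨ha, -⟩, haI⟩ := hball (x + ε / 2) (by
    rw [Metric.mem_ball, Real.dist_eq, abs_lt]; constructor <;> linarith)
  obtain ⟨⟨-, hb⟩, hbI⟩ := hball (x - ε / 2) (by
    rw [Metric.mem_ball, Real.dist_eq, abs_lt]; constructor <;> linarith)
  have h1 : Φ (strat g₁ (m, f)) ≤ Φ (strat g₁ (μ, x + ε / 2)) := by
    refine le_of_tendsto (hlim hg₁ hθ.1 hθ.2) ?_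
    filter_upwards [(hlim hg₀ hθ.1 hθ.2).eventually (gt_mem_nhds ha), self_mem_nhdsWithin]
      with z hz hzI
    exact not_lt.1 (not_score_lt hΦ hreg heq hcont hmom hμ haI hθ.1 hzI hg₀ hg₁ hz)
  have h2 : Φ (strat g₁ (μ, x - ε / 2)) ≤ Φ (strat g₁ (m', f')) := by
    refine ge_of_tendsto (hlim hg₁ hθ'.1 hθ'.2) ?_
    filter_upwards [(hlim hg₀ hθ'.1 hθ'.2).eventually (lt_mem_nhds hb), self_mem_nhdsWithin]
      with z hz hzI
    exact not_lt.1 (not_score_lt hΦ hreg heq hcont hmom hθ'.1 hzI hμ hbI hg₀ hg₁ hz)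
  have h3 := H₁.score_strictAntiOn hΦ hreg hμ (Ioo_subset_Icc_self hbI)
    (Ioo_subset_Icc_self haI) (by linarith)
  exact h1.trans_lt (h3.trans_le h2)

end Invariance

end ScoreAuction

theorem mainTheorem2 (E : ScoreAuction.Sellers) (Φ : ℝ × ℝ → ℝ)
    (hΦ : ScoreAuction.IsScoringRule Φ) (hreg : ScoreAuction.IsRegular E Φ)
    (strat : (ℝ × ℝ → ℝ) → ℝ × ℝ → ℝ × ℝ)
    (heq : ScoreAuction.IsEquilibriumStrategy E Φ strat)
    (hcont : ScoreAuction.ScoreContinuousInFixedCost E Φ strat)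
    (hmom : ∃ n : ℕ, ScoreAuction.IsMomentStrategy E n strat) :
    ScoreAuction.EquilibriumInvariance E Φ strat := by
  obtain ⟨n, hmom⟩ := hmom
  intro g₁ hg₁ g₂ hg₂ θ₁ hθ₁ θ₂ hθ₂
  simp only [ScoreAuction.RanksAbove, ← not_lt]
  exact not_congr ⟨ScoreAuction.score_lt_of_score_lt hΦ hreg heq hcont hmom hθ₁ hθ₂ hg₁ hg₂,
    ScoreAuction.score_lt_of_score_lt hΦ hreg heq hcont hmom hθ₁ hθ₂ hg₂ hg₁⟩
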